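/- Let $a,b,\beta$ be real with $b\le a$, $a\neq\pm b$, $\beta\neq0$, and put $\alpha=-\tfrac12(a+b)$, so that $a,\ b,\ \alpha\pm i\beta$ are the roots of $u^4-cu^2-2eu+d$ with $c=-(ab+2\alpha(a+b)+\alpha^2+\beta^2)$, $2e=2\alpha ab+(a+b)(\alpha^2+\beta^2)$, $d=ab(\alpha^2+\beta^2)$. Let $$U_{a,b}(x)=a+\frac{(b-a)(1-\mathrm{cn}(\nu x;\kappa))}{1+\delta+(\delta-1)\,\mathrm{cn}(\nu x;\kappa)},$$ where, with $A=(a-\alpha)^2+\beta^2$ and $B=(b-\alpha)^2+\beta^2$, $\delta=\sqrt{B/A}$, $\nu=(AB)^{1/4}$, $2\kappa^2=1-\frac{(a-\alpha)(b-\alpha)+\beta^2}{\sqrt{AB}}$; its period is $L=4K(\kappa)/\nu$. Then $u(x,t)=U_{a,b}(x-ct)$ is a periodic travelling wave of the mKdV equation $u_t+6u^2u_x+u_{xxx}=0$. The symmetry $(S_0)$ is $a\leftrightarrow b$, which turns $U_{a,b}$ into $U_{b,a}$. Let $$\lambda_{1}=\tfrac14(a-b)+\tfrac i2\beta,\qquad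 \lambda_2=\bar\lambda_1,\qquad \lambda_3=\tfrac12(a+b).$$ For $\lambda=\lambda_j$ consider the Lax system $$\varphi_x=\begin{pmatrix}\lambda&u\\-u&-\lambda\end{pmatrix}\varphi,\qquad \varphi_t=\begin{pmatrix}-4\lambda^3-2\lambda u^2&-4\lambda^2u-2\lambda u_x-2u^3-u_{xx}\\4\lambda^2u-2\lambda u_x+2u^3+u_{xx}&4\lambda^3+2\lambda u^2\end{pmatrix}\varphi,\qquad \varphi=(p,q)^t .$$ A periodic eigenfunction is a nonzero solution of the form $\Phi(x-ct)$ with $\Phi(y+L)=\Phi(y)$ for all $y$ or $\Phi(y+L)=-\Phi(y)$ for all $y$. A second solution is a solution for the same $\lambda$ that is linearly independent of a periodic eigenfunction. Assume the two non-degeneracy conditions $$\mathrm{Im}\,\frac1L\int_0^L\frac{\lambda_1^2\,(2i\beta(a-b)-(a+b)^2+4U_{a,b}^2)}{(e+4\lambda_1^2U_{a,b})^2}\,dy\neq0,\qquad \frac1L\int_0^L\frac{\lambda_3^2\,(4\beta^2+a^2+b^2+6ab+8U_{a,b}^2)}{(e+4\lambda_3^2U_{a,b})^2}\,dy\neq0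 .$$ **Existence and growth of the second solutions.** Second solutions exist for $\lambda_1$, $\lambda_2$ and $\lambda_3$; the complex conjugate of a second solution for $\lambda_1$ is one for $\lambda_2$, and for $\lambda_3$ there is a real one. Every second solution $\hat\varphi$ for $\lambda_1$ or $\lambda_2$ grows linearly everywhere: $m(|x|+|t|)-M\le\|\hat\varphi(x,t)\|\le M(1+|x|+|t|)$ for all $x,t$, for some $m>0$ and $M$. There is $c_0\neq c$ such that every second solution for $\lambda_3$ grows linearly except along a line $x-c_0t=\xi_0$, where the phase $\xi_0\in\mathbb R$ may be chosen arbitrarily: for some $m>0$ and $M$, $m|x-c_0t-\xi_0|-M\le\|\hat\varphi(x,t)\|\le M(1+|x-c_0t-\xi_0|)$ for all $x,t$. **Darboux transformations.** In the following, $\hat\varphi_1$ is any second solution for $\lambda_1$, $\hat\varphi_2=\overline{\hat\varphi_1}$, $\hat\varphi_3$ is any real second solution for $\lambda_3$, and $(p_j,q_j)$ are the components of $\hat\varphi_j$. The denominators of the three transformations vanish nowhere, and the results $\hat u$ are real classical solutions of the mKdV equation. 1. The one-fold transformation $\hat u=u+\dfrac{4\lambda_3p_3q_3}{p_3^2+q_3^2}$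 is an algebraic soliton of speed $c_0$ on the background of the wave $-U_{b,a}(x-ct)$ (the wave $u$ transformed by $(S_0)$ and reflected). 2. The two-fold transformation $$\hat u=u+\frac{4(\lambda_1^2-\lambda_2^2)\,[\lambda_1p_1q_1(p_2^2+q_2^2)-\lambda_2p_2q_2(p_1^2+q_1^2)]}{(\lambda_1^2+\lambda_2^2)(p_1^2+q_1^2)(p_2^2+q_2^2)-2\lambda_1\lambda_2[4p_1q_1p_2q_2+(p_1^2-q_1^2)(p_2^2-q_2^2)]}$$ is a rogue wave on the background of the wave $U_{b,a}(x-ct)$ (the wave $u$ transformed by $(S_0)$). 3. The three-fold transformation $\hat u=u+4N/D$ with $\lambda_1,\lambda_2,\lambda_3$ contains both an algebraic soliton of speed $c_0$ and a rogue wave on the background of the reflected wave $-u$. Here, with $P_j=p_j^2+q_j^2$, $Q_j=p_j^2-q_j^2$, and with $(i,j,k)$ running through $(1,2,3)$, $(2,1,3)$, $(3,1,2)$, $$N=\sum_{(i,j,k)}(\lambda_i^2-\lambda_j^2)(\lambda_i^2-\lambda_k^2)\lambda_ip_iq_i\big[(\lambda_j^2+\lambda_k^2)P_jP_k-2\lambda_j\lambda_kQ_jQ_k\big]-8(\lambda_1^4+\lambda_2^4+\lambda_3^4-\lambda_1^2\lambda_2^2-\lambda_1^2\lambda_3^2-\lambda_2^2\lambda_3^2)\prod_{j=1}^3\lambda_jp_jq_j,$$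 $$D=\sum_{(i,j,k)}\Big\{(\lambda_i+\lambda_j)^2(\lambda_i+\lambda_k)^2(\lambda_j-\lambda_k)^2(p_i^2q_j^2q_k^2+q_i^2p_j^2p_k^2)-8(\lambda_i^2-\lambda_j^2)(\lambda_i^2-\lambda_k^2)\lambda_j\lambda_kp_jp_kq_jq_kP_i\Big\}$$ $$\qquad+(\lambda_1-\lambda_2)^2(\lambda_1-\lambda_3)^2(\lambda_2-\lambda_3)^2(p_1^2p_2^2p_3^2+q_1^2q_2^2q_3^2).$$ **Terminology.** Let $w(x-ct)$ be an $L$-periodic travelling wave of the mKdV equation, and let $v$ be a real solution of that equation. * $v$ is an *algebraic soliton of speed $c_0$ on this background* if $v(x,t)=G(x-ct,x-c_0t)$ with $G(y,\eta)$ continuous, $L$-periodic in $y$, a rational function of $\eta\in\mathbb R$ without real poles for each fixed $y$, $|G(y,\eta)-w(y)|\le C/(1+|\eta|)$ for all $y,\eta$, and $G(\cdot,\eta)\neq w$ for every $\eta$. * $v$ is a *rogue wave on this background* if at no time $t$ is $v(\cdot,t)$ equal to a translate $w(\cdot-x_0)$, $x_0\in[0,L]$, and $\inf_{x_0\in[0,L]}\sup_{x\in\mathbb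 R}|v(x,t)-w(x-x_0)|\to0$ as $t\to\pm\infty$. * $v$ *contains both* if there is an algebraic soliton $s$ of speed $c_0$ on this background such that $v(\cdot,t)\neq s(\cdot,t)$ for every $t$ and $\sup_{x\in\mathbb R}|v(x,t)-s(x,t)|\to0$ as $t\to\pm\infty$. -/

import Mathlib

open Filter Topology
open scoped Matrix ENNReal

noncomputable section

namespace MKdV

/-! ### Jacobian elliptic functions (real argument, modulus `k`) -/

/-- Incomplete elliptic integral of the first kind
`F(φ; k) = ∫₀^φ dθ / √(1 - k² sin² θ)`. -/
def ellipticF (k φ : ℝ) : ℝ :=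
  ∫ θ in (0 : ℝ)..φ, 1 / Real.sqrt (1 - k ^ 2 * Real.sin θ ^ 2)

/-- Complete elliptic integral of the first kind `K(k) = F(π/2; k)`. -/
def ellipticK (k : ℝ) : ℝ := ellipticF k (Real.pi / 2)

/-- Jacobi amplitude: the inverse of the increasing bijection `φ ↦ F(φ; k)` of `ℝ`
(for `0 ≤ k < 1`). -/
def jacobiAm (k x : ℝ) : ℝ := Function.invFun (ellipticF k) x

/-- Jacobi elliptic function `cn(x; k) = cos (am (x; k))`. -/
def jacobiCn (k x : ℝ) : ℝ := Real.cos (jacobiAm k x)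

/-! ### The mKdV equation and its Lax pair -/

/-- `u(x,t)` is a classical solution, of class `C^{3,1}`, of `u_t + 6 u² u_x + u_xxx = 0`
on `ℝ × ℝ`. -/
def IsSolution (u : ℝ → ℝ → ℝ) : Prop :=
  ∃ u₁ u₂ u₃ uₜ : ℝ → ℝ → ℝ,
    Continuous (Function.uncurry u) ∧ Continuous (Function.uncurry u₁) ∧
    Continuous (Function.uncurry u₂) ∧ Continuous (Function.uncurry u₃) ∧
    Continuous (Function.uncurry uₜ) ∧
    ∀ x t : ℝ,
      HasDerivAt (fun y => u y t) (u₁ x t) x ∧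
      HasDerivAt (fun y => u₁ y t) (u₂ x t) x ∧
      HasDerivAt (fun y => u₂ y t) (u₃ x t) x ∧
      HasDerivAt (fun s => u x s) (uₜ x t) t ∧
      uₜ x t + 6 * u x t ^ 2 * u₁ x t + u₃ x t = 0

/-- The matrix of the spatial Lax equation. -/
def laxU (l : ℂ) (u : ℝ) : Matrix (Fin 2) (Fin 2) ℂ :=
  !![l, (u : ℂ); -(u : ℂ), -l]

/-- The matrix of the temporal Lax equation; `u₁`, `u₂` stand for `u_x`, `u_xx`. -/
def laxV (l : ℂ) (u u₁ u₂ : ℝ) : Matrix (Fin 2) (Fin 2) ℂ :=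
  !![-4 * l ^ 3 - 2 * l * u ^ 2,
      -4 * l ^ 2 * u - 2 * l * u₁ - 2 * u ^ 3 - u₂;
     4 * l ^ 2 * u - 2 * l * u₁ + 2 * u ^ 3 + u₂,
      4 * l ^ 3 + 2 * l * u ^ 2]

/-- `φ = (p, q)ᵗ` solves the Lax system `φ_x = U φ`, `φ_t = V φ` with spectral parameter `l`
and potential `u`. -/
def IsLaxSolution (l : ℂ) (u : ℝ → ℝ → ℝ) (φ : ℝ → ℝ → Fin 2 → ℂ) : Prop :=
  ∀ x t : ℝ,
    HasDerivAt (fun y => φ y t) (laxU l (u x t) *ᵥ φ x t) x ∧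
    HasDerivAt (fun s => φ x s)
      (laxV l (u x t) (deriv (fun y => u y t) x) (iteratedDeriv 2 (fun y => u y t) x) *ᵥ φ x t) t

/-- The function `(x,t) ↦ U(x - c t)` travelling with speed `c`. -/
def travelling (U : ℝ → ℝ) (c : ℝ) : ℝ → ℝ → ℝ := fun x t => U (x - c * t)

/-- `U` is the profile of an `L`-periodic travelling wave of speed `c` of the mKdV equation. -/
def IsPeriodicWave (U : ℝ → ℝ) (c L : ℝ) : Prop :=
  0 < L ∧ Function.Periodic U L ∧ IsSolution (travelling U c)

/-- Periodic eigenfunction for the travelling wave `U(x - c t)`: a nonzero solution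
`φ(x,t) = Φ(x - c t)` of the Lax system which is `L`-periodic up to a sign
(so that `p²`, `q²` and `p q` are `L`-periodic). -/
def IsPeriodicEigenfunction (U : ℝ → ℝ) (c L : ℝ) (l : ℂ) (φ : ℝ → ℝ → Fin 2 → ℂ) : Prop :=
  φ ≠ 0 ∧ IsLaxSolution l (travelling U c) φ ∧
  ∃ Φ : ℝ → Fin 2 → ℂ, (∀ x t : ℝ, φ x t = Φ (x - c * t)) ∧
    ((∀ y, Φ (y + L) = Φ y) ∨ (∀ y, Φ (y + L) = -Φ y))

/-- Second solution: a solution of the Lax system, for the same spectral parameter, which is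
linearly independent of a periodic eigenfunction. -/
def IsSecondSolution (U : ℝ → ℝ) (c L : ℝ) (l : ℂ) (ψ : ℝ → ℝ → Fin 2 → ℂ) : Prop :=
  IsLaxSolution l (travelling U c) ψ ∧
  ∃ φ, IsPeriodicEigenfunction U c L l φ ∧ LinearIndependent ℂ ![φ, ψ]

/-- Both components are real-valued. -/
def IsRealValued (φ : ℝ → ℝ → Fin 2 → ℂ) : Prop := ∀ x t i, (φ x t i).im = 0

/-- Componentwise complex conjugate. -/
def conjSol (φ : ℝ → ℝ → Fin 2 → ℂ) : ℝ → ℝ → Fin 2 → ℂ :=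
  fun x t i => starRingEnd ℂ (φ x t i)

/-! ### Linear growth -/

/-- Linear growth in `x` and `t` everywhere on the `(x,t)` plane. -/
def GrowsLinearly (φ : ℝ → ℝ → Fin 2 → ℂ) : Prop :=
  ∃ m M : ℝ, 0 < m ∧ ∀ x t : ℝ,
    m * (|x| + |t|) - M ≤ ‖φ x t‖ ∧ ‖φ x t‖ ≤ M * (1 + |x| + |t|)

/-- Linear growth in `x` and `t` everywhere on the `(x,t)` plane except for the straight line
`x - c₀ t = ξ₀`: the size is that of the distance to the line, up to a bounded error. -/
def GrowsLinearlyOffLine (c₀ ξ₀ : ℝ) (φ : ℝ → ℝ → Fin 2 → ℂ) : Prop :=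
  ∃ m M : ℝ, 0 < m ∧ ∀ x t : ℝ,
    m * |x - c₀ * t - ξ₀| - M ≤ ‖φ x t‖ ∧ ‖φ x t‖ ≤ M * (1 + |x - c₀ * t - ξ₀|)

/-! ### Darboux transformations

The arguments `v`, `v₁`, `v₂`, `v₃` are values `(p, q)` of solutions of the Lax system. -/

/-- Denominator of the one-fold transformation. -/
def oneFoldDen (v : Fin 2 → ℂ) : ℂ := v 0 ^ 2 + v 1 ^ 2

/-- One-fold Darboux transformation. -/
def oneFold (l u : ℂ) (v : Fin 2 → ℂ) : ℂ := u + 4 * l * v 0 * v 1 / oneFoldDen v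

/-- Denominator of the two-fold transformation. -/
def twoFoldDen (l₁ l₂ : ℂ) (v₁ v₂ : Fin 2 → ℂ) : ℂ :=
  (l₁ ^ 2 + l₂ ^ 2) * (v₁ 0 ^ 2 + v₁ 1 ^ 2) * (v₂ 0 ^ 2 + v₂ 1 ^ 2)
    - 2 * l₁ * l₂ * (4 * v₁ 0 * v₁ 1 * v₂ 0 * v₂ 1
        + (v₁ 0 ^ 2 - v₁ 1 ^ 2) * (v₂ 0 ^ 2 - v₂ 1 ^ 2))

/-- Two-fold Darboux transformation. -/
def twoFold (l₁ l₂ u : ℂ) (v₁ v₂ : Fin 2 → ℂ) : ℂ :=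
  u + 4 * (l₁ ^ 2 - l₂ ^ 2) *
      (l₁ * v₁ 0 * v₁ 1 * (v₂ 0 ^ 2 + v₂ 1 ^ 2) - l₂ * v₂ 0 * v₂ 1 * (v₁ 0 ^ 2 + v₁ 1 ^ 2))
    / twoFoldDen l₁ l₂ v₁ v₂

/-- Numerator `N` of the three-fold transformation. -/
def threeFoldNum (l₁ l₂ l₃ : ℂ) (v₁ v₂ v₃ : Fin 2 → ℂ) : ℂ :=
  (l₃ ^ 2 - l₁ ^ 2) * (l₃ ^ 2 - l₂ ^ 2) * l₃ * v₃ 0 * v₃ 1 *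
      ((l₁ ^ 2 + l₂ ^ 2) * (v₁ 0 ^ 2 + v₁ 1 ^ 2) * (v₂ 0 ^ 2 + v₂ 1 ^ 2)
        - 2 * l₁ * l₂ * (v₁ 0 ^ 2 - v₁ 1 ^ 2) * (v₂ 0 ^ 2 - v₂ 1 ^ 2))
  + (l₂ ^ 2 - l₁ ^ 2) * (l₂ ^ 2 - l₃ ^ 2) * l₂ * v₂ 0 * v₂ 1 *
      ((l₁ ^ 2 + l₃ ^ 2) * (v₁ 0 ^ 2 + v₁ 1 ^ 2) * (v₃ 0 ^ 2 + v₃ 1 ^ 2)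
        - 2 * l₁ * l₃ * (v₁ 0 ^ 2 - v₁ 1 ^ 2) * (v₃ 0 ^ 2 - v₃ 1 ^ 2))
  + (l₁ ^ 2 - l₂ ^ 2) * (l₁ ^ 2 - l₃ ^ 2) * l₁ * v₁ 0 * v₁ 1 *
      ((l₂ ^ 2 + l₃ ^ 2) * (v₂ 0 ^ 2 + v₂ 1 ^ 2) * (v₃ 0 ^ 2 + v₃ 1 ^ 2)
        - 2 * l₂ * l₃ * (v₂ 0 ^ 2 - v₂ 1 ^ 2) * (v₃ 0 ^ 2 - v₃ 1 ^ 2))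
  - 8 * (l₁ ^ 4 + l₂ ^ 4 + l₃ ^ 4 - l₁ ^ 2 * l₂ ^ 2 - l₁ ^ 2 * l₃ ^ 2 - l₂ ^ 2 * l₃ ^ 2)
      * l₁ * l₂ * l₃ * v₁ 0 * v₂ 0 * v₃ 0 * v₁ 1 * v₂ 1 * v₃ 1

/-- Denominator `D` of the three-fold transformation. -/
def threeFoldDen (l₁ l₂ l₃ : ℂ) (v₁ v₂ v₃ : Fin 2 → ℂ) : ℂ :=
  (l₁ + l₂) ^ 2 * (l₁ + l₃) ^ 2 * (l₂ - l₃) ^ 2 *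
      (v₁ 0 ^ 2 * v₂ 1 ^ 2 * v₃ 1 ^ 2 + v₁ 1 ^ 2 * v₂ 0 ^ 2 * v₃ 0 ^ 2)
  + (l₁ + l₂) ^ 2 * (l₂ + l₃) ^ 2 * (l₁ - l₃) ^ 2 *
      (v₂ 0 ^ 2 * v₁ 1 ^ 2 * v₃ 1 ^ 2 + v₂ 1 ^ 2 * v₁ 0 ^ 2 * v₃ 0 ^ 2)
  + (l₁ + l₃) ^ 2 * (l₂ + l₃) ^ 2 * (l₁ - l₂) ^ 2 *
      (v₃ 0 ^ 2 * v₁ 1 ^ 2 * v₂ 1 ^ 2 + v₃ 1 ^ 2 * v₁ 0 ^ 2 * v₂ 0 ^ 2)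
  + (l₁ - l₂) ^ 2 * (l₁ - l₃) ^ 2 * (l₂ - l₃) ^ 2 *
      (v₁ 0 ^ 2 * v₂ 0 ^ 2 * v₃ 0 ^ 2 + v₁ 1 ^ 2 * v₂ 1 ^ 2 * v₃ 1 ^ 2)
  - 8 * (l₃ ^ 2 - l₁ ^ 2) * (l₃ ^ 2 - l₂ ^ 2) * l₁ * l₂ *
      v₁ 0 * v₂ 0 * v₁ 1 * v₂ 1 * (v₃ 0 ^ 2 + v₃ 1 ^ 2)
  - 8 * (l₂ ^ 2 - l₁ ^ 2) * (l₂ ^ 2 - l₃ ^ 2) * l₁ * l₃ *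
      v₁ 0 * v₃ 0 * v₁ 1 * v₃ 1 * (v₂ 0 ^ 2 + v₂ 1 ^ 2)
  - 8 * (l₁ ^ 2 - l₂ ^ 2) * (l₁ ^ 2 - l₃ ^ 2) * l₂ * l₃ *
      v₂ 0 * v₃ 0 * v₂ 1 * v₃ 1 * (v₁ 0 ^ 2 + v₁ 1 ^ 2)

/-- Three-fold Darboux transformation. -/
def threeFold (l₁ l₂ l₃ u : ℂ) (v₁ v₂ v₃ : Fin 2 → ℂ) : ℂ :=
  u + 4 * threeFoldNum l₁ l₂ l₃ v₁ v₂ v₃ / threeFoldDen l₁ l₂ l₃ v₁ v₂ v₃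

/-! ### Algebraic solitons and rogue waves on a background -/

/-- `v` is an algebraic soliton of speed `c₀` on the background of the `L`-periodic travelling wave
`w(x - c t)`: a solution `v(x,t) = G(x - c t, x - c₀ t)` of the mKdV equation whose profile `G`
is `L`-periodic in the phase of the background, is a rational function of `η = x - c₀ t`, decays
to the background at the algebraic rate `1/|η|` away from the lines `η = const`, and differs from
the background along each of these lines. -/
def IsAlgebraicSolitonOn (w : ℝ → ℝ) (c L c₀ : ℝ) (v : ℝ → ℝ → ℝ) : Prop :=
  IsPeriodicWave w c L ∧ IsSolution v ∧
  ∃ G : ℝ → ℝ → ℝ, Continuous (Function.uncurry G) ∧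
    (∀ x t, v x t = G (x - c * t) (x - c₀ * t)) ∧
    (∀ y η, G (y + L) η = G y η) ∧
    (∀ y, ∃ P Q : Polynomial ℝ, ∀ η, Q.eval η ≠ 0 ∧ G y η = P.eval η / Q.eval η) ∧
    (∃ C : ℝ, ∀ y η, |G y η - w y| ≤ C / (1 + |η|)) ∧
    (∀ η, ∃ y, G y η ≠ w y)

/-- `v` is a rogue wave on the background of the `L`-periodic travelling wave with profile `w`:
at no time is `v` a translate of `w`, and
`inf_{x₀ ∈ [0,L]} sup_x |v(x,t) - w(x - x₀)| → 0` as `t → ±∞`. -/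
def IsRogueWaveOn (w : ℝ → ℝ) (c L : ℝ) (v : ℝ → ℝ → ℝ) : Prop :=
  IsPeriodicWave w c L ∧ IsSolution v ∧
  (∀ t : ℝ, ∀ x₀ ∈ Set.Icc 0 L, ∃ x, v x t ≠ w (x - x₀)) ∧
  Tendsto (fun t : ℝ => ⨅ x₀ ∈ Set.Icc 0 L, ⨆ x : ℝ, ENNReal.ofReal |v x t - w (x - x₀)|)
    atTop (𝓝 0) ∧
  Tendsto (fun t : ℝ => ⨅ x₀ ∈ Set.Icc 0 L, ⨆ x : ℝ, ENNReal.ofReal |v x t - w (x - x₀)|)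
    atBot (𝓝 0)

/-- `v` contains both an algebraic soliton of speed `c₀` and a rogue wave on the background
`w(x - c t)`: there is an algebraic soliton `s` of speed `c₀` on this background such that `v`
differs from `s` at every time while `sup_x |v(x,t) - s(x,t)| → 0` as `t → ±∞`. -/
def IsSolitonAndRogueWaveOn (w : ℝ → ℝ) (c L c₀ : ℝ) (v : ℝ → ℝ → ℝ) : Prop :=
  IsSolution v ∧
  ∃ s : ℝ → ℝ → ℝ, IsAlgebraicSolitonOn w c L c₀ s ∧
    (∀ t : ℝ, ∃ x, v x t ≠ s x t) ∧
    Tendsto (fun t : ℝ => ⨆ x : ℝ, ENNReal.ofReal |v x t - s x t|) atTop (𝓝 0) ∧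
    Tendsto (fun t : ℝ => ⨆ x : ℝ, ENNReal.ofReal |v x t - s x t|) atBot (𝓝 0)

/-! ### The cn-type periodic wave

The quartic `u⁴ - c u² + d - 2 e u` has the roots `a`, `b`, `α ± i β` with `α = -(a + b)/2`. -/

/-- Real part of the complex roots. -/
def alphaRoot (a b : ℝ) : ℝ := -(a + b) / 2

/-- Wave speed. -/
def speed (a b β : ℝ) : ℝ :=
  -(a * b + 2 * alphaRoot a b * (a + b) + alphaRoot a b ^ 2 + β ^ 2)

/-- Integration constant `e` in `u'' + 2 u³ - c u = e`. -/
def eConst (a b β : ℝ) : ℝ :=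
  (2 * alphaRoot a b * a * b + (a + b) * (alphaRoot a b ^ 2 + β ^ 2)) / 2

/-- `(a - α)² + β²`. -/
def sqDistA (a b β : ℝ) : ℝ := (a - alphaRoot a b) ^ 2 + β ^ 2

/-- `(b - α)² + β²`. -/
def sqDistB (a b β : ℝ) : ℝ := (b - alphaRoot a b) ^ 2 + β ^ 2

/-- The parameter `δ > 0`. -/
def delta (a b β : ℝ) : ℝ := Real.sqrt (sqDistB a b β / sqDistA a b β)

/-- The parameter `ν > 0`. -/
def nu (a b β : ℝ) : ℝ := Real.sqrt (Real.sqrt (sqDistA a b β * sqDistB a b β))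

/-- The elliptic modulus `κ ∈ (0,1)`. -/
def kappa (a b β : ℝ) : ℝ :=
  Real.sqrt ((1 - ((a - alphaRoot a b) * (b - alphaRoot a b) + β ^ 2)
      / Real.sqrt (sqDistA a b β * sqDistB a b β)) / 2)

/-- The cn-type periodic wave. Its image under the symmetry `a ↔ b` is `cnWave b a β`. -/
def cnWave (a b β x : ℝ) : ℝ :=
  a + (b - a) * (1 - jacobiCn (kappa a b β) (nu a b β * x))
    / (1 + delta a b β + (delta a b β - 1) * jacobiCn (kappa a b β) (nu a b β * x))

/-- The period `L = 4 K(κ) / ν`. -/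
def period (a b β : ℝ) : ℝ := 4 * ellipticK (kappa a b β) / nu a b β

/-- The eigenvalue `λ₁`. -/
def lam1 (a b β : ℝ) : ℂ := ((a : ℂ) - b) / 4 + Complex.I / 2 * β

/-- The eigenvalue `λ₂`. -/
def lam2 (a b β : ℝ) : ℂ := ((a : ℂ) - b) / 4 - Complex.I / 2 * β

/-- The eigenvalue `λ₃`. -/
def lam3 (a b : ℝ) : ℂ := ((a : ℂ) + b) / 2

/-- Mean value over one period. -/
def meanValue (L : ℝ) (f : ℝ → ℂ) : ℂ := (1 / (L : ℂ)) * ∫ y in (0 : ℝ)..L, f y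

/-- The mean value in the non-degeneracy condition for `λ₁`. -/
def mean1 (a b β : ℝ) : ℂ :=
  meanValue (period a b β) fun y =>
    lam1 a b β ^ 2 * (2 * Complex.I * β * (a - b) - (a + b) ^ 2 + 4 * (cnWave a b β y : ℂ) ^ 2)
      / (eConst a b β + 4 * lam1 a b β ^ 2 * cnWave a b β y) ^ 2

/-- The mean value in the non-degeneracy condition for `λ₃`. -/
def mean3 (a b β : ℝ) : ℂ :=
  meanValue (period a b β) fun y =>
    lam3 a b ^ 2 * (4 * β ^ 2 + a ^ 2 + b ^ 2 + 6 * a * b + 8 * (cnWave a b β y : ℂ) ^ 2)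
      / (eConst a b β + 4 * lam3 a b ^ 2 * cnWave a b β y) ^ 2

/-- Second solutions, for the spectral parameter `l`, on the cn-type wave. -/
def IsSecond (a b β : ℝ) (l : ℂ) (ψ : ℝ → ℝ → Fin 2 → ℂ) : Prop :=
  IsSecondSolution (cnWave a b β) (speed a b β) (period a b β) l ψ

end MKdV

end

noncomputable section

namespace MKdV

/-! ### Jacobi elliptic functions -/

section Jacobi

variable {k : ℝ}

/-! The profile solves U'' = e + cU - 2U³ with U'² = -U⁴ + cU² + 2eU - d. On functions of x - ct the
temporal Lax equation becomes algebraic: the trace-free matrix V + c·`laxU` must annihilate the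
eigenfunction. It is singular exactly at the roots ±λ₁, ±λ₂, ±λ₃ of 16λ⁶ - 8cλ⁴ + (c² - 4d)λ² - e².
Here c = 2(λ₁² + λ₂² + λ₃²), e = 4λ₁λ₂λ₃ and a = λ₁ + λ₂ + λ₃. At a root the matrix is nilpotent.
Its kernel carries the periodic eigenfunction (p, q), whose quadratic expressions p² ± q² and pq are
polynomials in U and U' (`exists_eigenPair`, `EigenPair.antiperiodic`). A suitably scaled second
solution is sent by the matrix to (p, q). It therefore has the form T(p, q) + (q, -p)/D, with D
proportional to p² + q² and T = t + phase(x - ct) + C (`EigenPair.laxAt_second`,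
`exists_eigenPair_of_isSecondSolution`).

Growth of a second solution is growth of T, which equals t + (τ/L)(x - ct) up to a bounded error, τ
being the phase gained over one period. The means in the non-degeneracy conditions are nonzero real
multiples of τ. For λ₁ the condition Im τ ≠ 0 makes this linear map from the plane to ℂ injective.
For λ₃ the number τ is real and nonzero, and the form is constant along lines of speed c₀ = c - L/τ.

That Darboux transformations give solutions is checked on jets for one step (`JetAt.darboux`,
`LaxAt.darboux`). The two-fold formula iterates this step, and the three-fold formula is the
two-fold one applied after a step with λ₃ (`twoFold_eq_iterate`, `threeFold_eq_iterate`). For a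
conjugate pair the intermediate complex potential may be singular, but up to a constant the final
denominator is a positive sum of squares, and the equation extends by density
(`smoothSol_of_jetAt`).

The backgrounds are what the periodic eigenfunctions produce: -U_{b,a}, U_{b,a} and -U
(`cnWave_swap`, `twoFold_eigen`, `sumNum_eq_zero`). With the real second solution, the transformed
wave is a quotient of quadratic polynomials in T whose leading part is the background, so the
deviation is linear over quadratic (`isAlgebraicSolitonOn_of_quadratic`). With the complex one, the
two-fold increment depends only on the direction of the vector and is Lipschitz on the projective
line (`exists_realTwoFold_sub_le`). The Wronskian of a second solution with (p, q) is constant while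
the second solution grows, so the wave approaches the one built from (p, q) like 1/(|x| + |t|). In
the three-fold case this limit is the algebraic soliton.

It remains to see that the new waves are not trivial. In the two-fold case (p, q) points along (1,
-1) at y = 0, the only direction with an extreme increment (`realTwoFold_ne`). In the three-fold
case, two equal potentials would make a decaying and a non-decaying solution of the transformed
spatial equation proportional (`exists_realTwoFold_ne`). -/

theorem one_sub_sq_mul_sin_sq_pos (hk : k ^ 2 < 1) (φ : ℝ) : 0 < 1 - k ^ 2 * Real.sin φ ^ 2 := by
  nlinarith [Real.sin_sq_add_cos_sq φ, sq_nonneg (Real.cos φ), sq_nonneg (Real.sin φ)]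

theorem continuous_ellipticF_integrand (hk : k ^ 2 < 1) :
    Continuous fun θ : ℝ => 1 / Real.sqrt (1 - k ^ 2 * Real.sin θ ^ 2) :=
  continuous_const.div (by fun_prop)
    fun θ => (Real.sqrt_pos.2 (one_sub_sq_mul_sin_sq_pos hk θ)).ne'

theorem hasDerivAt_ellipticF (hk : k ^ 2 < 1) (φ : ℝ) :
    HasDerivAt (ellipticF k) (1 / Real.sqrt (1 - k ^ 2 * Real.sin φ ^ 2)) φ :=
  have hc := continuous_ellipticF_integrand hk
  intervalIntegral.integral_hasDerivAt_right (hc.intervalIntegrable _ _)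
    (hc.stronglyMeasurableAtFilter _ _) hc.continuousAt

theorem ellipticF_zero : ellipticF k 0 = 0 := by simp [ellipticF]

theorem ellipticF_deriv_pos (hk : k ^ 2 < 1) (φ : ℝ) :
    0 < 1 / Real.sqrt (1 - k ^ 2 * Real.sin φ ^ 2) :=
  one_div_pos.2 (Real.sqrt_pos.2 (one_sub_sq_mul_sin_sq_pos hk φ))

theorem strictMono_ellipticF (hk : k ^ 2 < 1) : StrictMono (ellipticF k) :=
  strictMono_of_hasDerivAt_pos (hasDerivAt_ellipticF hk) (ellipticF_deriv_pos hk)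

/-- The integrand is at least 1. Comparison with the identity then forces `ellipticF` to be
unbounded in both directions, hence onto. -/
theorem monotone_ellipticF_sub_id (hk : k ^ 2 < 1) : Monotone fun φ => ellipticF k φ - φ := by
  refine monotone_of_deriv_nonneg
    (fun φ => ((hasDerivAt_ellipticF hk φ).fun_sub (hasDerivAt_id' φ)).differentiableAt) fun φ => ?_
  rw [((hasDerivAt_ellipticF hk φ).fun_sub (hasDerivAt_id' φ)).deriv, sub_nonneg,
    le_div_iff₀ (Real.sqrt_pos.2 (one_sub_sq_mul_sin_sq_pos hk φ)), one_mul]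
  exact Real.sqrt_le_one.2 (by nlinarith [mul_nonneg (sq_nonneg k) (sq_nonneg (Real.sin φ))])

theorem surjective_ellipticF (hk : k ^ 2 < 1) : Function.Surjective (ellipticF k) := by
  have h0 : ∀ {x y : ℝ}, x ≤ y → ellipticF k x - x ≤ ellipticF k y - y :=
    fun h => monotone_ellipticF_sub_id hk h
  have hc : Continuous (ellipticF k) :=
    continuous_iff_continuousAt.2 fun φ => (hasDerivAt_ellipticF hk φ).continuousAt
  refine hc.surjective ?_ ?_
  · refine tendsto_atTop_mono' _ ?_ tendsto_id
    filter_upwards [eventually_ge_atTop 0] with x hx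
    have := h0 hx
    rw [ellipticF_zero] at this
    simp only [id]; linarith
  · refine tendsto_atBot_mono' _ ?_ tendsto_id
    filter_upwards [eventually_le_atBot 0] with x hx
    have := h0 hx
    rw [ellipticF_zero] at this
    simp only [id]; linarith

theorem ellipticF_jacobiAm (hk : k ^ 2 < 1) (x : ℝ) : ellipticF k (jacobiAm k x) = x :=
  Function.invFun_eq (surjective_ellipticF hk x)

theorem jacobiAm_ellipticF (hk : k ^ 2 < 1) (φ : ℝ) : jacobiAm k (ellipticF k φ) = φ :=
  Function.leftInverse_invFun (strictMono_ellipticF hk).injective φ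

theorem continuous_jacobiAm (hk : k ^ 2 < 1) : Continuous (jacobiAm k) := by
  have h : jacobiAm k = ((strictMono_ellipticF hk).orderIsoOfSurjective _
      (surjective_ellipticF hk)).symm := by
    funext x
    apply (strictMono_ellipticF hk).injective
    rw [ellipticF_jacobiAm hk]
    exact (((strictMono_ellipticF hk).orderIsoOfSurjective _
      (surjective_ellipticF hk)).apply_symm_apply x).symm
  rw [h]
  exact OrderIso.continuous _

theorem hasDerivAt_jacobiAm (hk : k ^ 2 < 1) (x : ℝ) :
    HasDerivAt (jacobiAm k) (Real.sqrt (1 - k ^ 2 * Real.sin (jacobiAm k x) ^ 2)) x := by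
  have h := HasDerivAt.of_local_left_inverse (continuous_jacobiAm hk).continuousAt
    (hasDerivAt_ellipticF hk (jacobiAm k x)) (ellipticF_deriv_pos hk _).ne'
    (Eventually.of_forall (ellipticF_jacobiAm hk))
  simpa using h

theorem ellipticF_neg (hk : k ^ 2 < 1) (φ : ℝ) : ellipticF k (-φ) = -ellipticF k φ := by
  have h : ∀ x, HasDerivAt (fun x => ellipticF k (-x) + ellipticF k x) 0 x := fun x => by
    have h1 := (hasDerivAt_ellipticF hk (-x)).scomp x (hasDerivAt_neg x)
    exact (h1.add (hasDerivAt_ellipticF hk x)).congr_deriv (by simp)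
  have := is_const_of_deriv_eq_zero (fun x => (h x).differentiableAt) (fun x => (h x).deriv) φ 0
  simp [ellipticF_zero] at this
  linarith

theorem ellipticF_add_pi (hk : k ^ 2 < 1) (φ : ℝ) :
    ellipticF k (φ + Real.pi) = ellipticF k φ + 2 * ellipticK k := by
  have h : ∀ x, HasDerivAt (fun x => ellipticF k (x + Real.pi) - ellipticF k x) 0 x := fun x => by
    have h1 := (hasDerivAt_ellipticF hk (x + Real.pi)).comp_add_const x Real.pi
    exact (h1.sub (hasDerivAt_ellipticF hk x)).congr_deriv (by simp)
  -- At -π/2 the constant difference is F(π/2) - F(-π/2), which is 2K because F is odd.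
  have := is_const_of_deriv_eq_zero (fun x => (h x).differentiableAt) (fun x => (h x).deriv) φ
    (-(Real.pi / 2))
  simp only [ellipticF_neg hk] at this
  rw [show -(Real.pi / 2) + Real.pi = Real.pi / 2 by ring] at this
  rw [ellipticK]; linarith

theorem jacobiAm_add (hk : k ^ 2 < 1) (x : ℝ) :
    jacobiAm k (x + 2 * ellipticK k) = jacobiAm k x + Real.pi := by
  apply (strictMono_ellipticF hk).injective
  rw [ellipticF_jacobiAm hk, ellipticF_add_pi hk, ellipticF_jacobiAm hk]

theorem jacobiCn_add (hk : k ^ 2 < 1) (x : ℝ) :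
    jacobiCn k (x + 4 * ellipticK k) = jacobiCn k x := by
  rw [show x + 4 * ellipticK k = x + 2 * ellipticK k + 2 * ellipticK k by ring, jacobiCn,
    jacobiAm_add hk, jacobiAm_add hk, Real.cos_add_pi, Real.cos_add_pi, neg_neg, jacobiCn]

theorem jacobiCn_zero (hk : k ^ 2 < 1) : jacobiCn k 0 = 1 := by
  have := jacobiAm_ellipticF hk 0
  rw [ellipticF_zero] at this
  rw [jacobiCn, this, Real.cos_zero]

theorem ellipticK_pos (hk : k ^ 2 < 1) : 0 < ellipticK k := by
  have := strictMono_ellipticF hk (show (0 : ℝ) < Real.pi / 2 by positivity)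
  rwa [ellipticF_zero] at this

/-- The derivative `-sn dn` of `cn`. -/
def jacobiCnDeriv (k x : ℝ) : ℝ :=
  -(Real.sin (jacobiAm k x) * Real.sqrt (1 - k ^ 2 * Real.sin (jacobiAm k x) ^ 2))

theorem hasDerivAt_jacobiCn (hk : k ^ 2 < 1) (x : ℝ) :
    HasDerivAt (jacobiCn k) (jacobiCnDeriv k x) x :=
  (hasDerivAt_jacobiAm hk x).cos.congr_deriv (by simp [jacobiCnDeriv])

theorem jacobiCnDeriv_sq (hk : k ^ 2 < 1) (x : ℝ) :
    jacobiCnDeriv k x ^ 2 =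
      (1 - jacobiCn k x ^ 2) * (1 - k ^ 2 + k ^ 2 * jacobiCn k x ^ 2) := by
  rw [jacobiCnDeriv, neg_sq, mul_pow, Real.sq_sqrt (one_sub_sq_mul_sin_sq_pos hk _).le, jacobiCn,
    Real.cos_sq']
  ring

theorem hasDerivAt_jacobiCnDeriv (hk : k ^ 2 < 1) (x : ℝ) :
    HasDerivAt (jacobiCnDeriv k)
      (jacobiCn k x * (2 * k ^ 2 - 1 - 2 * k ^ 2 * jacobiCn k x ^ 2)) x := by
  have hp := one_sub_sq_mul_sin_sq_pos hk (jacobiAm k x)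
  have ha := hasDerivAt_jacobiAm hk x
  have h := (ha.sin.mul ((((ha.sin.pow 2).const_mul (k ^ 2)).const_sub 1).sqrt hp.ne')).neg
  refine h.congr_deriv ?_
  have hs := Real.sq_sqrt hp.le
  have hs0 := (Real.sqrt_pos.2 hp).ne'
  simp only [jacobiCn, Nat.cast_ofNat, Nat.add_one_sub_one, pow_one, Pi.pow_apply]
  set s := Real.sqrt (1 - k ^ 2 * Real.sin (jacobiAm k x) ^ 2)
  have hcs := Real.sin_sq_add_cos_sq (jacobiAm k x)
  field_simp
  linear_combination (-Real.cos (jacobiAm k x)) * hs +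
    (Real.cos (jacobiAm k x) * 2 * k ^ 2) * hcs

end Jacobi

/-! ### The cn-type wave -/

section Wave

variable {a b β : ℝ}

theorem sqDistA_pos (hβ : β ≠ 0) : 0 < sqDistA a b β := by unfold sqDistA; positivity

theorem sqDistB_pos (hβ : β ≠ 0) : 0 < sqDistB a b β := by unfold sqDistB; positivity

theorem sqDistA_swap : sqDistA b a β = sqDistB a b β := by
  simp only [sqDistA, sqDistB, alphaRoot]; ring

theorem sqDistB_swap : sqDistB b a β = sqDistA a b β := by
  simp only [sqDistA, sqDistB, alphaRoot]; ring

theorem speed_swap : speed b a β = speed a b β := by simp only [speed, alphaRoot]; ring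

theorem kappa_swap : kappa b a β = kappa a b β := by
  rw [kappa, kappa, sqDistA_swap (a := a), sqDistB_swap (a := a), mul_comm (sqDistB a b β)]
  simp only [alphaRoot, add_comm b, mul_comm (b - _)]

theorem nu_swap : nu b a β = nu a b β := by
  rw [nu, nu, sqDistA_swap (a := a), sqDistB_swap (a := a), mul_comm (sqDistB a b β)]

theorem period_swap : period b a β = period a b β := by simp only [period, kappa_swap, nu_swap]

theorem nu_pos (hβ : β ≠ 0) : 0 < nu a b β :=
  Real.sqrt_pos.2 (Real.sqrt_pos.2 (mul_pos (sqDistA_pos hβ) (sqDistB_pos hβ)))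

theorem nu_sq (hβ : β ≠ 0) :
    nu a b β ^ 2 = Real.sqrt (sqDistA a b β) * Real.sqrt (sqDistB a b β) := by
  rw [nu, Real.sq_sqrt (Real.sqrt_nonneg _), Real.sqrt_mul (sqDistA_pos hβ).le]

theorem delta_eq (hβ : β ≠ 0) :
    delta a b β = Real.sqrt (sqDistB a b β) / Real.sqrt (sqDistA a b β) := by
  rw [delta, Real.sqrt_div (sqDistB_pos hβ).le]

theorem delta_pos (hβ : β ≠ 0) : 0 < delta a b β :=
  Real.sqrt_pos.2 (div_pos (sqDistB_pos hβ) (sqDistA_pos hβ))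

/-- Cauchy–Schwarz for the plane vectors (a - α, β) and (b - α, β). They lie in the same open
half-plane, so they are never antiparallel and the lower bound is strict; this is what gives κ < 1.
-/
theorem abs_cross_lt (hβ : β ≠ 0) :
    -Real.sqrt (sqDistA a b β * sqDistB a b β) < (a - alphaRoot a b) * (b - alphaRoot a b) + β ^ 2 ∧
      (a - alphaRoot a b) * (b - alphaRoot a b) + β ^ 2 ≤
        Real.sqrt (sqDistA a b β * sqDistB a b β) := by
  have hb : 0 < β ^ 2 := by positivity
  constructor
  · rw [neg_lt]
    by_cases h : 0 ≤ -((a - alphaRoot a b) * (b - alphaRoot a b) + β ^ 2)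
    · apply Real.lt_sqrt_of_sq_lt
      simp only [sqDistA, sqDistB]
      set x := a - alphaRoot a b
      set y := b - alphaRoot a b
      have hxy : x * y < 0 := by linarith
      have : 0 < (x - y) ^ 2 := by nlinarith [sq_nonneg x, sq_nonneg y]
      nlinarith [mul_pos hb this]
    · exact (not_le.1 h).trans_le (Real.sqrt_nonneg _)
  · apply Real.le_sqrt_of_sq_le
    simp only [sqDistA, sqDistB]
    set x := a - alphaRoot a b
    set y := b - alphaRoot a b
    nlinarith [mul_nonneg hb.le (sq_nonneg (x - y))]

theorem kappa_sq (hβ : β ≠ 0) :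
    kappa a b β ^ 2 = (1 - ((a - alphaRoot a b) * (b - alphaRoot a b) + β ^ 2)
      / Real.sqrt (sqDistA a b β * sqDistB a b β)) / 2 := by
  have hp : 0 < Real.sqrt (sqDistA a b β * sqDistB a b β) :=
    Real.sqrt_pos.2 (mul_pos (sqDistA_pos hβ) (sqDistB_pos hβ))
  rw [kappa, Real.sq_sqrt]
  have := (div_le_one hp).2 (abs_cross_lt (a := a) (b := b) hβ).2
  linarith

theorem kappa_sq_lt_one (hβ : β ≠ 0) : kappa a b β ^ 2 < 1 := by
  have hp : 0 < Real.sqrt (sqDistA a b β * sqDistB a b β) :=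
    Real.sqrt_pos.2 (mul_pos (sqDistA_pos hβ) (sqDistB_pos hβ))
  rw [kappa_sq hβ]
  have : -1 < ((a - alphaRoot a b) * (b - alphaRoot a b) + β ^ 2) /
      Real.sqrt (sqDistA a b β * sqDistB a b β) := by
    rw [lt_div_iff₀ hp]; linarith [(abs_cross_lt (a := a) (b := b) hβ).1]
  linarith

theorem period_pos (hβ : β ≠ 0) : 0 < period a b β :=
  div_pos (mul_pos four_pos (ellipticK_pos (kappa_sq_lt_one hβ))) (nu_pos hβ)

/-- `cn` with the modulus and the scaling of the wave. -/
def waveCn (a b β x : ℝ) : ℝ := jacobiCn (kappa a b β) (nu a b β * x)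

/-- The derivative of `cn` in the scaling of the wave. -/
def waveCnDeriv (a b β x : ℝ) : ℝ := jacobiCnDeriv (kappa a b β) (nu a b β * x)

theorem abs_waveCn_le (x : ℝ) : |waveCn a b β x| ≤ 1 := Real.abs_cos_le_one _

theorem waveDen_pos (hβ : β ≠ 0) (x : ℝ) :
    0 < 1 + delta a b β + (delta a b β - 1) * waveCn a b β x := by
  have h := abs_le.1 (abs_waveCn_le (a := a) (b := b) (β := β) x)
  have hd := delta_pos (a := a) (b := b) hβ
  rcases h.1.eq_or_lt with h1 | h1
  · rw [← h1]; linarith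
  · nlinarith [mul_pos hd (show 0 < 1 + waveCn a b β x by linarith)]

theorem cnWave_eq (x : ℝ) : cnWave a b β x = a + (b - a) * (1 - waveCn a b β x) /
    (1 + delta a b β + (delta a b β - 1) * waveCn a b β x) := rfl

/-- The derivative of the cn-type wave. -/
def cnWaveDeriv (a b β x : ℝ) : ℝ :=
  2 * (a - b) * delta a b β * (nu a b β * waveCnDeriv a b β x) /
    (1 + delta a b β + (delta a b β - 1) * waveCn a b β x) ^ 2

theorem hasDerivAt_waveCn (hβ : β ≠ 0) (x : ℝ) :
    HasDerivAt (waveCn a b β) (nu a b β * waveCnDeriv a b β x) x := by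
  have h := (hasDerivAt_jacobiCn (kappa_sq_lt_one (a := a) (b := b) hβ) (nu a b β * x)).comp x
    ((hasDerivAt_id x).const_mul (nu a b β))
  exact h.congr_deriv (by rw [waveCnDeriv]; ring)

theorem hasDerivAt_waveCnDeriv (hβ : β ≠ 0) (x : ℝ) :
    HasDerivAt (waveCnDeriv a b β) (nu a b β * (waveCn a b β x *
      (2 * kappa a b β ^ 2 - 1 - 2 * kappa a b β ^ 2 * waveCn a b β x ^ 2))) x := by
  have h := (hasDerivAt_jacobiCnDeriv (kappa_sq_lt_one (a := a) (b := b) hβ) (nu a b β * x)).comp x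
    ((hasDerivAt_id x).const_mul (nu a b β))
  exact h.congr_deriv (by rw [waveCn]; ring)

theorem waveCnDeriv_sq (hβ : β ≠ 0) (x : ℝ) : waveCnDeriv a b β x ^ 2 =
    (1 - waveCn a b β x ^ 2) * (1 - kappa a b β ^ 2 + kappa a b β ^ 2 * waveCn a b β x ^ 2) :=
  jacobiCnDeriv_sq (kappa_sq_lt_one hβ) _

theorem hasDerivAt_cnWave (hβ : β ≠ 0) (x : ℝ) :
    HasDerivAt (cnWave a b β) (cnWaveDeriv a b β x) x := by
  have hc := hasDerivAt_waveCn (a := a) (b := b) hβ x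
  have hN := (waveDen_pos (a := a) (b := b) hβ x).ne'
  have h := (((hc.const_sub 1).const_mul (b - a)).fun_div
    ((hc.const_mul (delta a b β - 1)).const_add (1 + delta a b β)) hN).const_add a
  refine h.congr_deriv ?_
  rw [cnWaveDeriv]
  field_simp
  ring

/-- With r = √A, s = √B and m = a - b one has A - B = 2(a - b)(a + b), so a, b, β² and κ² are all
rational in r, s, m. Substituting them turns the second-order equation into an identity between
rational functions of independent variables. The division by m is where a ≠ b is used. -/
theorem waveDeriv_deriv_aux {m r s C C1 k n2 N : ℝ} (hm : m ≠ 0) (hr : r ≠ 0) (hs : s ≠ 0)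
    (hN0 : N ≠ 0) (hN : N = r + s + (s - r) * C)
    (hC : C1 ^ 2 = (1 - C ^ 2) * (1 - k + k * C ^ 2)) (hn : n2 = r * s)
    {a b β2 : ℝ} (ha : a = ((r ^ 2 - s ^ 2) / (2 * m) + m) / 2)
    (hb : b = ((r ^ 2 - s ^ 2) / (2 * m) - m) / 2)
    (hβ : β2 = r ^ 2 - ((r ^ 2 - s ^ 2) / (2 * m) + m / 2) ^ 2)
    (hk : k = (1 - (r ^ 2 + s ^ 2 - m ^ 2) / (2 * (r * s))) / 2) :
    2 * (a - b) * (s * r) * n2 * (C * (2 * k - 1 - 2 * k * C ^ 2) * N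
        - 2 * (s - r) * C1 ^ 2) / N ^ 3 =
      (a + b) / 2 * ((a - b) ^ 2 / 4 + β2) + (-(a * b) + 3 / 4 * (a + b) ^ 2 - β2) *
        (a + (b - a) * r * (1 - C) / N) - 2 * (a + (b - a) * r * (1 - C) / N) ^ 3 := by
  have hab : a - b = m := by rw [ha, hb]; ring
  have hba : b - a = -m := by rw [ha, hb]; ring
  rw [hC, hn, hab, hba, hk, hβ, ha, hb]
  field_simp
  rw [hN]
  ring

/-- The factors a - U, U - b and (U - α)² + β² are multiples of 1 - C, 1 + C and 1 - k + kC² over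
powers of N. Their product reproduces the differential equation of cn. -/
theorem waveDeriv_sq_aux {r s C C1 k n2 a b α β2 N : ℝ} (hr : r ≠ 0) (hs : s ≠ 0)
    (hN0 : N ≠ 0) (hN : N = r + s + (s - r) * C)
    (hC : C1 ^ 2 = (1 - C ^ 2) * (1 - k + k * C ^ 2)) (hn : n2 = r * s)
    (hA : r ^ 2 = (a - α) ^ 2 + β2) (hB : s ^ 2 = (b - α) ^ 2 + β2)
    (hk : k = (1 - ((a - α) * (b - α) + β2) / (r * s)) / 2) (U : ℝ)
    (hU : U = a + (b - a) * r * (1 - C) / N) :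
    (2 * (a - b) * (s * r)) ^ 2 * n2 * C1 ^ 2 / N ^ 4 =
      (a - U) * (U - b) * ((U - α) ^ 2 + β2) := by
  have h1 : (a - U) = (a - b) * (1 - C) * r / N := by
    rw [hU]; field_simp; ring
  have h2 : (U - b) = (a - b) * (1 + C) * s / N := by
    rw [hU]; field_simp; rw [hN]; ring
  have h3 : (U - α) ^ 2 + β2 = 4 * (r * s) ^ 2 * (1 - k + k * C ^ 2) / N ^ 2 := by
    have : U - α = ((b - α) * r * (1 - C) + (a - α) * s * (1 + C)) / N := by
      rw [hU]; field_simp; rw [hN]; ring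
    rw [this, hk]
    field_simp
    rw [hN]
    linear_combination (-2 * (1 + C) ^ 2 * s ^ 2) * hA + (-2 * (1 - C) ^ 2 * r ^ 2) * hB
  rw [h1, h2, h3, hC, hn]
  field_simp
  ring

theorem waveDen_eq (hβ : β ≠ 0) (x : ℝ) :
    Real.sqrt (sqDistA a b β) * (1 + delta a b β + (delta a b β - 1) * waveCn a b β x) =
      Real.sqrt (sqDistA a b β) + Real.sqrt (sqDistB a b β) +
        (Real.sqrt (sqDistB a b β) - Real.sqrt (sqDistA a b β)) * waveCn a b β x := by
  have hr := Real.sqrt_pos.2 (sqDistA_pos (a := a) (b := b) hβ)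
  rw [delta_eq hβ]; field_simp

theorem sqrt_sqDistA_sq (hβ : β ≠ 0) : Real.sqrt (sqDistA a b β) ^ 2 = sqDistA a b β :=
  Real.sq_sqrt (sqDistA_pos hβ).le

theorem sqrt_sqDistB_sq (hβ : β ≠ 0) : Real.sqrt (sqDistB a b β) ^ 2 = sqDistB a b β :=
  Real.sq_sqrt (sqDistB_pos hβ).le

theorem cnWaveDeriv_sq (hβ : β ≠ 0) (x : ℝ) : cnWaveDeriv a b β x ^ 2 =
    (a - cnWave a b β x) * (cnWave a b β x - b) *
      ((cnWave a b β x - alphaRoot a b) ^ 2 + β ^ 2) := by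
  have hN := (waveDen_pos (a := a) (b := b) hβ x).ne'
  have hr := (Real.sqrt_pos.2 (sqDistA_pos (a := a) (b := b) hβ)).ne'
  have hs := (Real.sqrt_pos.2 (sqDistB_pos (a := a) (b := b) hβ)).ne'
  have hk := kappa_sq (a := a) (b := b) hβ
  rw [Real.sqrt_mul (sqDistA_pos hβ).le] at hk
  have hd : delta a b β * Real.sqrt (sqDistA a b β) = Real.sqrt (sqDistB a b β) := by
    rw [delta_eq hβ]; field_simp
  have hW := waveDen_eq (a := a) (b := b) hβ x
  rw [← waveDeriv_sq_aux hr hs (mul_ne_zero hr hN) hW (waveCnDeriv_sq hβ x) (nu_sq hβ)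
    (sqrt_sqDistA_sq hβ) (sqrt_sqDistB_sq hβ) hk (cnWave a b β x)
    (by rw [cnWave_eq]; congr 1; field_simp), cnWaveDeriv, ← hd]
  generalize 1 + delta a b β + (delta a b β - 1) * waveCn a b β x = N at *
  field_simp

theorem hasDerivAt_cnWaveDeriv (hβ : β ≠ 0) (hab : a ≠ b) (x : ℝ) :
    HasDerivAt (cnWaveDeriv a b β)
      (eConst a b β + speed a b β * cnWave a b β x - 2 * cnWave a b β x ^ 3) x := by
  have hc := hasDerivAt_waveCn (a := a) (b := b) hβ x
  have hc1 := hasDerivAt_waveCnDeriv (a := a) (b := b) hβ x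
  have hN := (waveDen_pos (a := a) (b := b) hβ x).ne'
  have h := ((hc1.const_mul (nu a b β)).const_mul (2 * (a - b) * delta a b β)).fun_div
    (((hc.const_mul (delta a b β - 1)).const_add (1 + delta a b β)).fun_pow 2) (pow_ne_zero 2 hN)
  refine h.congr_deriv ?_
  have hm : a - b ≠ 0 := sub_ne_zero.2 hab
  have hA : Real.sqrt (sqDistA a b β) ^ 2 = (a - -(a + b) / 2) ^ 2 + β ^ 2 :=
    sqrt_sqDistA_sq (a := a) (b := b) hβ
  have hB : Real.sqrt (sqDistB a b β) ^ 2 = (b - -(a + b) / 2) ^ 2 + β ^ 2 :=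
    sqrt_sqDistB_sq (a := a) (b := b) hβ
  have hk : kappa a b β ^ 2 = (1 - ((a - -(a + b) / 2) * (b - -(a + b) / 2) + β ^ 2)
      / Real.sqrt (sqDistA a b β * sqDistB a b β)) / 2 := kappa_sq (a := a) (b := b) hβ
  rw [Real.sqrt_mul (sqDistA_pos hβ).le] at hk
  have hn := nu_sq (a := a) (b := b) hβ
  have hr := (Real.sqrt_pos.2 (sqDistA_pos (a := a) (b := b) hβ)).ne'
  have hs := (Real.sqrt_pos.2 (sqDistB_pos (a := a) (b := b) hβ)).ne'
  have hC := waveCnDeriv_sq (a := a) (b := b) hβ x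
  have hd : delta a b β * Real.sqrt (sqDistA a b β) = Real.sqrt (sqDistB a b β) := by
    rw [delta_eq hβ]; field_simp
  have hW := waveDen_eq (a := a) (b := b) hβ x
  have he : eConst a b β = (a + b) / 2 * ((a - b) ^ 2 / 4 + β ^ 2) := by
    simp only [eConst, alphaRoot]; ring
  have hcc : speed a b β = -(a * b) + 3 / 4 * (a + b) ^ 2 - β ^ 2 := by
    simp only [speed, alphaRoot]; ring
  rw [cnWave_eq, he, hcc]
  generalize Real.sqrt (sqDistA a b β) = r at *
  generalize Real.sqrt (sqDistB a b β) = s at *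
  have hp : a + b = (r ^ 2 - s ^ 2) / (2 * (a - b)) := by
    rw [hA, hB]; field_simp; ring
  have key := waveDeriv_deriv_aux (a := a) (b := b) (β2 := β ^ 2) hm hr hs (mul_ne_zero hr hN) hW
    hC hn (by rw [← hp]; ring) (by rw [← hp]; ring) (by rw [← hp, hA]; ring)
    (by rw [hk, hA, hB]; field_simp; ring)
  generalize hNe : 1 + delta a b β + (delta a b β - 1) * waveCn a b β x = N at *
  have hU : (b - a) * (1 - waveCn a b β x) / N = (b - a) * r * (1 - waveCn a b β x) / (r * N) := by
    field_simp
  rw [hU, ← key, ← hd]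
  push_cast
  field_simp

theorem cnWave_add_period (hβ : β ≠ 0) (x : ℝ) :
    cnWave a b β (x + period a b β) = cnWave a b β x := by
  have : waveCn a b β (x + period a b β) = waveCn a b β x := by
    have hn := (nu_pos (a := a) (b := b) hβ).ne'
    rw [waveCn, period, mul_add, mul_div_cancel₀ _ hn, jacobiCn_add (kappa_sq_lt_one hβ), waveCn]
  rw [cnWave_eq, cnWave_eq, this]

theorem waveCn_zero (hβ : β ≠ 0) : waveCn a b β 0 = 1 := by
  rw [waveCn, mul_zero, jacobiCn_zero (kappa_sq_lt_one hβ)]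

theorem cnWave_zero (hβ : β ≠ 0) : cnWave a b β 0 = a := by
  rw [cnWave_eq, waveCn_zero hβ]; simp

theorem waveCn_swap (x : ℝ) : waveCn b a β x = waveCn a b β x := by
  rw [waveCn, waveCn, kappa_swap, nu_swap]

theorem cnWave_swap_aux {r s C N M a b β2 m : ℝ} (hm : m ≠ 0) (hm' : m = a - b) (hN0 : N ≠ 0)
    (hM0 : M ≠ 0) (hN : N = r + s + (s - r) * C) (hM : M = s + r + (r - s) * C)
    (hA : r ^ 2 = (a - -(a + b) / 2) ^ 2 + β2) (hB : s ^ 2 = (b - -(a + b) / 2) ^ 2 + β2) :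
    (b + (a - b) * s * (1 - C) / M) * ((a + b) / 2 * ((a - b) ^ 2 / 4 + β2) +
        (a + b) ^ 2 * (a + (b - a) * r * (1 - C) / N)) =
      -((a + b) / 2 * ((a - b) ^ 2 / 4 + β2) * (a + (b - a) * r * (1 - C) / N)) +
        (a + b) ^ 2 / 2 * ((a + b) ^ 2 - (-(a * b) + 3 / 4 * (a + b) ^ 2 - β2)) := by
  have hp : a + b = (r ^ 2 - s ^ 2) / (2 * m) := by
    rw [eq_div_iff (mul_ne_zero two_ne_zero hm), hA, hB, hm']; ring
  have ha : a = ((r ^ 2 - s ^ 2) / (2 * m) + m) / 2 := by rw [← hp, hm']; ring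
  have hb : b = ((r ^ 2 - s ^ 2) / (2 * m) - m) / 2 := by rw [← hp, hm']; ring
  have hβ : β2 = r ^ 2 - ((r ^ 2 - s ^ 2) / (2 * m) + m / 2) ^ 2 := by rw [← hp, hA, hm']; ring
  have hba : b - a = -m := by rw [hm']; ring
  rw [hp, hba, ← hm', hβ, ha, hb]
  field_simp
  rw [hN, hM]
  ring

/-- Both profiles are Möbius functions of the same cn, hence of each other. The relation is
normalized so that its denominator e + 4λ₃²U is the one arising in the Darboux formulas. -/
theorem cnWave_swap (hβ : β ≠ 0) (hab : a ≠ b) (x : ℝ) :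
    cnWave b a β x * (eConst a b β + (a + b) ^ 2 * cnWave a b β x) =
      -(eConst a b β * cnWave a b β x) + (a + b) ^ 2 / 2 * ((a + b) ^ 2 - speed a b β) := by
  have hA : Real.sqrt (sqDistA a b β) ^ 2 = (a - -(a + b) / 2) ^ 2 + β ^ 2 :=
    sqrt_sqDistA_sq (a := a) (b := b) hβ
  have hB : Real.sqrt (sqDistB a b β) ^ 2 = (b - -(a + b) / 2) ^ 2 + β ^ 2 :=
    sqrt_sqDistB_sq (a := a) (b := b) hβ
  have hN := (waveDen_pos (a := a) (b := b) hβ x).ne'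
  have hM := (waveDen_pos (a := b) (b := a) hβ x).ne'
  have hWN := waveDen_eq (a := a) (b := b) hβ x
  have hWM := waveDen_eq (a := b) (b := a) hβ x
  have hr := (Real.sqrt_pos.2 (sqDistA_pos (a := a) (b := b) hβ)).ne'
  have hs := (Real.sqrt_pos.2 (sqDistB_pos (a := a) (b := b) hβ)).ne'
  rw [sqDistA_swap (a := a), sqDistB_swap (a := a), waveCn_swap] at hWM
  rw [waveCn_swap] at hM
  have he : eConst a b β = (a + b) / 2 * ((a - b) ^ 2 / 4 + β ^ 2) := by
    simp only [eConst, alphaRoot]; ring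
  have hcc : speed a b β = -(a * b) + 3 / 4 * (a + b) ^ 2 - β ^ 2 := by
    simp only [speed, alphaRoot]; ring
  rw [cnWave_eq, cnWave_eq, waveCn_swap, he, hcc]
  have key := cnWave_swap_aux (sub_ne_zero.2 hab) rfl (mul_ne_zero hr hN)
    (mul_ne_zero hs hM) hWN hWM hA hB
  generalize 1 + delta a b β + (delta a b β - 1) * waveCn a b β x = N at *
  generalize 1 + delta b a β + (delta b a β - 1) * waveCn a b β x = M at *
  rw [mul_right_comm, mul_right_comm (b - a), mul_comm _ N, mul_comm _ M,
    mul_div_mul_right _ _ hr, mul_div_mul_right _ _ hs] at key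
  exact key

end Wave

/-! ### Solutions of the Lax system on a periodic wave -/

open scoped ContDiff ComplexConjugate

/-- Bootstrapping: if y is C^n then so is its derivative F(s, y), and y is C^(n+1). -/
theorem contDiff_of_hasDerivAt {E : Type*} [NormedAddCommGroup E] [NormedSpace ℝ E] {y : ℝ → E}
    {F : ℝ × E → E} (hF : ContDiff ℝ ∞ F) (hy : ∀ s, HasDerivAt y (F (s, y s)) s) :
    ContDiff ℝ ∞ y := by
  rw [contDiff_infty]
  intro n
  induction n with
  | zero =>
    exact contDiff_zero.2 (continuous_iff_continuousAt.2 fun s => (hy s).continuousAt)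
  | succ n ih =>
    have hd : deriv y = fun s => F (s, y s) := funext fun s => (hy s).deriv
    rw [Nat.cast_succ]
    refine contDiff_succ_iff_deriv.2 ⟨fun s => (hy s).differentiableAt, by simp, ?_⟩
    rw [hd]
    exact (hF.of_le (by exact_mod_cast le_top)).comp (contDiff_id.prodMk ih)

/-- `U` is an `L`-periodic solution of `U'' = e + c U - 2 U³` of energy `d`, with derivative `U₁`. -/
structure Profile (U U₁ : ℝ → ℝ) (c e d L : ℝ) : Prop where
  pos : 0 < L
  hasDerivAt : ∀ y, HasDerivAt U (U₁ y) y
  hasDerivAt' : ∀ y, HasDerivAt U₁ (e + c * U y - 2 * U y ^ 3) y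
  energy : ∀ y, U₁ y ^ 2 = -U y ^ 4 + c * U y ^ 2 + 2 * e * U y - d
  periodic : ∀ y, U (y + L) = U y
  periodic' : ∀ y, U₁ (y + L) = U₁ y

/-- `l` is a branch point of the spectral curve of the wave `U`, and the squared norm of the
periodic eigenfunction does not vanish. -/
structure BranchPoint (U : ℝ → ℝ) (c e d : ℝ) (l : ℂ) : Prop where
  curve : 16 * l ^ 6 - 8 * c * l ^ 4 + (c ^ 2 - 4 * d) * l ^ 2 - e ^ 2 = 0
  ne_zero : l ≠ 0
  den_ne_zero : ∀ y, 4 * l ^ 2 * U y + e ≠ 0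

/-- The Lax system in components, at one point. -/
structure LaxAt (l : ℂ) (u u₁ u₂ : ℂ) (p q : ℝ → ℝ → ℂ) (x t : ℝ) : Prop where
  px : HasDerivAt (fun y => p y t) (l * p x t + u * q x t) x
  qx : HasDerivAt (fun y => q y t) (-(u * p x t) - l * q x t) x
  pt : HasDerivAt (fun s => p x s) ((-4 * l ^ 3 - 2 * l * u ^ 2) * p x t +
    (-4 * l ^ 2 * u - 2 * l * u₁ - 2 * u ^ 3 - u₂) * q x t) t
  qt : HasDerivAt (fun s => q x s) ((4 * l ^ 2 * u - 2 * l * u₁ + 2 * u ^ 3 + u₂) * p x t +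
    (4 * l ^ 3 + 2 * l * u ^ 2) * q x t) t

theorem isLaxSolution_iff {l : ℂ} {u : ℝ → ℝ → ℝ} {φ : ℝ → ℝ → Fin 2 → ℂ} :
    IsLaxSolution l u φ ↔ ∀ x t, LaxAt l (u x t) (deriv (fun y => u y t) x : ℝ)
      (iteratedDeriv 2 (fun y => u y t) x : ℝ) (fun x t => φ x t 0) (fun x t => φ x t 1) x t := by
  refine forall₂_congr fun x t => ?_
  rw [hasDerivAt_pi, hasDerivAt_pi]
  simp only [Fin.forall_fin_two, laxU, laxV, Matrix.mulVec, dotProduct, Fin.sum_univ_two,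
    Matrix.of_apply, Matrix.cons_val_zero, Matrix.cons_val_one, Matrix.cons_val_fin_one]
  constructor
  · rintro ⟨⟨h1, h2⟩, h3, h4⟩
    exact ⟨h1, h2.congr_deriv (by ring), h3, h4⟩
  · rintro ⟨h1, h2, h3, h4⟩
    exact ⟨⟨h1, h2.congr_deriv (by ring)⟩, h3, h4⟩

theorem const_of_hasDerivAt_zero {w : ℝ → ℝ → ℂ}
    (hx : ∀ x t, HasDerivAt (fun y => w y t) 0 x) (ht : ∀ x t, HasDerivAt (fun s => w x s) 0 t)
    (x t : ℝ) : w x t = w 0 0 := by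
  have h1 := is_const_of_deriv_eq_zero (fun y => (hx y t).differentiableAt)
    (fun y => (hx y t).deriv) x 0
  have h2 := is_const_of_deriv_eq_zero (fun s => (ht 0 s).differentiableAt)
    (fun s => (ht 0 s).deriv) t 0
  exact h1.trans h2

/-- Both Lax matrices are trace-free. -/
theorem wronskian_const {l : ℂ} {u u₁ u₂ p q p' q' : ℝ → ℝ → ℂ}
    (h : ∀ x t, LaxAt l (u x t) (u₁ x t) (u₂ x t) p q x t)
    (h' : ∀ x t, LaxAt l (u x t) (u₁ x t) (u₂ x t) p' q' x t) (x t : ℝ) :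
    p x t * q' x t - q x t * p' x t = p 0 0 * q' 0 0 - q 0 0 * p' 0 0 := by
  refine const_of_hasDerivAt_zero (w := fun x t => p x t * q' x t - q x t * p' x t) ?_ ?_ x t
  · intro x t
    exact (((h x t).px.mul (h' x t).qx).sub ((h x t).qx.mul (h' x t).px)).congr_deriv (by ring)
  · intro x t
    exact (((h x t).pt.mul (h' x t).qt).sub ((h x t).qt.mul (h' x t).pt)).congr_deriv (by ring)

/-- The squared norm `p² + q²` of the normalized periodic eigenfunction. -/
def eigenDen (U : ℝ → ℝ) (e : ℝ) (l : ℂ) (y : ℝ) : ℂ := 2 * (4 * l ^ 2 * U y + e)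

/-- A periodic eigenfunction, normalized up to the factor `k`. -/
structure EigenPair (U U₁ : ℝ → ℝ) (c e : ℝ) (l k : ℂ) (p q : ℝ → ℂ) : Prop where
  ne_zero : k ≠ 0
  px : ∀ y, HasDerivAt p (l * p y + U y * q y) y
  qx : ∀ y, HasDerivAt q (-(U y * p y) - l * q y) y
  sum : ∀ y, p y ^ 2 + q y ^ 2 = k * eigenDen U e l y
  diff : ∀ y, p y ^ 2 - q y ^ 2 = k * (4 * l * U₁ y)
  prod : ∀ y, p y * q y = -(k * (l * (4 * l ^ 2 + 2 * U y ^ 2 - c)))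

theorem EigenPair.smul {U U₁ : ℝ → ℝ} {c e : ℝ} {l k s : ℂ} {p q : ℝ → ℂ}
    (h : EigenPair U U₁ c e l k p q) (hs : s ≠ 0) :
    EigenPair U U₁ c e l (k * s ^ 2) (fun y => s * p y) (fun y => s * q y) where
  ne_zero := mul_ne_zero h.ne_zero (pow_ne_zero 2 hs)
  px y := ((h.px y).const_mul s).congr_deriv (by ring)
  qx y := ((h.qx y).const_mul s).congr_deriv (by ring)
  sum y := by linear_combination s ^ 2 * h.sum y
  diff y := by linear_combination s ^ 2 * h.diff y
  prod y := by linear_combination s ^ 2 * h.prod y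

/-- The rate of growth of the phase of the second solutions. -/
def phaseRate (U : ℝ → ℝ) (c e : ℝ) (l : ℂ) (y : ℝ) : ℂ :=
  -(l ^ 2 * (4 * l ^ 2 + 2 * U y ^ 2 - c)) / (4 * l ^ 2 * U y + e) ^ 2

/-- The phase of the second solutions. -/
def phase (U : ℝ → ℝ) (c e : ℝ) (l : ℂ) (y : ℝ) : ℂ := ∫ s in (0 : ℝ)..y, phaseRate U c e l s

/-! ### Existence and sign-periodicity of the eigenfunction; the phase over a period. -/

section

variable {U U₁ : ℝ → ℝ} {c e d L : ℝ} {l k : ℂ} {p q : ℝ → ℂ}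

theorem Profile.continuous (hU : Profile U U₁ c e d L) : Continuous U :=
  continuous_iff_continuousAt.2 fun y => (hU.hasDerivAt y).continuousAt

theorem Profile.continuous' (hU : Profile U U₁ c e d L) : Continuous U₁ :=
  continuous_iff_continuousAt.2 fun y => (hU.hasDerivAt' y).continuousAt

theorem Profile.contDiff (hU : Profile U U₁ c e d L) : ContDiff ℝ ∞ U := by
  have h : ContDiff ℝ ∞ fun y => (U y, U₁ y) :=
    contDiff_of_hasDerivAt (F := fun z : ℝ × ℝ × ℝ => (z.2.2, e + c * z.2.1 - 2 * z.2.1 ^ 3))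
      (by fun_prop) fun s => (hU.hasDerivAt s).prodMk (hU.hasDerivAt' s)
  exact contDiff_fst.comp h

theorem EigenPair.contDiff (hU : Profile U U₁ c e d L) (h : EigenPair U U₁ c e l k p q) :
    ContDiff ℝ ∞ p ∧ ContDiff ℝ ∞ q := by
  have hc : ContDiff ℝ ∞ fun y => (U y : ℂ) := Complex.ofRealCLM.contDiff.comp hU.contDiff
  have hc1 : ContDiff ℝ ∞ fun z : ℝ × ℂ × ℂ => (U z.1 : ℂ) := hc.comp contDiff_fst
  have hc2 : ContDiff ℝ ∞ fun z : ℝ × ℂ × ℂ =>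
      ((l * z.2.1 + U z.1 * z.2.2, -(U z.1 * z.2.1) - l * z.2.2) : ℂ × ℂ) := by fun_prop
  have h : ContDiff ℝ ∞ fun y => (p y, q y) :=
    contDiff_of_hasDerivAt hc2 fun s => (h.px s).prodMk (h.qx s)
  exact ⟨contDiff_fst.comp h, contDiff_snd.comp h⟩

theorem EigenPair.continuous (h : EigenPair U U₁ c e l k p q) : Continuous p ∧ Continuous q :=
  ⟨continuous_iff_continuousAt.2 fun y => (h.px y).continuousAt,
    continuous_iff_continuousAt.2 fun y => (h.qx y).continuousAt⟩

theorem eigenDen_ne_zero (hl : BranchPoint U c e d l) (y : ℝ) : eigenDen U e l y ≠ 0 :=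
  mul_ne_zero two_ne_zero (hl.den_ne_zero y)

theorem hasDerivAt_ofReal {f : ℝ → ℝ} {f' y : ℝ} (h : HasDerivAt f f' y) :
    HasDerivAt (fun y => (f y : ℂ)) f' y := h.ofReal_comp

theorem hasDerivAt_eigenDen (hU : Profile U U₁ c e d L) (y : ℝ) :
    HasDerivAt (eigenDen U e l) (8 * l ^ 2 * U₁ y) y := by
  have h := (((hasDerivAt_ofReal (hU.hasDerivAt y)).const_mul (4 * l ^ 2)).add_const
    (e : ℂ)).const_mul 2
  exact h.congr_deriv (by ring)

theorem continuous_phaseRate (hU : Profile U U₁ c e d L) (hl : BranchPoint U c e d l) :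
    Continuous (phaseRate U c e l) := by
  have hc : Continuous fun y => (U y : ℂ) := Complex.continuous_ofReal.comp hU.continuous
  exact Continuous.div (by fun_prop) (by fun_prop) fun y => pow_ne_zero 2 (hl.den_ne_zero y)

theorem hasDerivAt_phase (hU : Profile U U₁ c e d L) (hl : BranchPoint U c e d l) (y : ℝ) :
    HasDerivAt (phase U c e l) (phaseRate U c e l y) y :=
  have hc := continuous_phaseRate hU hl
  intervalIntegral.integral_hasDerivAt_right (hc.intervalIntegrable _ _)
    (hc.stronglyMeasurableAtFilter _ _) hc.continuousAt

theorem contDiff_phase (hU : Profile U U₁ c e d L) (hl : BranchPoint U c e d l) :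
    ContDiff ℝ ∞ (phase U c e l) := by
  have hc : ContDiff ℝ ∞ fun y => (U y : ℂ) := Complex.ofRealCLM.contDiff.comp hU.contDiff
  have h1 : ContDiff ℝ ∞ fun y => (4 * l ^ 2 * (U y : ℂ) + e) ^ 2 := by fun_prop
  have h2 : ContDiff ℝ ∞ fun y => -(l ^ 2 * (4 * l ^ 2 + 2 * (U y : ℂ) ^ 2 - c)) := by fun_prop
  have h : ContDiff ℝ ∞ (phaseRate U c e l) :=
    h2.mul (h1.inv fun y => pow_ne_zero 2 (hl.den_ne_zero y))
  exact contDiff_of_hasDerivAt (h.comp contDiff_fst) (hasDerivAt_phase hU hl)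

theorem phase_add_period (hU : Profile U U₁ c e d L) (hl : BranchPoint U c e d l) (y : ℝ) :
    phase U c e l (y + L) = phase U c e l y + phase U c e l L := by
  have hp : Function.Periodic (phaseRate U c e l) L := fun y => by
    simp only [phaseRate, hU.periodic]
  have h : ∀ x, HasDerivAt (fun x => phase U c e l (x + L) - phase U c e l x) 0 x := fun x => by
    have h1 := (hasDerivAt_phase hU hl (x + L)).comp_add_const x L
    exact (h1.sub (hasDerivAt_phase hU hl x)).congr_deriv (by rw [hp x, sub_self])
  have := is_const_of_deriv_eq_zero (fun x => (h x).differentiableAt) (fun x => (h x).deriv) y 0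
  simp only [zero_add] at this
  rw [show phase U c e l 0 = 0 by simp [phase]] at this
  linear_combination this

/-- In the variables f = p + iq, g = p - iq the prescribed data read f² = Z, g² = Y, fg = D, and the
curve equation is their compatibility ZY = D². Since D never vanishes, neither does Z, so Z has a
smooth square root along the whole line. -/
theorem exists_eigenPair (hU : Profile U U₁ c e d L) (hl : BranchPoint U c e d l) :
    ∃ p q, EigenPair U U₁ c e l 1 p q := by
  set D := eigenDen U e l with hD
  set R : ℝ → ℂ := fun y => l * (4 * l ^ 2 + 2 * U y ^ 2 - c) with hR
  set Z : ℝ → ℂ := fun y => 4 * l * U₁ y - 2 * Complex.I * R y with hZ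
  set Y : ℝ → ℂ := fun y => 4 * l * U₁ y + 2 * Complex.I * R y with hY
  have hI := Complex.I_sq
  have hZY : ∀ y, Z y * Y y = D y ^ 2 := fun y => by
    have he : (U₁ y : ℂ) ^ 2 = -(U y : ℂ) ^ 4 + c * (U y : ℂ) ^ 2 + 2 * e * U y - d := by
      exact_mod_cast congrArg (fun r : ℝ => (r : ℂ)) (hU.energy y)
    simp only [hZ, hY, hD, eigenDen, hR]
    linear_combination 16 * l ^ 2 * he - 4 * l ^ 2 * (4 * l ^ 2 + 2 * U y ^ 2 - c) ^ 2 * hI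
      + 4 * hl.curve
  have hD0 : ∀ y, D y ≠ 0 := eigenDen_ne_zero hl
  have hZ0 : ∀ y, Z y ≠ 0 := fun y h => hD0 y (by
    have := hZY y; rw [h, zero_mul] at this; exact pow_eq_zero_iff two_ne_zero |>.1 this.symm)
  have hcU : Continuous fun y => (U y : ℂ) := Complex.continuous_ofReal.comp hU.continuous
  have hcU1 : Continuous fun y => (U₁ y : ℂ) := Complex.continuous_ofReal.comp hU.continuous'
  -- The spatial equation is f' = -iUf + lg. With g = D/f and f² = Z the logarithmic derivative of f
  -- must be this function, so f is found by exponentiating its primitive.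
  set h : ℝ → ℂ := fun y => -Complex.I * U y + l * D y / Z y with hh
  have hch : Continuous h := by
    refine Continuous.add (by fun_prop) (Continuous.div ?_ (by fun_prop) hZ0)
    simp only [hD, eigenDen]; fun_prop
  set H : ℝ → ℂ := fun y => ∫ s in (0 : ℝ)..y, h s
  have hH : ∀ y, HasDerivAt H (h y) y := fun y =>
    intervalIntegral.integral_hasDerivAt_right (hch.intervalIntegrable _ _)
      (hch.stronglyMeasurableAtFilter _ _) hch.continuousAt
  have hdU := fun y => hasDerivAt_ofReal (hU.hasDerivAt y)
  have hdU1 := fun y => hasDerivAt_ofReal (hU.hasDerivAt' y)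
  have hdR : ∀ y, HasDerivAt R (4 * l * U y * U₁ y) y := fun y => by
    have := (((((hdU y).fun_pow 2).const_mul 2).const_add (4 * l ^ 2)).sub_const (c : ℂ)).const_mul l
    exact this.congr_deriv (by push_cast; ring)
  have hdZ : ∀ y, HasDerivAt Z (2 * h y * Z y) y := fun y => by
    refine (((hdU1 y).const_mul (4 * l)).sub
      ((hdR y).const_mul (2 * Complex.I))).congr_deriv ?_
    have h1 : h y * Z y = -Complex.I * U y * Z y + l * D y := by
      simp only [hh]; rw [add_mul, div_mul_cancel₀ _ (hZ0 y)]
    rw [mul_assoc 2 (h y), h1]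
    simp only [hZ, hD, eigenDen, hR]
    push_cast
    linear_combination (-4 * l * U y * (4 * l ^ 2 + 2 * U y ^ 2 - c)) * hI
  obtain ⟨z, hz⟩ := IsAlgClosed.exists_pow_nat_eq (Z 0) two_pos
  set f : ℝ → ℂ := fun y => z * Complex.exp (H y)
  have hdf : ∀ y, HasDerivAt f (h y * f y) y := fun y =>
    ((hH y).cexp.const_mul z).congr_deriv (by ring)
  have hf2 : ∀ y, f y ^ 2 = Z y := fun y => by
    have h1 : ∀ y, HasDerivAt (fun y => f y ^ 2 / Z y) 0 y := fun y =>
      (((hdf y).fun_pow 2).fun_div (hdZ y) (hZ0 y)).congr_deriv (by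
        rw [div_eq_zero_iff]; left; push_cast; ring)
    have h2 := is_const_of_deriv_eq_zero (fun x => (h1 x).differentiableAt)
      (fun x => (h1 x).deriv) y 0
    have h3 : f 0 ^ 2 = Z 0 := by simp [f, H, hz]
    rw [h3, div_self (hZ0 0), div_eq_one_iff_eq (hZ0 y)] at h2
    exact h2
  have hf0 : ∀ y, f y ≠ 0 := fun y h => hZ0 y (by rw [← hf2, h]; ring)
  -- Defining g through the product, and not as another square root, fixes the relative sign of f
  -- and g.
  set g : ℝ → ℂ := fun y => D y / f y with hg
  have hfg : ∀ y, f y * g y = D y := fun y => mul_div_cancel₀ _ (hf0 y)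
  have hg2 : ∀ y, g y ^ 2 = Y y := fun y => by
    have : Z y * g y ^ 2 = Z y * Y y := by rw [hZY, ← hf2, ← hfg]; ring
    exact mul_left_cancel₀ (hZ0 y) this
  have hdf' : ∀ y, HasDerivAt f (-Complex.I * U y * f y + l * g y) y := fun y =>
    (hdf y).congr_deriv (by
      simp only [hh]
      rw [add_mul, ← hf2, ← hfg]; congr 1
      have := hf0 y; field_simp)
  have hdg : ∀ y, HasDerivAt g (Complex.I * U y * g y + l * f y) y := fun y => by
    refine ((hasDerivAt_eigenDen (l := l) (e := e) hU y).fun_div (hdf' y) (hf0 y)).congr_deriv ?_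
    rw [div_eq_iff (pow_ne_zero 2 (hf0 y))]
    have h8 : 8 * l ^ 2 * (U₁ y : ℂ) = l * (f y ^ 2 + g y ^ 2) := by
      rw [hf2, hg2]; simp only [hZ, hY]; ring
    rw [h8, show eigenDen U e l y = f y * g y from (hfg y).symm]; ring
  refine ⟨fun y => (f y + g y) / 2, fun y => (f y - g y) / (2 * Complex.I), one_ne_zero, ?_, ?_,
    ?_, ?_, ?_⟩
  · intro y
    refine (((hdf' y).add (hdg y)).div_const 2).congr_deriv ?_
    field_simp
    linear_combination (g y - f y) * U y * hI
  · intro y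
    refine (((hdf' y).sub (hdg y)).div_const (2 * Complex.I)).congr_deriv ?_
    field_simp
    ring
  · intro y
    rw [div_pow, div_pow, mul_pow, hI, one_mul, ← hD, ← hfg]; ring
  · intro y
    have h8 : 4 * l * (U₁ y : ℂ) = (f y ^ 2 + g y ^ 2) / 2 := by
      rw [hf2, hg2]; simp only [hZ, hY]; ring
    rw [div_pow, div_pow, mul_pow, hI, one_mul, h8]; ring
  · intro y
    have h8 : R y * (4 * Complex.I) = g y ^ 2 - f y ^ 2 := by
      rw [hf2, hg2]; simp only [hZ, hY]; ring
    have : R y = (g y ^ 2 - f y ^ 2) / (4 * Complex.I) := by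
      rw [← h8, mul_div_cancel_right₀]; simp
    rw [one_mul, show l * (4 * l ^ 2 + 2 * (U y : ℂ) ^ 2 - c) = R y from rfl, this]
    field_simp
    ring

/-- The quadratic data are L-periodic, so the shifted pair has the same squares and the same
product. The Wronskian of the pair and its shift then has square zero, so the two are proportional
with a factor of square 1, and the common linear equation makes this factor constant. -/
theorem EigenPair.antiperiodic (hU : Profile U U₁ c e d L) (hl : BranchPoint U c e d l)
    (h : EigenPair U U₁ c e l k p q) :
    ∃ σ : ℂ, (σ = 1 ∨ σ = -1) ∧ ∀ y, p (y + L) = σ * p y ∧ q (y + L) = σ * q y := by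
  have hkD : ∀ y, k * eigenDen U e l y ≠ 0 := fun y =>
    mul_ne_zero h.ne_zero (eigenDen_ne_zero hl y)
  have hDp : ∀ y, eigenDen U e l (y + L) = eigenDen U e l y := fun y => by
    simp only [eigenDen, hU.periodic]
  have hs := fun y => h.sum (y + L)
  have hdf := fun y => h.diff (y + L)
  have hpr := fun y => h.prod (y + L)
  simp only [hDp, hU.periodic, hU.periodic'] at hs hdf hpr
  have hp2 : ∀ y, p (y + L) ^ 2 = p y ^ 2 := fun y => by
    linear_combination (hs y + hdf y - h.sum y - h.diff y) / 2
  have hq2 : ∀ y, q (y + L) ^ 2 = q y ^ 2 := fun y => by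
    linear_combination (hs y - hdf y - h.sum y + h.diff y) / 2
  have hpq : ∀ y, p (y + L) * q (y + L) = p y * q y := fun y => by
    linear_combination hpr y - h.prod y
  have hw : ∀ y, p y * q (y + L) - q y * p (y + L) = 0 := fun y => by
    have : (p y * q (y + L) - q y * p (y + L)) ^ 2 = 0 := by
      linear_combination p y ^ 2 * hq2 y + q y ^ 2 * hp2 y - 2 * p y * q y * hpq y
    exact pow_eq_zero_iff two_ne_zero |>.1 this
  -- This form of the factor has the nowhere vanishing denominator p² + q², so zeros of p or q alone
  -- do no harm.
  set ρ : ℝ → ℂ := fun y => (p y * p (y + L) + q y * q (y + L)) / (p y ^ 2 + q y ^ 2) with hρ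
  have h0 : ∀ y, p y ^ 2 + q y ^ 2 ≠ 0 := fun y => by rw [h.sum]; exact hkD y
  have hρp : ∀ y, p (y + L) = ρ y * p y := fun y => by
    simp only [hρ]
    rw [div_mul_eq_mul_div, eq_div_iff (h0 y)]
    linear_combination (-q y) * hw y
  have hρq : ∀ y, q (y + L) = ρ y * q y := fun y => by
    simp only [hρ]
    rw [div_mul_eq_mul_div, eq_div_iff (h0 y)]
    linear_combination p y * hw y
  have hρ2 : ∀ y, ρ y ^ 2 = 1 := fun y => by
    have : (ρ y ^ 2 - 1) * (p y ^ 2 + q y ^ 2) = 0 := by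
      have h1 := hp2 y
      have h2 := hq2 y
      rw [hρp] at h1
      rw [hρq] at h2
      linear_combination h1 + h2
    exact sub_eq_zero.1 ((mul_eq_zero.1 this).resolve_right (h0 y))
  have hd : ∀ y, HasDerivAt ρ 0 y := fun y => by
    have hpL := (h.px (y + L)).comp_add_const y L
    have hqL := (h.qx (y + L)).comp_add_const y L
    refine ((((h.px y).mul hpL).add ((h.qx y).mul hqL)).div
      (((h.px y).pow 2).add ((h.qx y).pow 2)) (h0 y)).congr_deriv ?_
    rw [div_eq_zero_iff]; left
    simp only [Pi.add_apply, Pi.mul_apply, Pi.pow_apply, hU.periodic, hρp, hρq]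
    push_cast
    ring
  have hc := fun y => is_const_of_deriv_eq_zero (fun x => (hd x).differentiableAt)
      (fun x => (hd x).deriv) y 0
  refine ⟨ρ 0, sq_eq_sq_iff_eq_or_eq_neg.1 (by rw [hρ2, one_pow]), fun y => ?_⟩
  rw [hρp, hρq, hc y]
  exact ⟨rfl, rfl⟩

end

/-! ### Second solutions -/

section

variable {U U₁ : ℝ → ℝ} {c e d L : ℝ} {l k C : ℂ} {p q : ℝ → ℂ}

theorem hasDerivAt_travelling_x {E : Type*} [NormedAddCommGroup E] [NormedSpace ℝ E] {f : ℝ → E}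
    {f' : E} {x t : ℝ} (h : HasDerivAt f f' (x - c * t)) :
    HasDerivAt (fun y => f (y - c * t)) f' x := by
  simpa using h.comp_sub_const x (c * t)

theorem hasDerivAt_travelling_t {E : Type*} [NormedAddCommGroup E] [NormedSpace ℝ E] {f : ℝ → E}
    {f' : E} {x t : ℝ} (h : HasDerivAt f f' (x - c * t)) :
    HasDerivAt (fun s => f (x - c * s)) ((-c) • f') t := by
  have h1 : HasDerivAt (fun s => x - c * s) (-c) t := by
    simpa using ((hasDerivAt_id t).const_mul c).const_sub x
  exact h.scomp t h1

theorem Profile.isLaxSolution_iff (hU : Profile U U₁ c e d L) {φ : ℝ → ℝ → Fin 2 → ℂ} :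
    IsLaxSolution l (travelling U c) φ ↔ ∀ x t, LaxAt l (U (x - c * t)) (U₁ (x - c * t))
      (e + c * U (x - c * t) - 2 * U (x - c * t) ^ 3 : ℝ)
      (fun x t => φ x t 0) (fun x t => φ x t 1) x t := by
  rw [MKdV.isLaxSolution_iff]
  refine forall₂_congr fun x t => ?_
  have h1 : ∀ x t, deriv (fun y => travelling U c y t) x = U₁ (x - c * t) := fun x t =>
    (hasDerivAt_travelling_x (hU.hasDerivAt _)).deriv
  have h2 : iteratedDeriv 2 (fun y => travelling U c y t) x =
      e + c * U (x - c * t) - 2 * U (x - c * t) ^ 3 := by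
    rw [iteratedDeriv_succ, iteratedDeriv_one, funext fun x => h1 x t]
    exact (hasDerivAt_travelling_x (hU.hasDerivAt' _)).deriv
  rw [h1, h2, travelling]

/-- This is the kernel condition for V + c·`laxU`, with U'' eliminated by the profile equation.
After multiplication by k both rows follow from the quadratic data. -/
theorem EigenPair.stationary (h : EigenPair U U₁ c e l k p q) (y : ℝ) :
    -(l * (4 * l ^ 2 + 2 * U y ^ 2 - c)) * p y + -(4 * l ^ 2 * U y + e + 2 * l * U₁ y) * q y = 0 ∧
    (4 * l ^ 2 * U y + e - 2 * l * U₁ y) * p y + l * (4 * l ^ 2 + 2 * U y ^ 2 - c) * q y = 0 := by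
  have hs := h.sum y
  have hd := h.diff y
  have hp := h.prod y
  rw [eigenDen] at hs
  constructor <;> apply mul_left_cancel₀ h.ne_zero
  · linear_combination (-p y) * hp + (q y / 2) * hs + q y / 2 * hd
  · linear_combination (q y) * hp - (p y / 2) * hs + p y / 2 * hd

theorem EigenPair.laxAt (h : EigenPair U U₁ c e l k p q) (x t : ℝ) :
    LaxAt l (U (x - c * t)) (U₁ (x - c * t))
      (e + c * U (x - c * t) - 2 * U (x - c * t) ^ 3 : ℝ)
      (fun x t => p (x - c * t)) (fun x t => q (x - c * t)) x t := by
  have hst := h.stationary (x - c * t)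
  refine ⟨hasDerivAt_travelling_x (h.px _), hasDerivAt_travelling_x (h.qx _),
    (hasDerivAt_travelling_t (h.px _)).congr_deriv ?_,
    (hasDerivAt_travelling_t (h.qx _)).congr_deriv ?_⟩
  · rw [Complex.real_smul]; push_cast
    linear_combination (-1 : ℂ) * hst.1
  · rw [Complex.real_smul]; push_cast
    linear_combination (-1 : ℂ) * hst.2

/-- The time-dependent phase of a second solution in the moving frame. -/
def timePhase (U : ℝ → ℝ) (c e : ℝ) (l C : ℂ) (x t : ℝ) : ℂ := t + phase U c e l (x - c * t) + C

theorem hasDerivAt_timePhase_x (hU : Profile U U₁ c e d L) (hl : BranchPoint U c e d l)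
    (x t : ℝ) :
    HasDerivAt (fun x => timePhase U c e l C x t) (phaseRate U c e l (x - c * t)) x :=
  ((hasDerivAt_travelling_x (hasDerivAt_phase hU hl _)).const_add (t : ℂ)).add_const C

theorem hasDerivAt_timePhase_t (hU : Profile U U₁ c e d L) (hl : BranchPoint U c e d l)
    (x t : ℝ) :
    HasDerivAt (fun t => timePhase U c e l C x t) (1 - c * phaseRate U c e l (x - c * t)) t := by
  refine (((hasDerivAt_ofReal (hasDerivAt_id t)).add
    (hasDerivAt_travelling_t (hasDerivAt_phase hU hl _))).add_const C).congr_deriv ?_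
  rw [Complex.real_smul]; push_cast; ring

/-- First component of a second solution. -/
def secondFst (U : ℝ → ℝ) (c e : ℝ) (l C : ℂ) (p q : ℝ → ℂ) (x t : ℝ) : ℂ :=
  timePhase U c e l C x t * p (x - c * t) + q (x - c * t) / eigenDen U e l (x - c * t)

/-- Second component of a second solution. -/
def secondSnd (U : ℝ → ℝ) (c e : ℝ) (l C : ℂ) (p q : ℝ → ℂ) (x t : ℝ) : ℂ :=
  timePhase U c e l C x t * q (x - c * t) - p (x - c * t) / eigenDen U e l (x - c * t)

/-- Variation of constants: (q, -p)/D completes (p, q) to a frame of constant Wronskian and fails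
the spatial equation only by a multiple of (p, q). That multiple, up to sign 4l·pq/(kD²), is the
rate which the phase has to supply. -/
theorem EigenPair.hasDerivAt_div (hU : Profile U U₁ c e d L) (hl : BranchPoint U c e d l)
    (h : EigenPair U U₁ c e l k p q) (y : ℝ) :
    HasDerivAt (fun y => q y / eigenDen U e l y)
      (l * (q y / eigenDen U e l y) - U y * (p y / eigenDen U e l y) - phaseRate U c e l y * p y) y ∧
    HasDerivAt (fun y => p y / eigenDen U e l y)
      (U y * (q y / eigenDen U e l y) - l * (p y / eigenDen U e l y) + phaseRate U c e l y * q y) y := by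
  have hD := eigenDen_ne_zero hl y
  have hd := hasDerivAt_eigenDen (l := l) (e := e) hU y
  have hr : phaseRate U c e l y * (k * eigenDen U e l y ^ 2) = 4 * l * (p y * q y) := by
    rw [h.prod, phaseRate, eigenDen]
    have := hl.den_ne_zero y
    generalize 4 * l ^ 2 * (U y : ℂ) + e = X at *
    field_simp
    ring
  have hr' : phaseRate U c e l y = 4 * l * (p y * q y) / (k * eigenDen U e l y ^ 2) := by
    rw [← hr, mul_div_cancel_right₀]
    exact mul_ne_zero h.ne_zero (pow_ne_zero 2 hD)
  have hk := h.ne_zero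
  have hs := h.sum y
  have hdf := h.diff y
  constructor
  · refine ((h.qx y).fun_div hd hD).congr_deriv ?_
    rw [hr']
    field_simp
    linear_combination (2 * l * q y) * hdf + 2 * l * q y * hs
  · refine ((h.px y).fun_div hd hD).congr_deriv ?_
    rw [hr']
    field_simp
    linear_combination (2 * l * p y) * hdf - 2 * l * p y * hs

theorem EigenPair.laxAt_second (hU : Profile U U₁ c e d L) (hl : BranchPoint U c e d l)
    (h : EigenPair U U₁ c e l k p q) (C : ℂ) (x t : ℝ) :
    LaxAt l (U (x - c * t)) (U₁ (x - c * t))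
      (e + c * U (x - c * t) - 2 * U (x - c * t) ^ 3 : ℝ)
      (secondFst U c e l C p q) (secondSnd U c e l C p q) x t := by
  have hT := hasDerivAt_timePhase_x (C := C) hU hl x t
  have hT' := hasDerivAt_timePhase_t (C := C) hU hl x t
  have hL := h.laxAt x t
  obtain ⟨hq, hp⟩ := h.hasDerivAt_div hU hl (x - c * t)
  have hD := eigenDen_ne_zero hl (x - c * t)
  have hst := h.stationary (x - c * t)
  refine ⟨((hT.mul hL.px).add (hasDerivAt_travelling_x hq)).congr_deriv ?_,
    ((hT.mul hL.qx).sub (hasDerivAt_travelling_x hp)).congr_deriv ?_,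
    ((hT'.mul hL.pt).add (hasDerivAt_travelling_t hq)).congr_deriv ?_,
    ((hT'.mul hL.qt).sub (hasDerivAt_travelling_t hp)).congr_deriv ?_⟩
  · simp only [secondFst, secondSnd]; ring
  · simp only [secondFst, secondSnd]; ring
  -- The matrix V + c·`laxU` sends (q, -p)/D to (p, q); this balances the summand t of the phase.
  · have key : (-(l * (4 * l ^ 2 + 2 * U (x - c * t) ^ 2 - c)) * q (x - c * t) +
        (4 * l ^ 2 * U (x - c * t) + e + 2 * l * U₁ (x - c * t)) * p (x - c * t)) =
          p (x - c * t) * eigenDen U e l (x - c * t) := by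
      rw [eigenDen]; linear_combination (-1 : ℂ) * hst.2
    have key' : p (x - c * t) = (-(l * (4 * l ^ 2 + 2 * U (x - c * t) ^ 2 - c)) * q (x - c * t) +
        (4 * l ^ 2 * U (x - c * t) + e + 2 * l * U₁ (x - c * t)) * p (x - c * t)) /
        eigenDen U e l (x - c * t) := by rw [key, mul_div_cancel_right₀ _ hD]
    simp only [secondFst, secondSnd, Complex.real_smul]
    push_cast
    linear_combination key'
  · have key : ((4 * l ^ 2 * U (x - c * t) + e - 2 * l * U₁ (x - c * t)) * q (x - c * t) -
        l * (4 * l ^ 2 + 2 * U (x - c * t) ^ 2 - c) * p (x - c * t)) =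
          q (x - c * t) * eigenDen U e l (x - c * t) := by
      rw [eigenDen]; linear_combination (1 : ℂ) * hst.1
    have key' : q (x - c * t) = ((4 * l ^ 2 * U (x - c * t) + e - 2 * l * U₁ (x - c * t)) *
        q (x - c * t) - l * (4 * l ^ 2 + 2 * U (x - c * t) ^ 2 - c) * p (x - c * t)) /
        eigenDen U e l (x - c * t) := by rw [key, mul_div_cancel_right₀ _ hD]
    simp only [secondFst, secondSnd, Complex.real_smul]
    push_cast
    linear_combination key'

/-- Since this Wronskian is fixed, the direction of the second solution approaches that of (p, q) as
fast as the second solution grows. All the convergence statements rest on this. -/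
theorem EigenPair.wronskian_second (hl : BranchPoint U c e d l) (h : EigenPair U U₁ c e l k p q)
    (x t : ℝ) : p (x - c * t) * secondSnd U c e l C p q x t -
      q (x - c * t) * secondFst U c e l C p q x t = -k := by
  have hD := eigenDen_ne_zero hl (x - c * t)
  have hs := h.sum (x - c * t)
  simp only [secondSnd, secondFst]
  field_simp
  linear_combination (-1 : ℂ) * hs

/-- Every solution of the Lax system is a combination of the two standard ones. -/
theorem EigenPair.exists_combination (hU : Profile U U₁ c e d L) (hl : BranchPoint U c e d l)
    (h : EigenPair U U₁ c e l k p q) {P Q : ℝ → ℝ → ℂ}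
    (hψ : ∀ x t, LaxAt l (U (x - c * t)) (U₁ (x - c * t))
      (e + c * U (x - c * t) - 2 * U (x - c * t) ^ 3 : ℝ) P Q x t) :
    ∃ m w : ℂ, ∀ x t, P x t = m * p (x - c * t) + w * secondFst U c e l 0 p q x t ∧
      Q x t = m * q (x - c * t) + w * secondSnd U c e l 0 p q x t := by
  have h1 := wronskian_const h.laxAt hψ
  have h2 := wronskian_const (h.laxAt_second hU hl 0) hψ
  set w1 := p (0 - c * 0) * Q 0 0 - q (0 - c * 0) * P 0 0
  set w2 := secondFst U c e l 0 p q 0 0 * Q 0 0 - secondSnd U c e l 0 p q 0 0 * P 0 0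
  refine ⟨w2 / k, -w1 / k, fun x t => ?_⟩
  have h3 := h.wronskian_second (C := 0) hl x t
  have hk := h.ne_zero
  constructor
  · field_simp
    rw [← h1 x t, ← h2 x t]
    linear_combination P x t * h3
  · field_simp
    rw [← h1 x t, ← h2 x t]
    linear_combination Q x t * h3

theorem EigenPair.isPeriodicEigenfunction (hU : Profile U U₁ c e d L)
    (hl : BranchPoint U c e d l) (h : EigenPair U U₁ c e l k p q) :
    IsPeriodicEigenfunction U c L l fun x t => ![p (x - c * t), q (x - c * t)] := by
  refine ⟨fun h0 => ?_, hU.isLaxSolution_iff.2 h.laxAt, fun y => ![p y, q y], fun _ _ => rfl, ?_⟩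
  · have h1 := congrFun (congrFun h0 0) 0
    have hp := congrFun h1 0
    have hq := congrFun h1 1
    have hs := h.sum (0 - c * 0)
    simp only [Matrix.cons_val_zero, Matrix.cons_val_one, Matrix.cons_val_fin_one,
      Pi.zero_apply] at hp hq
    rw [hp, hq] at hs
    exact mul_ne_zero h.ne_zero (eigenDen_ne_zero hl _) (by rw [← hs]; ring)
  · obtain ⟨σ, hσ, hL⟩ := h.antiperiodic hU hl
    rcases hσ with rfl | rfl
    · left; intro y; simp [hL y]
    · right; intro y; simp [hL y]

theorem EigenPair.eq_smul_of_isPeriodicEigenfunction (hU : Profile U U₁ c e d L)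
    (hl : BranchPoint U c e d l) (h : EigenPair U U₁ c e l k p q) {φ : ℝ → ℝ → Fin 2 → ℂ}
    (hφ : IsPeriodicEigenfunction U c L l φ) :
    ∃ m : ℂ, m ≠ 0 ∧ ∀ x t, φ x t = m • ![p (x - c * t), q (x - c * t)] := by
  obtain ⟨h0, hlax, Φ, hΦ, -⟩ := hφ
  obtain ⟨m, w, hmw⟩ := h.exists_combination hU hl (hU.isLaxSolution_iff.1 hlax)
  have hw : w = 0 := by
    -- The points (0, 0) and (c, 1) have the same travelling coordinate, but their phases differ by
    -- 1. A function of x - ct cannot contain such a phase.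
    have a0 := hmw 0 0
    have a1 := hmw c 1
    simp only [hΦ, secondFst, secondSnd, timePhase, mul_zero, mul_one,
      sub_self] at a0 a1
    have e1 : w * p 0 = 0 := by
      push_cast at a0 a1
      linear_combination a0.1 - a1.1
    have e2 : w * q 0 = 0 := by
      push_cast at a0 a1
      linear_combination a0.2 - a1.2
    by_contra hw
    have hs := h.sum 0
    rw [(mul_eq_zero.1 e1).resolve_left hw, (mul_eq_zero.1 e2).resolve_left hw] at hs
    exact mul_ne_zero h.ne_zero (eigenDen_ne_zero hl _) (by rw [← hs]; ring)
  subst hw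
  have hφ' : ∀ x t, φ x t = m • ![p (x - c * t), q (x - c * t)] := fun x t => by
    ext i; fin_cases i
    · simpa using (hmw x t).1
    · simpa using (hmw x t).2
  refine ⟨m, fun hm => h0 ?_, hφ'⟩
  subst hm
  funext x t
  rw [hφ', zero_smul]; rfl

/-- The standard form of the second solutions. -/
theorem exists_eigenPair_of_isSecondSolution (hU : Profile U U₁ c e d L)
    (hl : BranchPoint U c e d l) {ψ : ℝ → ℝ → Fin 2 → ℂ} (hψ : IsSecondSolution U c L l ψ) :
    ∃ p q k C, EigenPair U U₁ c e l k p q ∧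
      ∀ x t, ψ x t 0 = secondFst U c e l C p q x t ∧ ψ x t 1 = secondSnd U c e l C p q x t := by
  obtain ⟨p, q, h⟩ := exists_eigenPair hU hl
  obtain ⟨hlax, φ, hφ, hli⟩ := hψ
  obtain ⟨n, hn, hφn⟩ := h.eq_smul_of_isPeriodicEigenfunction hU hl hφ
  obtain ⟨m, w, hmw⟩ := h.exists_combination hU hl (hU.isLaxSolution_iff.1 hlax)
  have hw : w ≠ 0 := by
    rintro rfl
    rw [LinearIndependent.pair_iff] at hli
    have := hli (m / n) (-1) (by
      funext x t
      have e1 := hmw x t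
      ext i; fin_cases i
      · simp [hφn, e1.1, ← mul_assoc, div_mul_cancel₀ _ hn]
      · simp [hφn, e1.2, ← mul_assoc, div_mul_cancel₀ _ hn])
    simp at this
  -- The weight w is absorbed into the scale of the eigenfunction, and the multiple of (p, q) into
  -- the constant of the phase.
  refine ⟨_, _, _, m / w, h.smul hw, fun x t => ?_⟩
  rw [(hmw x t).1, (hmw x t).2]
  simp only [secondFst, secondSnd, timePhase]
  constructor <;> field_simp <;> ring

end

/-! ### Complex conjugation and linear combinations of Lax solutions -/

section

variable {l u u₁ u₂ : ℂ} {p q p' q' : ℝ → ℝ → ℂ} {x t : ℝ}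

theorem hasDerivAt_conj {f : ℝ → ℂ} {f' : ℂ} (h : HasDerivAt f f' x) :
    HasDerivAt (fun y => conj (f y)) (conj f') x := h.star

theorem LaxAt.conj (h : LaxAt l u u₁ u₂ p q x t) :
    LaxAt (conj l) (conj u) (conj u₁) (conj u₂) (fun x t => conj (p x t))
      (fun x t => conj (q x t)) x t :=
  ⟨(hasDerivAt_conj h.px).congr_deriv (by simp), (hasDerivAt_conj h.qx).congr_deriv (by simp),
    (hasDerivAt_conj h.pt).congr_deriv (by simp [map_ofNat]),
    (hasDerivAt_conj h.qt).congr_deriv (by simp [map_ofNat])⟩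

theorem LaxAt.combination (h : LaxAt l u u₁ u₂ p q x t) (h' : LaxAt l u u₁ u₂ p' q' x t)
    (s r : ℂ) : LaxAt l u u₁ u₂ (fun x t => s * p x t + r * p' x t)
      (fun x t => s * q x t + r * q' x t) x t :=
  ⟨((h.px.const_mul s).add (h'.px.const_mul r)).congr_deriv (by ring),
    ((h.qx.const_mul s).add (h'.qx.const_mul r)).congr_deriv (by ring),
    ((h.pt.const_mul s).add (h'.pt.const_mul r)).congr_deriv (by ring),
    ((h.qt.const_mul s).add (h'.qt.const_mul r)).congr_deriv (by ring)⟩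

end

/-! ### Conjugate second solutions, existence of second solutions, and their basic size estimates.
-/

section

variable {U U₁ : ℝ → ℝ} {c e d L : ℝ} {l k C : ℂ} {p q : ℝ → ℂ}

theorem IsLaxSolution.conj {u : ℝ → ℝ → ℝ} {ψ : ℝ → ℝ → Fin 2 → ℂ} (h : IsLaxSolution l u ψ) :
    IsLaxSolution (conj l) u (conjSol ψ) :=
  isLaxSolution_iff.2 fun x t => by
    have h' := (isLaxSolution_iff.1 h x t).conj
    simp only [Complex.conj_ofReal] at h'
    exact h'

theorem IsSecondSolution.conj {ψ : ℝ → ℝ → Fin 2 → ℂ} (h : IsSecondSolution U c L l ψ) :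
    IsSecondSolution U c L (conj l) (conjSol ψ) := by
  obtain ⟨hlax, φ, ⟨h0, hφ, Φ, hΦ, hper⟩, hli⟩ := h
  refine ⟨hlax.conj, conjSol φ, ⟨fun h => h0 ?_, hφ.conj, fun y i => starRingEnd ℂ (Φ y i), ?_, ?_⟩,
    ?_⟩
  · funext x t i
    have := congrFun (congrFun (congrFun h x) t) i
    simpa [conjSol] using this
  · intro x t; funext i; simp [conjSol, hΦ]
  · refine hper.imp (fun h y => ?_) fun h y => ?_ <;> funext i <;> simp [h]
  · rw [LinearIndependent.pair_iff] at hli ⊢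
    intro s r hsr
    have := hli (starRingEnd ℂ s) (starRingEnd ℂ r) (by
      funext x t i
      have := congrArg (starRingEnd ℂ) (congrFun (congrFun (congrFun hsr x) t) i)
      simpa [conjSol] using this)
    simpa using this

theorem EigenPair.isSecondSolution (hU : Profile U U₁ c e d L) (hl : BranchPoint U c e d l)
    (h : EigenPair U U₁ c e l k p q) {ψ : ℝ → ℝ → Fin 2 → ℂ}
    (hψ : IsLaxSolution l (travelling U c) ψ) (hw : p 0 * ψ 0 0 1 - q 0 * ψ 0 0 0 ≠ 0) :
    IsSecondSolution U c L l ψ := by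
  refine ⟨hψ, _, h.isPeriodicEigenfunction hU hl, ?_⟩
  rw [LinearIndependent.pair_iff]
  intro s r hsr
  have h1 := congrFun (congrFun hsr 0) 0
  have e0 := congrFun h1 0
  have e1 := congrFun h1 1
  simp at e0 e1
  have hr : r * (p 0 * ψ 0 0 1 - q 0 * ψ 0 0 0) = 0 := by linear_combination p 0 * e1 - q 0 * e0
  have hs : s * (p 0 * ψ 0 0 1 - q 0 * ψ 0 0 0) = 0 := by
    linear_combination ψ 0 0 1 * e0 - ψ 0 0 0 * e1
  exact ⟨(mul_eq_zero.1 hs).resolve_right hw, (mul_eq_zero.1 hr).resolve_right hw⟩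

theorem exists_isSecondSolution (hU : Profile U U₁ c e d L) (hl : BranchPoint U c e d l) :
    ∃ ψ, IsSecondSolution U c L l ψ := by
  obtain ⟨p, q, h⟩ := exists_eigenPair hU hl
  refine ⟨fun x t => ![secondFst U c e l 0 p q x t, secondSnd U c e l 0 p q x t],
    h.isSecondSolution hU hl (hU.isLaxSolution_iff.2 (h.laxAt_second hU hl 0)) ?_⟩
  have := h.wronskian_second (C := 0) hl 0 0
  simp only [mul_zero, sub_zero] at this
  simp [this]

/-- For real λ the real and imaginary parts of a second solution solve the same system. Their
Wronskians with (p, q) cannot both vanish, because the Wronskian of the second solution itself does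
not. -/
theorem exists_isSecondSolution_real {l : ℝ} (hU : Profile U U₁ c e d L)
    (hl : BranchPoint U c e d l) :
    ∃ ψ, IsSecondSolution U c L l ψ ∧ IsRealValued ψ := by
  obtain ⟨p, q, h⟩ := exists_eigenPair hU hl
  have hL := h.laxAt_second hU hl 0
  have hw := h.wronskian_second (C := 0) hl 0 0
  set P := secondFst U c e l 0 p q
  set Q := secondSnd U c e l 0 p q
  -- The choices (1, 1) and (-i, i) give twice the real and twice the imaginary part.
  have key : ∀ s r : ℂ, (∀ z : ℂ, (s * z + r * conj z).im = 0) →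
      p 0 * (s * Q 0 0 + r * conj (Q 0 0)) - q 0 * (s * P 0 0 + r * conj (P 0 0)) ≠ 0 →
      ∃ ψ, IsSecondSolution U c L l ψ ∧ IsRealValued ψ := by
    intro s r hsr hne
    have hL' : ∀ x t, LaxAt (l : ℂ) (U (x - c * t)) (U₁ (x - c * t))
        (e + c * U (x - c * t) - 2 * U (x - c * t) ^ 3 : ℝ)
        (fun x t => conj (P x t)) (fun x t => conj (Q x t)) x t := fun x t => by
      simpa only [Complex.conj_ofReal] using (hL x t).conj
    refine ⟨fun x t => ![s * P x t + r * conj (P x t), s * Q x t + r * conj (Q x t)],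
      h.isSecondSolution hU hl (hU.isLaxSolution_iff.2 fun x t =>
        (hL x t).combination (hL' x t) s r) ?_, ?_⟩
    · simpa using hne
    · intro x t i
      fin_cases i
      · simpa using hsr (P x t)
      · simpa using hsr (Q x t)
  have hI := Complex.I_sq
  simp only [mul_zero, sub_zero] at hw
  by_cases hre : p 0 * (1 * Q 0 0 + 1 * conj (Q 0 0)) - q 0 * (1 * P 0 0 + 1 * conj (P 0 0)) = 0
  · refine key (-Complex.I) Complex.I (fun z => by simp) fun him => ?_
    have : (-1 : ℂ) = 0 := by linear_combination (1 / 2 : ℂ) * hre - hw + (1 / 2) * Complex.I * him +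
      (1 / 2) * (p 0 * (Q 0 0 - conj (Q 0 0)) - q 0 * (P 0 0 - conj (P 0 0))) * hI
    simp at this
  · exact key 1 1 (fun z => by simp) hre

/-! ### Growth of the second solutions -/

theorem exists_bound_of_periodic {f : ℝ → ℝ} (hf : Continuous f) (hL : 0 < L)
    (hp : ∀ y, f (y + L) = f y) : ∃ M, 0 < M ∧ ∀ y, |f y| ≤ M := by
  have := Function.Periodic.isBounded_of_continuous (f := f) (c := L) hp hL.ne' hf
  obtain ⟨M, hM⟩ := this.exists_norm_le
  exact ⟨max M 1, by positivity, fun y => (hM _ ⟨y, rfl⟩).trans (le_max_left _ _)⟩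

theorem exists_lower_bound_of_periodic {f : ℝ → ℝ} (hf : Continuous f) (hL : 0 < L)
    (hp : ∀ y, f (y + L) = f y) (h0 : ∀ y, 0 < f y) : ∃ m, 0 < m ∧ ∀ y, m ≤ f y := by
  obtain ⟨M, hM, h⟩ := exists_bound_of_periodic (f := fun y => (f y)⁻¹)
    (hf.inv₀ fun y => (h0 y).ne') hL (fun y => by simp only [hp])
  refine ⟨M⁻¹, inv_pos.2 hM, fun y => ?_⟩
  rw [inv_le_comm₀ hM (h0 y)]
  exact (le_abs_self _).trans (h y)

theorem EigenPair.bounds (hU : Profile U U₁ c e d L) (hl : BranchPoint U c e d l)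
    (h : EigenPair U U₁ c e l k p q) : ∃ m M : ℝ, 0 < m ∧ 0 < M ∧ ∀ y,
      m ≤ ‖p y‖ + ‖q y‖ ∧ ‖p y‖ + ‖q y‖ ≤ M ∧
      (‖p y‖ + ‖q y‖) / ‖eigenDen U e l y‖ ≤ M := by
  obtain ⟨σ, hσ, hL⟩ := h.antiperiodic hU hl
  have hσ1 : ‖σ‖ = 1 := by rcases hσ with rfl | rfl <;> simp
  have hc : Continuous fun y => ‖p y‖ + ‖q y‖ := h.continuous.1.norm.add h.continuous.2.norm
  have hp : ∀ y, ‖p (y + L)‖ + ‖q (y + L)‖ = ‖p y‖ + ‖q y‖ := fun y => by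
    rw [(hL y).1, (hL y).2, norm_mul, norm_mul, hσ1, one_mul, one_mul]
  have hcD : Continuous fun y => ‖eigenDen U e l y‖ :=
    (continuous_iff_continuousAt.2 fun y => (hasDerivAt_eigenDen hU y).continuousAt).norm
  have h0 : ∀ y, 0 < ‖p y‖ + ‖q y‖ := fun y => by
    by_contra hn
    have hp0 : p y = 0 := norm_le_zero_iff.1 (by linarith [norm_nonneg (p y), norm_nonneg (q y)])
    have hq0 : q y = 0 := norm_le_zero_iff.1 (by linarith [norm_nonneg (p y), norm_nonneg (q y)])
    have hs := h.sum y
    rw [hp0, hq0] at hs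
    exact mul_ne_zero h.ne_zero (eigenDen_ne_zero hl y) (by rw [← hs]; ring)
  obtain ⟨m, hm, h1⟩ := exists_lower_bound_of_periodic hc hU.pos hp h0
  obtain ⟨M, hM, h2⟩ := exists_bound_of_periodic hc hU.pos hp
  obtain ⟨M', hM', h3⟩ := exists_bound_of_periodic
    (f := fun y => (‖p y‖ + ‖q y‖) / ‖eigenDen U e l y‖)
    (hc.div hcD fun y => norm_ne_zero_iff.2 (eigenDen_ne_zero hl y)) hU.pos
    (fun y => by simp only [hp, eigenDen, hU.periodic])
  exact ⟨m, max M M', hm, by positivity, fun y => ⟨h1 y,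
    ((le_abs_self _).trans (h2 y)).trans (le_max_left _ _),
    ((le_abs_self _).trans (h3 y)).trans (le_max_right _ _)⟩⟩

/-- Subtracting its mean slope makes the phase L-periodic, hence bounded. -/
theorem timePhase_bound (hU : Profile U U₁ c e d L) (hl : BranchPoint U c e d l) (C : ℂ) :
    ∃ M : ℝ, 0 < M ∧ ∀ x t,
      ‖timePhase U c e l C x t - (t + phase U c e l L / L * (x - c * t : ℝ))‖ ≤ M := by
  have hc : Continuous (phase U c e l) :=
    continuous_iff_continuousAt.2 fun y => (hasDerivAt_phase hU hl y).continuousAt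
  have hL0 : (L : ℂ) ≠ 0 := by exact_mod_cast hU.pos.ne'
  obtain ⟨M, hM, h⟩ := exists_bound_of_periodic
    (f := fun y : ℝ => ‖phase U c e l y + C - phase U c e l L / L * y‖)
    (by fun_prop) hU.pos (fun y => by
      rw [phase_add_period hU hl]; congr 1; push_cast; field_simp; ring)
  refine ⟨M, hM, fun x t => ?_⟩
  have := (le_abs_self _).trans (h (x - c * t))
  rwa [show timePhase U c e l C x t - (t + phase U c e l L / L * (x - c * t : ℝ)) =
    phase U c e l (x - c * t) + C - phase U c e l L / L * (x - c * t : ℝ) by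
      rw [timePhase]; ring]

/-- The absolute value of the phase controls the size of a second solution. -/
theorem second_bounds (hU : Profile U U₁ c e d L) (hl : BranchPoint U c e d l)
    (h : EigenPair U U₁ c e l k p q) (C : ℂ) : ∃ m M : ℝ, 0 < m ∧ 0 < M ∧ ∀ x t,
      m * ‖timePhase U c e l C x t‖ - M ≤
        ‖secondFst U c e l C p q x t‖ + ‖secondSnd U c e l C p q x t‖ ∧
      ‖secondFst U c e l C p q x t‖ + ‖secondSnd U c e l C p q x t‖ ≤
        M * (1 + ‖timePhase U c e l C x t‖) := by
  obtain ⟨m, M, hm, hM, hb⟩ := h.bounds hU hl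
  refine ⟨m, M, hm, hM, fun x t => ?_⟩
  obtain ⟨h1, h2, h3⟩ := hb (x - c * t)
  rw [add_div] at h3
  simp only [secondFst, secondSnd]
  set T := timePhase U c e l C x t
  generalize p (x - c * t) = a at *
  generalize q (x - c * t) = b at *
  generalize eigenDen U e l (x - c * t) = D at *
  have e1 := norm_add_le (T * a) (b / D)
  have e2 := norm_sub_le (T * b) (a / D)
  have e3 := norm_sub_norm_le (T * a) (-(b / D))
  have e4 := norm_sub_norm_le (T * b) (a / D)
  simp only [sub_neg_eq_add, norm_neg, norm_mul, norm_div] at e1 e2 e3 e4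
  have hT := norm_nonneg T
  constructor <;> nlinarith

end

/-! ### Real form of the second solutions, and linear growth. -/

section

variable {U U₁ : ℝ → ℝ} {c e d L : ℝ} {l k C : ℂ} {p q : ℝ → ℂ}

/-- The nilpotent matrix V + c·`laxU` maps the second solution onto (p, q). The eigenfunction is
thus recovered algebraically, and it is real when λ and the second solution are real. -/
theorem EigenPair.eq_lax_second (hl : BranchPoint U c e d l)
    (h : EigenPair U U₁ c e l k p q) (x t : ℝ) :
    p (x - c * t) = -(l * (4 * l ^ 2 + 2 * U (x - c * t) ^ 2 - c)) * secondFst U c e l C p q x t -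
      (4 * l ^ 2 * U (x - c * t) + e + 2 * l * U₁ (x - c * t)) * secondSnd U c e l C p q x t ∧
    q (x - c * t) = (4 * l ^ 2 * U (x - c * t) + e - 2 * l * U₁ (x - c * t)) *
        secondFst U c e l C p q x t +
      l * (4 * l ^ 2 + 2 * U (x - c * t) ^ 2 - c) * secondSnd U c e l C p q x t := by
  have hst := h.stationary (x - c * t)
  have hD := eigenDen_ne_zero hl (x - c * t)
  have key : p (x - c * t) = (-(l * (4 * l ^ 2 + 2 * U (x - c * t) ^ 2 - c)) * q (x - c * t) +
      (4 * l ^ 2 * U (x - c * t) + e + 2 * l * U₁ (x - c * t)) * p (x - c * t)) /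
      eigenDen U e l (x - c * t) := by
    rw [eq_div_iff hD, eigenDen]; linear_combination hst.2
  have key' : q (x - c * t) = ((4 * l ^ 2 * U (x - c * t) + e - 2 * l * U₁ (x - c * t)) *
      q (x - c * t) - l * (4 * l ^ 2 + 2 * U (x - c * t) ^ 2 - c) * p (x - c * t)) /
      eigenDen U e l (x - c * t) := by
    rw [eq_div_iff hD, eigenDen]; linear_combination (-1 : ℂ) * hst.1
  simp only [secondFst, secondSnd]
  constructor
  · linear_combination key - timePhase U c e l C x t * hst.1
  · linear_combination key' - timePhase U c e l C x t * hst.2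

theorem exists_real_eigenPair_of_isSecondSolution {l : ℝ} (hU : Profile U U₁ c e d L)
    (hl : BranchPoint U c e d l) {ψ : ℝ → ℝ → Fin 2 → ℂ} (hψ : IsSecondSolution U c L l ψ)
    (hr : IsRealValued ψ) :
    ∃ (p q : ℝ → ℝ) (k C : ℝ), EigenPair U U₁ c e l k (fun y => p y) (fun y => q y) ∧
      ∀ x t, ψ x t 0 = secondFst U c e l C (fun y => p y) (fun y => q y) x t ∧
        ψ x t 1 = secondSnd U c e l C (fun y => p y) (fun y => q y) x t := by
  obtain ⟨p, q, k, C, h, hφ⟩ := exists_eigenPair_of_isSecondSolution hU hl hψ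
  have him : ∀ x t, (secondFst U c e l C p q x t).im = 0 ∧ (secondSnd U c e l C p q x t).im = 0 :=
    fun x t => ⟨by rw [← (hφ x t).1]; exact hr x t 0, by rw [← (hφ x t).2]; exact hr x t 1⟩
  have hpr : ∀ y, p y = ((p y).re : ℂ) := fun y => by
    have := (h.eq_lax_second (C := C) hl y 0).1
    rw [mul_zero, sub_zero, ← Complex.conj_eq_iff_im.2 (him y 0).1,
      ← Complex.conj_eq_iff_im.2 (him y 0).2] at this
    refine (Complex.conj_eq_iff_re.1 ?_).symm
    rw [this]
    simp only [map_sub, map_mul, map_neg, map_add, map_pow, Complex.conj_ofReal, map_ofNat,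
      Complex.conj_eq_iff_im.2 (him y 0).1,
      Complex.conj_eq_iff_im.2 (him y 0).2]
  have hqr : ∀ y, q y = ((q y).re : ℂ) := fun y => by
    have := (h.eq_lax_second (C := C) hl y 0).2
    rw [mul_zero, sub_zero, ← Complex.conj_eq_iff_im.2 (him y 0).1,
      ← Complex.conj_eq_iff_im.2 (him y 0).2] at this
    refine (Complex.conj_eq_iff_re.1 ?_).symm
    rw [this]
    simp only [map_sub, map_mul, map_add, map_pow, Complex.conj_ofReal, map_ofNat,
      Complex.conj_eq_iff_im.2 (him y 0).1,
      Complex.conj_eq_iff_im.2 (him y 0).2]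
  have hk0 := mul_ne_zero h.ne_zero (eigenDen_ne_zero hl 0)
  have hk : k = (k.re : ℂ) := by
    have h1 : k = (p 0 ^ 2 + q 0 ^ 2) / eigenDen U e l 0 := by
      rw [h.sum, mul_div_cancel_right₀ _ (eigenDen_ne_zero hl 0)]
    refine (Complex.conj_eq_iff_re.1 ?_).symm
    rw [h1, hpr 0, hqr 0, eigenDen]
    simp [map_ofNat]
  have hC : C = (C.re : ℂ) := by
    have h1 : C = (p 0 * secondFst U c e l C p q 0 0 + q 0 * secondSnd U c e l C p q 0 0) /
        (p 0 ^ 2 + q 0 ^ 2) := by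
      rw [eq_div_iff (by rw [h.sum]; exact hk0)]
      simp [secondFst, secondSnd, timePhase, phase]
      ring
    refine (Complex.conj_eq_iff_re.1 ?_).symm
    rw [h1]
    simp only [map_div₀, map_add, map_mul, map_pow, Complex.conj_eq_iff_im.2 (him 0 0).1,
      Complex.conj_eq_iff_im.2 (him 0 0).2]
    rw [hpr 0, hqr 0]
    simp
  have hp' : p = fun y => ((p y).re : ℂ) := funext hpr
  have hq' : q = fun y => ((q y).re : ℂ) := funext hqr
  refine ⟨fun y => (p y).re, fun y => (q y).re, k.re, C.re, ?_, ?_⟩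
  · rw [← hp', ← hq', ← hk]; exact h
  · rw [← hp', ← hq', ← hC]; exact hφ

/-- With Im σ ≠ 0, the real-linear map (x, t) ↦ t + σ(x - ct) is an isomorphism of the plane onto ℂ.
-/
theorem exists_bounds_linear_phase (hU : Profile U U₁ c e d L)
    (hτ : (phase U c e l L).im ≠ 0) :
    ∃ m M : ℝ, 0 < m ∧ 0 < M ∧ ∀ x t,
      m * (|x| + |t|) ≤ ‖(t + phase U c e l L / L * (x - c * t : ℝ) : ℂ)‖ ∧
      ‖(t + phase U c e l L / L * (x - c * t : ℝ) : ℂ)‖ ≤ M * (|x| + |t|) := by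
  set σ : ℂ := phase U c e l L / L
  have hσ : σ.im ≠ 0 := by
    rw [show σ.im = (phase U c e l L).im / L from Complex.div_ofReal_im _ _]
    exact div_ne_zero hτ hU.pos.ne'
  have hpos : 0 < |σ.im| := abs_pos.2 hσ
  -- For the value z of the map, |Im σ||x - ct| ≤ |z| from the imaginary part and |t| ≤ |z| + |σ||x
  -- - ct|. Recovering |x| from |x - ct| and |t| leads to the lower constant.
  refine ⟨|σ.im| / (1 + (1 + |c|) * (|σ.im| + ‖σ‖)), 1 + ‖σ‖ * (1 + |c|), by positivity,
    by positivity, fun x t => ?_⟩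
  have hcc := abs_nonneg c
  have hxx := abs_nonneg x
  have htt := abs_nonneg t
  have hss := norm_nonneg σ
  have hy : |x - c * t| ≤ |x| + |c| * |t| := by rw [← abs_mul]; exact abs_sub x (c * t)
  constructor
  · rw [div_mul_eq_mul_div, div_le_iff₀ (by positivity)]
    set z : ℂ := (t : ℂ) + σ * (x - c * t : ℝ)
    have h1 : |σ.im| * |x - c * t| ≤ ‖z‖ := by
      rw [← abs_mul]
      refine le_trans (le_of_eq ?_) (Complex.abs_im_le_norm z)
      simp [z]
    have h2 : |t| ≤ ‖z‖ + ‖σ‖ * |x - c * t| := by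
      have := norm_sub_le z (σ * (x - c * t : ℝ))
      rw [add_sub_cancel_right, norm_mul, Complex.norm_real, Complex.norm_real] at this
      exact this
    have h3 : |x| ≤ |x - c * t| + |c| * |t| := by
      have := abs_add_le (x - c * t) (c * t)
      rwa [sub_add_cancel, abs_mul] at this
    have h2' : |σ.im| * |t| ≤ (|σ.im| + ‖σ‖) * ‖z‖ := by
      nlinarith [mul_le_mul_of_nonneg_left h2 hpos.le, mul_le_mul_of_nonneg_left h1 hss]
    have hz := norm_nonneg z
    have hsi : |σ.im| ≤ ‖σ‖ := Complex.abs_im_le_norm σ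
    have h4 : |σ.im| * |x| ≤ ‖z‖ + |c| * ((|σ.im| + ‖σ‖) * ‖z‖) := by
      nlinarith [mul_le_mul_of_nonneg_left h3 hpos.le, mul_le_mul_of_nonneg_left h2' hcc]
    nlinarith
  · refine (norm_add_le _ _).trans ?_
    rw [norm_mul, Complex.norm_real, Complex.norm_real, Real.norm_eq_abs, Real.norm_eq_abs]
    nlinarith [mul_le_mul_of_nonneg_left hy hss, mul_nonneg hss hxx, mul_nonneg hss htt,
      mul_nonneg (mul_nonneg hss hcc) hxx]

theorem timePhase_bounds (hU : Profile U U₁ c e d L) (hl : BranchPoint U c e d l)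
    (hτ : (phase U c e l L).im ≠ 0) (C : ℂ) :
    ∃ m M : ℝ, 0 < m ∧ 0 < M ∧ ∀ x t, m * (|x| + |t|) - M ≤ ‖timePhase U c e l C x t‖ ∧
      ‖timePhase U c e l C x t‖ ≤ M * (1 + |x| + |t|) := by
  obtain ⟨m, M, hm, hM, h⟩ := exists_bounds_linear_phase hU hτ
  obtain ⟨M', hM', h'⟩ := timePhase_bound hU hl C
  refine ⟨m, M + M', hm, by positivity, fun x t => ?_⟩
  obtain ⟨h1, h2⟩ := h x t
  have h3 := h' x t
  rw [norm_sub_rev] at h3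
  have h4 := norm_sub_norm_le (t + phase U c e l L / L * (x - c * t : ℝ) : ℂ)
    (timePhase U c e l C x t)
  rw [norm_sub_rev] at h3
  have h5 := norm_sub_norm_le (timePhase U c e l C x t)
    (t + phase U c e l L / L * (x - c * t : ℝ) : ℂ)
  rw [norm_sub_rev] at h4
  have := abs_nonneg x
  have := abs_nonneg t
  constructor
  · linarith
  · nlinarith

theorem norm_fin_two_bounds (v : Fin 2 → ℂ) :
    ‖v‖ ≤ ‖v 0‖ + ‖v 1‖ ∧ ‖v 0‖ + ‖v 1‖ ≤ 2 * ‖v‖ := by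
  constructor
  · refine (pi_norm_le_iff_of_nonneg (by positivity)).2 fun i => ?_
    fin_cases i <;> simp
  · linarith [norm_le_pi_norm v 0, norm_le_pi_norm v 1]

theorem growsLinearly_of_isSecondSolution (hU : Profile U U₁ c e d L)
    (hl : BranchPoint U c e d l) (hτ : (phase U c e l L).im ≠ 0) {ψ : ℝ → ℝ → Fin 2 → ℂ}
    (hψ : IsSecondSolution U c L l ψ) : GrowsLinearly ψ := by
  obtain ⟨p, q, k, C, h, hφ⟩ := exists_eigenPair_of_isSecondSolution hU hl hψ
  obtain ⟨m, M, hm, hM, h1⟩ := timePhase_bounds hU hl hτ C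
  obtain ⟨n, N, hn, hN, h2⟩ := second_bounds hU hl h C
  refine ⟨n * m / 2, n * M + N + N * (1 + M), by positivity, fun x t => ?_⟩
  obtain ⟨a1, a2⟩ := norm_fin_two_bounds (ψ x t)
  obtain ⟨b1, b2⟩ := h1 x t
  obtain ⟨c1, c2⟩ := h2 x t
  rw [(hφ x t).1, (hφ x t).2] at a1 a2
  have h4 := mul_le_mul_of_nonneg_left b1 hn.le
  have h5 := mul_le_mul_of_nonneg_left b2 hN.le
  have hx := abs_nonneg x
  have ht := abs_nonneg t
  have hnM : 0 < n * M := by positivity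
  have hNM : 0 < N * M := by positivity
  have hz := norm_nonneg (timePhase U c e l C x t)
  constructor
  · nlinarith
  · nlinarith [mul_nonneg hN.le hx, mul_nonneg hN.le ht, mul_nonneg hnM.le hx,
      mul_nonneg hnM.le ht]

/-- For real τ, t + (τ/L)(x - ct) is τ/L times x - (c - L/τ)t, which identifies the exceptional
direction. Shifting the line by ξ₀ only changes the bounded error. -/
theorem growsLinearlyOffLine_of_isSecondSolution {τ : ℝ} (hU : Profile U U₁ c e d L)
    (hl : BranchPoint U c e d l) (hτ : phase U c e l L = τ) (hτ0 : τ ≠ 0)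
    {ψ : ℝ → ℝ → Fin 2 → ℂ} (hψ : IsSecondSolution U c L l ψ) (ξ₀ : ℝ) :
    GrowsLinearlyOffLine (c - L / τ) ξ₀ ψ := by
  obtain ⟨p, q, k, C, h, hφ⟩ := exists_eigenPair_of_isSecondSolution hU hl hψ
  obtain ⟨M, hM, h1⟩ := timePhase_bound hU hl C
  obtain ⟨n, N, hn, hN, h2⟩ := second_bounds hU hl h C
  have hL := hU.pos
  set σ := τ / L
  have hσ : 0 < |σ| := abs_pos.2 (div_ne_zero hτ0 hL.ne')
  have hlin : ∀ x t : ℝ, (t + phase U c e l L / L * (x - c * t : ℝ) : ℂ) =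
      ((σ * (x - (c - L / τ) * t) : ℝ) : ℂ) := fun x t => by
    rw [hτ, ← Complex.ofReal_div, ← Complex.ofReal_mul, ← Complex.ofReal_add]
    congr 1
    simp only [σ]
    field_simp
    ring
  refine ⟨n * |σ| / 2, n * (M + |σ| * |ξ₀|) + N + N * (1 + (M + |σ| * |ξ₀|) + |σ|), by positivity,
    fun x t => ?_⟩
  obtain ⟨a1, a2⟩ := norm_fin_two_bounds (ψ x t)
  obtain ⟨c1, c2⟩ := h2 x t
  rw [(hφ x t).1, (hφ x t).2] at a1 a2
  have h3 := h1 x t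
  rw [hlin] at h3
  have e1 : ‖((σ * (x - (c - L / τ) * t) : ℝ) : ℂ)‖ = |σ| * |x - (c - L / τ) * t| := by
    rw [Complex.norm_real, Real.norm_eq_abs, abs_mul]
  have h4 := norm_sub_norm_le (timePhase U c e l C x t) ((σ * (x - (c - L / τ) * t) : ℝ) : ℂ)
  have h5 := norm_sub_norm_le ((σ * (x - (c - L / τ) * t) : ℝ) : ℂ) (timePhase U c e l C x t)
  rw [norm_sub_rev] at h5
  rw [e1] at h4 h5
  set X := x - (c - L / τ) * t
  have h6 := abs_sub_abs_le_abs_sub X ξ₀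
  have h7 := abs_sub X ξ₀
  have hz := norm_nonneg (timePhase U c e l C x t)
  set T := ‖timePhase U c e l C x t‖
  have b1 : |σ| * |X - ξ₀| - (M + |σ| * |ξ₀|) ≤ T := by nlinarith
  have b2 : T ≤ |σ| * |X - ξ₀| + (M + |σ| * |ξ₀|) := by nlinarith
  have h8 := mul_le_mul_of_nonneg_left b1 hn.le
  have h9 := mul_le_mul_of_nonneg_left b2 hN.le
  have hX := abs_nonneg (X - ξ₀)
  have hA : 0 ≤ M + |σ| * |ξ₀| := by positivity
  generalize |X - ξ₀| = Y at *
  generalize M + |σ| * |ξ₀| = A at *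
  have hnA : 0 ≤ n * A := by positivity
  have hNA : 0 ≤ N * A := by positivity
  have hNs : 0 ≤ N * |σ| := by positivity
  constructor
  · nlinarith
  · have : 0 ≤ (n * A + N + N * A) * Y := by positivity
    nlinarith

end

/-! ### Spectral data of the cn-type wave -/

section

variable {a b β : ℝ}

theorem cnWaveDeriv_add_period (hβ : β ≠ 0) (x : ℝ) :
    cnWaveDeriv a b β (x + period a b β) = cnWaveDeriv a b β x := by
  have h1 := (hasDerivAt_cnWave (a := a) (b := b) hβ (x + period a b β)).comp_add_const x _
  have h2 : (fun y => cnWave a b β (y + period a b β)) = cnWave a b β :=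
    funext fun y => cnWave_add_period hβ y
  rw [h2] at h1
  exact h1.unique (hasDerivAt_cnWave hβ x)

theorem cnWave_profile (hβ : β ≠ 0) (hab : a ≠ b) :
    Profile (cnWave a b β) (cnWaveDeriv a b β) (speed a b β) (eConst a b β)
      (a * b * (alphaRoot a b ^ 2 + β ^ 2)) (period a b β) where
  pos := period_pos hβ
  hasDerivAt := hasDerivAt_cnWave hβ
  hasDerivAt' := hasDerivAt_cnWaveDeriv hβ hab
  energy y := by rw [cnWaveDeriv_sq hβ]; simp only [speed, eConst, alphaRoot]; ring
  periodic := cnWave_add_period hβ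
  periodic' := cnWaveDeriv_add_period hβ

theorem speed_eq_lam : (speed a b β : ℂ) =
    2 * (lam1 a b β ^ 2 + lam2 a b β ^ 2 + lam3 a b ^ 2) := by
  simp only [speed, alphaRoot, lam1, lam2, lam3]
  push_cast
  linear_combination (-(β : ℂ) ^ 2) * Complex.I_sq

theorem eConst_eq_lam : (eConst a b β : ℂ) = 4 * lam1 a b β * lam2 a b β * lam3 a b := by
  simp only [eConst, alphaRoot, lam1, lam2, lam3]
  push_cast
  linear_combination (((a : ℂ) + b) / 2 * β ^ 2) * Complex.I_sq

theorem fst_eq_lam : (a : ℂ) = lam1 a b β + lam2 a b β + lam3 a b := by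
  simp only [lam1, lam2, lam3]; ring

theorem energy_eq_lam : ((a * b * (alphaRoot a b ^ 2 + β ^ 2) : ℝ) : ℂ) =
    (lam3 a b ^ 2 - (lam1 a b β + lam2 a b β) ^ 2) *
      (lam3 a b ^ 2 - (lam1 a b β - lam2 a b β) ^ 2) := by
  simp only [alphaRoot, lam1, lam2, lam3]
  push_cast
  linear_combination ((a : ℂ) * b * β ^ 2) * Complex.I_sq

theorem conj_lam1 : conj (lam1 a b β) = lam2 a b β := by
  simp [lam1, lam2, map_ofNat]; ring

theorem conj_lam2 : conj (lam2 a b β) = lam1 a b β := by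
  rw [← conj_lam1, Complex.conj_conj]

theorem lam3_eq_ofReal : lam3 a b = (((a + b) / 2 : ℝ) : ℂ) := by simp [lam3]

theorem lam1_eq : lam1 a b β = (((a - b) / 4 : ℝ) : ℂ) + ((β / 2 : ℝ) : ℂ) * Complex.I := by
  simp only [lam1]; push_cast; ring

theorem lam1_re : (lam1 a b β).re = (a - b) / 4 := by simp [lam1_eq]

theorem lam1_im : (lam1 a b β).im = β / 2 := by simp [lam1_eq]

theorem eConst_ne_zero (hab : a ≠ b) (hab' : a ≠ -b) : eConst a b β ≠ 0 := by
  have he : eConst a b β = (a + b) / 2 * ((a - b) ^ 2 / 4 + β ^ 2) := by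
    simp only [eConst, alphaRoot]; ring
  rw [he]
  have h1 : 0 < (a - b) ^ 2 := by have := sub_ne_zero.2 hab; positivity
  have h2 : a + b ≠ 0 := fun h => hab' (by linarith)
  have h3 : 0 < (a - b) ^ 2 / 4 + β ^ 2 := by positivity
  exact mul_ne_zero (div_ne_zero h2 two_ne_zero) h3.ne'

/-- The imaginary part of 4λ₁²U + e is (a - b)βU, so a zero would force U = 0 and then e = 0, which
is excluded. -/
theorem branchPoint_lam1 (hβ : β ≠ 0) (hab : a ≠ b) (hab' : a ≠ -b) :
    BranchPoint (cnWave a b β) (speed a b β) (eConst a b β)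
      (a * b * (alphaRoot a b ^ 2 + β ^ 2)) (lam1 a b β) where
  curve := by
    rw [speed_eq_lam, eConst_eq_lam, energy_eq_lam]; ring
  ne_zero h := by
    have := congrArg Complex.im h
    rw [lam1_im] at this
    exact hβ (by simpa using this)
  den_ne_zero y h := by
    have h3 : 4 * lam1 a b β ^ 2 * cnWave a b β y + eConst a b β =
        ((((a - b) ^ 2 / 4 - β ^ 2) * cnWave a b β y + eConst a b β : ℝ) : ℂ) +
          (((a - b) * β * cnWave a b β y : ℝ) : ℂ) * Complex.I := by
      simp only [lam1]; push_cast; linear_combination (β : ℂ) ^ 2 * cnWave a b β y * Complex.I_sq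
    rw [h3] at h
    have h1 := congrArg Complex.im h
    have h2 := congrArg Complex.re h
    rw [Complex.add_im, Complex.ofReal_im, Complex.im_ofReal_mul, Complex.I_im] at h1
    rw [Complex.add_re, Complex.ofReal_re, Complex.re_ofReal_mul, Complex.I_re] at h2
    simp only [zero_add, mul_one, mul_zero, add_zero, Complex.zero_im, Complex.zero_re,
      mul_eq_zero] at h1 h2
    have hU : cnWave a b β y = 0 := by
      rcases h1 with (h1 | h1) | h1
      · exact absurd h1 (sub_ne_zero.2 hab)
      · exact absurd h1 hβ
      · exact h1
    rw [hU] at h2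
    exact eConst_ne_zero hab hab' (by simpa using h2)

/-- Here (4λ₃²U + e)² is a positive multiple of a sum of two squares. A zero needs U' = 0, so U is a
or b, where 4λ₃² + 2U² - c equals (3a + b)²/4 + β² or (a + 3b)²/4 + β². -/
theorem branchPoint_lam3 (hβ : β ≠ 0) (hab : a ≠ b) (hab' : a ≠ -b) :
    BranchPoint (cnWave a b β) (speed a b β) (eConst a b β)
      (a * b * (alphaRoot a b ^ 2 + β ^ 2)) (lam3 a b) where
  curve := by
    rw [speed_eq_lam, eConst_eq_lam, energy_eq_lam]; ring
  ne_zero h := by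
    rw [lam3_eq_ofReal, Complex.ofReal_eq_zero] at h
    exact hab' (by linarith)
  den_ne_zero y h := by
    rw [lam3_eq_ofReal] at h
    have h1 : 4 * ((a + b) / 2) ^ 2 * cnWave a b β y + eConst a b β = 0 := by exact_mod_cast h
    have hE := (cnWave_profile (a := a) (b := b) hβ hab).energy y
    have hE' := cnWaveDeriv_sq (a := a) (b := b) hβ y
    set u := cnWave a b β y
    set u1 := cnWaveDeriv a b β y
    have hs : ((a + b) ^ 2) * ((4 * ((a + b) / 2) ^ 2 + 2 * u ^ 2 - speed a b β) ^ 2 + 4 * u1 ^ 2) =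
        4 * (4 * ((a + b) / 2) ^ 2 * u + eConst a b β) ^ 2 := by
      rw [hE]; simp only [speed, eConst, alphaRoot]; ring
    rw [h1] at hs
    have h2 : 0 < (a + b) ^ 2 := by
      have : a + b ≠ 0 := fun h => hab' (by linarith)
      positivity
    have h3 : (4 * ((a + b) / 2) ^ 2 + 2 * u ^ 2 - speed a b β) ^ 2 + 4 * u1 ^ 2 = 0 := by
      rcases mul_eq_zero.1 (hs.trans (by ring)) with h | h
      · exact absurd h h2.ne'
      · exact h
    have h4 : 4 * ((a + b) / 2) ^ 2 + 2 * u ^ 2 - speed a b β = 0 := by nlinarith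
    have h5 : u1 ^ 2 = 0 := by nlinarith
    rw [hE'] at h5
    have hb : 0 < β ^ 2 := by positivity
    have h6 : (u - alphaRoot a b) ^ 2 + β ^ 2 ≠ 0 := by positivity
    simp only [speed, alphaRoot] at h4
    rcases mul_eq_zero.1 ((mul_eq_zero.1 h5).resolve_right h6) with h | h
    · have : u = a := by linarith
      rw [this] at h4
      nlinarith [sq_nonneg (3 * a + b)]
    · have : u = b := by linarith
      rw [this] at h4
      nlinarith [sq_nonneg (a + 3 * b)]

/-- The integrand is a constant multiple of the phase rate, so the non-degeneracy condition concerns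
the phase gained over one period. The factor -2/L is real, so imaginary parts vanish together. -/
theorem mean1_eq : mean1 a b β = -2 / period a b β *
    phase (cnWave a b β) (speed a b β) (eConst a b β) (lam1 a b β) (period a b β) := by
  have h : ∀ y, lam1 a b β ^ 2 * (2 * Complex.I * β * (a - b) - (a + b) ^ 2 +
      4 * (cnWave a b β y : ℂ) ^ 2) / (eConst a b β + 4 * lam1 a b β ^ 2 * cnWave a b β y) ^ 2 =
      -2 * phaseRate (cnWave a b β) (speed a b β) (eConst a b β) (lam1 a b β) y := fun y => by
    have h1 : 2 * Complex.I * β * ((a : ℂ) - b) - (a + b) ^ 2 =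
        2 * (4 * lam1 a b β ^ 2 - speed a b β) := by
      rw [speed_eq_lam]; simp only [lam1, lam2, lam3]
      ring
    rw [h1, phaseRate, ← mul_div_assoc]
    congr 1 <;> ring
  rw [mean1, meanValue, phase, intervalIntegral.integral_congr fun y _ => h y,
    intervalIntegral.integral_const_mul]
  ring

theorem mean3_eq : mean3 a b β = -4 / period a b β *
    phase (cnWave a b β) (speed a b β) (eConst a b β) (lam3 a b) (period a b β) := by
  have h : ∀ y, lam3 a b ^ 2 * (4 * β ^ 2 + a ^ 2 + b ^ 2 + 6 * a * b +
      8 * (cnWave a b β y : ℂ) ^ 2) / (eConst a b β + 4 * lam3 a b ^ 2 * cnWave a b β y) ^ 2 =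
      -4 * phaseRate (cnWave a b β) (speed a b β) (eConst a b β) (lam3 a b) y := fun y => by
    have h1 : 4 * (β : ℂ) ^ 2 + a ^ 2 + b ^ 2 + 6 * a * b =
        4 * (4 * lam3 a b ^ 2 - speed a b β) := by
      simp only [speed, alphaRoot, lam3]; push_cast
      ring
    rw [h1, phaseRate, ← mul_div_assoc]
    congr 1 <;> ring
  rw [mean3, meanValue, phase, intervalIntegral.integral_congr fun y _ => h y,
    intervalIntegral.integral_const_mul]
  ring

theorem phase_lam1_im_ne_zero (h : (mean1 a b β).im ≠ 0) :
    (phase (cnWave a b β) (speed a b β) (eConst a b β) (lam1 a b β) (period a b β)).im ≠ 0 := by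
  rw [mean1_eq, show (-2 / (period a b β : ℂ)) = ((-2 / period a b β : ℝ) : ℂ) by push_cast; ring,
    Complex.im_ofReal_mul] at h
  exact (mul_ne_zero_iff.1 h).2

theorem exists_phase_lam3 (h : mean3 a b β ≠ 0) : ∃ τ : ℝ, τ ≠ 0 ∧
    phase (cnWave a b β) (speed a b β) (eConst a b β) (lam3 a b) (period a b β) = τ := by
  have h1 : phase (cnWave a b β) (speed a b β) (eConst a b β) (lam3 a b) (period a b β) =
      ((∫ s in (0 : ℝ)..period a b β, -(((a + b) / 2) ^ 2 * (4 * ((a + b) / 2) ^ 2 +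
        2 * cnWave a b β s ^ 2 - speed a b β)) /
          (4 * ((a + b) / 2) ^ 2 * cnWave a b β s + eConst a b β) ^ 2 : ℝ) : ℂ) := by
    rw [phase, ← intervalIntegral.integral_ofReal]
    refine intervalIntegral.integral_congr fun y _ => ?_
    simp only [phaseRate, lam3]
    push_cast
    ring
  refine ⟨_, fun h0 => ?_, h1⟩
  rw [h0] at h1
  rw [mean3_eq, h1] at h
  simp at h

end

/-! ### The one-fold Darboux transformation -/

/-- At the point `(x, t)`, the functions `u₁`, `u₂`, `u₃` are the derivatives of `u` with respect
to `x`, and `u` solves the (complex) mKdV equation. -/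
structure JetAt (u u₁ u₂ u₃ : ℝ → ℝ → ℂ) (x t : ℝ) : Prop where
  dx : HasDerivAt (fun y => u y t) (u₁ x t) x
  dx₁ : HasDerivAt (fun y => u₁ y t) (u₂ x t) x
  dx₂ : HasDerivAt (fun y => u₂ y t) (u₃ x t) x
  dt : HasDerivAt (fun s => u x s) (-(6 * u x t ^ 2 * u₁ x t) - u₃ x t) t

/-- `2pq / (p² + q²)`. -/
def darbouxSin (p q : ℝ → ℝ → ℂ) (x t : ℝ) : ℂ := 2 * p x t * q x t / (p x t ^ 2 + q x t ^ 2)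

/-- `(p² - q²) / (p² + q²)`. -/
def darbouxCos (p q : ℝ → ℝ → ℂ) (x t : ℝ) : ℂ :=
  (p x t ^ 2 - q x t ^ 2) / (p x t ^ 2 + q x t ^ 2)

/-- The Darboux-transformed potential. -/
def darbouxU (l : ℂ) (u p q : ℝ → ℝ → ℂ) (x t : ℝ) : ℂ := u x t + 2 * l * darbouxSin p q x t

/-- The derivative of the Darboux-transformed potential. -/
def darbouxU₁ (l : ℂ) (u u₁ p q : ℝ → ℝ → ℂ) (x t : ℝ) : ℂ :=
  u₁ x t - 4 * l * darbouxCos p q x t * (u x t + l * darbouxSin p q x t)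

/-- The second derivative of the Darboux-transformed potential. -/
def darbouxU₂ (l : ℂ) (u u₁ u₂ p q : ℝ → ℝ → ℂ) (x t : ℝ) : ℂ :=
  u₂ x t - 8 * l * darbouxSin p q x t * (u x t + l * darbouxSin p q x t) ^ 2 -
    4 * l * darbouxCos p q x t *
      (u₁ x t - 2 * l * darbouxCos p q x t * (u x t + l * darbouxSin p q x t))

/-- The third derivative of the Darboux-transformed potential. -/
def darbouxU₃ (l : ℂ) (u u₁ u₂ u₃ p q : ℝ → ℝ → ℂ) (x t : ℝ) : ℂ :=
  u₃ x t + 16 * l * darbouxCos p q x t * (u x t + l * darbouxSin p q x t) ^ 3 -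
    24 * l * darbouxSin p q x t * (u x t + l * darbouxSin p q x t) *
      (u₁ x t - 2 * l * darbouxCos p q x t * (u x t + l * darbouxSin p q x t)) -
    4 * l * darbouxCos p q x t *
      (u₂ x t - 4 * l * darbouxSin p q x t * (u x t + l * darbouxSin p q x t) ^ 2 -
        2 * l * darbouxCos p q x t *
          (u₁ x t - 2 * l * darbouxCos p q x t * (u x t + l * darbouxSin p q x t)))

/-- First component of the transformed eigenfunction. -/
def darbouxFst (l l' : ℂ) (p q P Q : ℝ → ℝ → ℂ) (x t : ℝ) : ℂ :=
  l' * P x t - l * (darbouxCos p q x t * P x t + darbouxSin p q x t * Q x t)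

/-- Second component of the transformed eigenfunction. -/
def darbouxSnd (l l' : ℂ) (p q P Q : ℝ → ℝ → ℂ) (x t : ℝ) : ℂ :=
  l' * Q x t - l * (darbouxSin p q x t * P x t - darbouxCos p q x t * Q x t)

section

variable {l l' : ℂ} {u u₁ u₂ u₃ p q P Q : ℝ → ℝ → ℂ} {x t : ℝ}

theorem darboux_sq (h0 : p x t ^ 2 + q x t ^ 2 ≠ 0) :
    darbouxSin p q x t ^ 2 + darbouxCos p q x t ^ 2 = 1 := by
  rw [darbouxSin, darbouxCos, div_pow, div_pow, ← add_div, div_eq_one_iff_eq (pow_ne_zero 2 h0)]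
  ring

theorem hasDerivAt_darbouxSin_x {v v₁ v₂ : ℂ} (h : LaxAt l v v₁ v₂ p q x t)
    (h0 : p x t ^ 2 + q x t ^ 2 ≠ 0) :
    HasDerivAt (fun y => darbouxSin p q y t)
      (-2 * darbouxCos p q x t * (v + l * darbouxSin p q x t)) x := by
  refine (((h.px.const_mul 2).mul h.qx).fun_div ((h.px.fun_pow 2).add (h.qx.fun_pow 2))
    h0).congr_deriv ?_
  simp only [darbouxSin, darbouxCos, Pi.add_apply, Pi.mul_apply]
  generalize hX : p x t ^ 2 + q x t ^ 2 = X at *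
  field_simp
  rw [← hX]
  push_cast
  ring

theorem hasDerivAt_darbouxCos_x {v v₁ v₂ : ℂ} (h : LaxAt l v v₁ v₂ p q x t)
    (h0 : p x t ^ 2 + q x t ^ 2 ≠ 0) :
    HasDerivAt (fun y => darbouxCos p q y t)
      (2 * darbouxSin p q x t * (v + l * darbouxSin p q x t)) x := by
  refine (((h.px.fun_pow 2).sub (h.qx.fun_pow 2)).fun_div ((h.px.fun_pow 2).add (h.qx.fun_pow 2))
    h0).congr_deriv ?_
  simp only [darbouxSin, Pi.add_apply, Pi.sub_apply]
  generalize hX : p x t ^ 2 + q x t ^ 2 = X at *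
  field_simp
  rw [← hX]
  push_cast
  ring

theorem hasDerivAt_darbouxSin_t {v v₁ v₂ : ℂ} (h : LaxAt l v v₁ v₂ p q x t)
    (h0 : p x t ^ 2 + q x t ^ 2 ≠ 0) :
    HasDerivAt (fun s => darbouxSin p q x s)
      (darbouxCos p q x t * (8 * l ^ 2 * v + 4 * v ^ 3 + 2 * v₂ - 4 * l * v₁ * darbouxCos p q x t +
        (8 * l ^ 3 + 4 * l * v ^ 2) * darbouxSin p q x t)) t := by
  refine (((h.pt.const_mul 2).mul h.qt).fun_div ((h.pt.fun_pow 2).add (h.qt.fun_pow 2))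
    h0).congr_deriv ?_
  simp only [darbouxSin, darbouxCos, Pi.add_apply, Pi.mul_apply]
  generalize hX : p x t ^ 2 + q x t ^ 2 = X at *
  field_simp
  rw [← hX]
  push_cast
  ring

theorem hasDerivAt_darbouxCos_t {v v₁ v₂ : ℂ} (h : LaxAt l v v₁ v₂ p q x t)
    (h0 : p x t ^ 2 + q x t ^ 2 ≠ 0) :
    HasDerivAt (fun s => darbouxCos p q x s)
      (-darbouxSin p q x t * (8 * l ^ 2 * v + 4 * v ^ 3 + 2 * v₂ -
        4 * l * v₁ * darbouxCos p q x t + (8 * l ^ 3 + 4 * l * v ^ 2) * darbouxSin p q x t)) t := by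
  refine (((h.pt.fun_pow 2).sub (h.qt.fun_pow 2)).fun_div ((h.pt.fun_pow 2).add (h.qt.fun_pow 2))
    h0).congr_deriv ?_
  simp only [darbouxSin, darbouxCos, Pi.add_apply, Pi.sub_apply]
  generalize hX : p x t ^ 2 + q x t ^ 2 = X at *
  field_simp
  rw [← hX]
  push_cast
  ring

/-- The functions `darbouxSin` and `darbouxCos` satisfy a closed first-order system in x and t, so
each jet of the new potential is a polynomial in them and the old jet. Only the evolution equation
needs the relation s² + g² = 1. -/
theorem JetAt.darboux (hu : JetAt u u₁ u₂ u₃ x t)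
    (h : LaxAt l (u x t) (u₁ x t) (u₂ x t) p q x t) (h0 : p x t ^ 2 + q x t ^ 2 ≠ 0) :
    JetAt (darbouxU l u p q) (darbouxU₁ l u u₁ p q) (darbouxU₂ l u u₁ u₂ p q)
      (darbouxU₃ l u u₁ u₂ u₃ p q) x t := by
  have hs := hasDerivAt_darbouxSin_x h h0
  have hg := hasDerivAt_darbouxCos_x h h0
  have hst := hasDerivAt_darbouxSin_t h h0
  have hsg := darboux_sq h0
  have hm := hu.dx.add (hs.const_mul l)
  have hm1 := hu.dx₁.sub ((hg.const_mul (2 * l)).mul hm)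
  constructor
  · refine (hu.dx.add (hs.const_mul (2 * l))).congr_deriv ?_
    rw [darbouxU₁]; ring
  · refine (hu.dx₁.sub ((hg.const_mul (4 * l)).mul hm)).congr_deriv ?_
    simp only [darbouxU₂, Pi.add_apply]; ring
  · refine ((hu.dx₂.sub ((hs.const_mul (8 * l)).mul (hm.pow 2))).sub
      ((hg.const_mul (4 * l)).mul hm1)).congr_deriv ?_
    simp only [darbouxU₃, Pi.add_apply, Pi.sub_apply, Pi.mul_apply, Pi.pow_apply]
    push_cast
    ring
  · refine (hu.dt.add (hst.const_mul (2 * l))).congr_deriv ?_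
    simp only [darbouxU, darbouxU₁, darbouxU₃]
    generalize darbouxSin p q x t = s at *
    generalize darbouxCos p q x t = g at *
    linear_combination (-16 * l ^ 3 * g * (u x t + l * s)) * hsg

/-- The gauge matrix is l' - lR with R = (g, s; s, -g) and R² = 1. Carrying along a solution at
another parameter is what permits iteration. -/
theorem LaxAt.darboux (h : LaxAt l (u x t) (u₁ x t) (u₂ x t) p q x t)
    (h' : LaxAt l' (u x t) (u₁ x t) (u₂ x t) P Q x t) (h0 : p x t ^ 2 + q x t ^ 2 ≠ 0) :
    LaxAt l' (darbouxU l u p q x t) (darbouxU₁ l u u₁ p q x t) (darbouxU₂ l u u₁ u₂ p q x t)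
      (darbouxFst l l' p q P Q) (darbouxSnd l l' p q P Q) x t := by
  have hs := hasDerivAt_darbouxSin_x h h0
  have hg := hasDerivAt_darbouxCos_x h h0
  have hst := hasDerivAt_darbouxSin_t h h0
  have hgt := hasDerivAt_darbouxCos_t h h0
  have hsg := darboux_sq h0
  refine ⟨((h'.px.const_mul l').sub (((hg.mul h'.px).add (hs.mul h'.qx)).const_mul l)).congr_deriv
      ?_, ((h'.qx.const_mul l').sub (((hs.mul h'.px).sub (hg.mul h'.qx)).const_mul l)).congr_deriv
      ?_, ((h'.pt.const_mul l').sub (((hgt.mul h'.pt).add (hst.mul h'.qt)).const_mul l)).congr_deriv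
      ?_, ((h'.qt.const_mul l').sub (((hst.mul h'.pt).sub (hgt.mul h'.qt)).const_mul l)).congr_deriv
      ?_⟩ <;>
  simp only [darbouxU, darbouxU₁, darbouxU₂, darbouxFst, darbouxSnd] <;>
  generalize darbouxSin p q x t = s at * <;>
  generalize darbouxCos p q x t = g at * <;>
  generalize u x t = v at * <;>
  generalize u₁ x t = v1 at * <;>
  generalize u₂ x t = v2 at * <;>
  generalize P x t = A at * <;>
  generalize Q x t = B at * <;> clear hs hg hst hgt h h' h0
  · ring
  · ring
  · grind
  · grind

end

/-! ### Smooth solutions of the mKdV equation -/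

/-- Partial derivative with respect to `x`. -/
def dX {E : Type*} [NormedAddCommGroup E] [NormedSpace ℝ E] (f : ℝ → ℝ → E) (x t : ℝ) : E :=
  deriv (fun y => f y t) x

/-- Partial derivative with respect to `t`. -/
def dT {E : Type*} [NormedAddCommGroup E] [NormedSpace ℝ E] (f : ℝ → ℝ → E) (x t : ℝ) : E :=
  deriv (fun s => f x s) t

section

variable {E : Type*} [NormedAddCommGroup E] [NormedSpace ℝ E] {f : ℝ → ℝ → E}

theorem hasDerivAt_fderiv_x (hf : ContDiff ℝ ∞ (Function.uncurry f)) (x t : ℝ) :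
    HasDerivAt (fun y => f y t) (fderiv ℝ (Function.uncurry f) (x, t) (1, 0)) x := by
  have h := (hf.differentiable (by simp) (x, t)).hasFDerivAt
  have h1 : HasDerivAt (fun y : ℝ => (y, t)) ((1, 0) : ℝ × ℝ) x :=
    (hasDerivAt_id x).prodMk (hasDerivAt_const x t)
  exact h.comp_hasDerivAt x h1

theorem hasDerivAt_fderiv_t (hf : ContDiff ℝ ∞ (Function.uncurry f)) (x t : ℝ) :
    HasDerivAt (fun s => f x s) (fderiv ℝ (Function.uncurry f) (x, t) (0, 1)) t := by
  have h := (hf.differentiable (by simp) (x, t)).hasFDerivAt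
  have h1 : HasDerivAt (fun s : ℝ => (x, s)) ((0, 1) : ℝ × ℝ) t :=
    (hasDerivAt_const t x).prodMk (hasDerivAt_id t)
  exact h.comp_hasDerivAt t h1

theorem hasDerivAt_dX (hf : ContDiff ℝ ∞ (Function.uncurry f)) (x t : ℝ) :
    HasDerivAt (fun y => f y t) (dX f x t) x :=
  (hasDerivAt_fderiv_x hf x t).differentiableAt.hasDerivAt

theorem hasDerivAt_dT (hf : ContDiff ℝ ∞ (Function.uncurry f)) (x t : ℝ) :
    HasDerivAt (fun s => f x s) (dT f x t) t :=
  (hasDerivAt_fderiv_t hf x t).differentiableAt.hasDerivAt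

theorem contDiff_dX (hf : ContDiff ℝ ∞ (Function.uncurry f)) :
    ContDiff ℝ ∞ (Function.uncurry (dX f)) := by
  have h : Function.uncurry (dX f) = fun z => fderiv ℝ (Function.uncurry f) z (1, 0) :=
    funext fun z => (hasDerivAt_fderiv_x hf z.1 z.2).deriv
  rw [h]
  exact (hf.fderiv_right (m := ∞) (by simp)).clm_apply contDiff_const

theorem contDiff_dT (hf : ContDiff ℝ ∞ (Function.uncurry f)) :
    ContDiff ℝ ∞ (Function.uncurry (dT f)) := by
  have h : Function.uncurry (dT f) = fun z => fderiv ℝ (Function.uncurry f) z (0, 1) :=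
    funext fun z => (hasDerivAt_fderiv_t hf z.1 z.2).deriv
  rw [h]
  exact (hf.fderiv_right (m := ∞) (by simp)).clm_apply contDiff_const

end

/-- Smooth solutions of the mKdV equation. -/
structure SmoothSol (u : ℝ → ℝ → ℝ) : Prop where
  contDiff : ContDiff ℝ ∞ (Function.uncurry u)
  eq : ∀ x t, dT u x t + 6 * u x t ^ 2 * dX u x t + dX (dX (dX u)) x t = 0

theorem SmoothSol.isSolution {u : ℝ → ℝ → ℝ} (hu : SmoothSol u) : IsSolution u :=
  have h := hu.contDiff
  ⟨dX u, dX (dX u), dX (dX (dX u)), dT u, h.continuous, (contDiff_dX h).continuous,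
    (contDiff_dX (contDiff_dX h)).continuous, (contDiff_dX (contDiff_dX (contDiff_dX h))).continuous,
    (contDiff_dT h).continuous, fun x t => ⟨hasDerivAt_dX h x t,
      hasDerivAt_dX (contDiff_dX h) x t, hasDerivAt_dX (contDiff_dX (contDiff_dX h)) x t,
      hasDerivAt_dT h x t, hu.eq x t⟩⟩

theorem SmoothSol.jetAt {u : ℝ → ℝ → ℝ} (hu : SmoothSol u) (x t : ℝ) :
    JetAt (fun x t => u x t) (fun x t => (dX u x t : ℝ)) (fun x t => (dX (dX u) x t : ℝ))
      (fun x t => (dX (dX (dX u)) x t : ℝ)) x t := by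
  have h := hu.contDiff
  refine ⟨(hasDerivAt_dX h x t).ofReal_comp, (hasDerivAt_dX (contDiff_dX h) x t).ofReal_comp,
    (hasDerivAt_dX (contDiff_dX (contDiff_dX h)) x t).ofReal_comp,
    (hasDerivAt_dT h x t).ofReal_comp.congr_deriv ?_⟩
  have := congrArg (fun r : ℝ => (r : ℂ)) (hu.eq x t)
  push_cast at this
  linear_combination this

/-- The complex field may be singular off S, while v is smooth everywhere. The equation holds on S,
and each point is a limit of points of S on its own horizontal line, so continuity extends the
equation. -/
theorem smoothSol_of_jetAt {v : ℝ → ℝ → ℝ} (hv : ContDiff ℝ ∞ (Function.uncurry v))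
    {V V₁ V₂ V₃ : ℝ → ℝ → ℂ} {S : Set (ℝ × ℝ)} (hS : IsOpen S)
    (hd : ∀ x t, ∃ᶠ y in 𝓝 x, (y, t) ∈ S) (hV : ∀ x t, (x, t) ∈ S → (v x t : ℂ) = V x t)
    (hJ : ∀ x t, (x, t) ∈ S → JetAt V V₁ V₂ V₃ x t) :
    SmoothSol v ∧ ∀ x t, (x, t) ∈ S →
      ((dX v x t : ℝ) : ℂ) = V₁ x t ∧ ((dX (dX v) x t : ℝ) : ℂ) = V₂ x t := by
  have hx : ∀ x t, (x, t) ∈ S → ∀ᶠ y in 𝓝 x, (y, t) ∈ S := fun x t h =>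
    (Continuous.prodMk_left t).continuousAt.eventually (hS.mem_nhds h)
  have ht : ∀ x t, (x, t) ∈ S → ∀ᶠ s in 𝓝 t, (x, s) ∈ S := fun x t h =>
    (Continuous.prodMk_right x).continuousAt.eventually (hS.mem_nhds h)
  have step : ∀ {w : ℝ → ℝ → ℝ} {W W' : ℝ → ℝ → ℂ}, ContDiff ℝ ∞ (Function.uncurry w) →
      (∀ x t, (x, t) ∈ S → (w x t : ℂ) = W x t) →
      (∀ x t, (x, t) ∈ S → HasDerivAt (fun y => W y t) (W' x t) x) →
      ∀ x t, (x, t) ∈ S → ((dX w x t : ℝ) : ℂ) = W' x t := by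
    intro w W W' hw hW hW' x t hxt
    have h1 := (hasDerivAt_dX hw x t).ofReal_comp
    have h2 : (fun y => (w y t : ℂ)) =ᶠ[𝓝 x] fun y => W y t := by
      filter_upwards [hx x t hxt] with y hy using hW y t hy
    exact h1.unique ((hW' x t hxt).congr_of_eventuallyEq h2)
  have h1 := step hv hV fun x t h => (hJ x t h).dx
  have h2 := step (contDiff_dX hv) h1 fun x t h => (hJ x t h).dx₁
  have h3 := step (contDiff_dX (contDiff_dX hv)) h2 fun x t h => (hJ x t h).dx₂
  refine ⟨⟨hv, fun x t => ?_⟩, fun x t h => ⟨h1 x t h, h2 x t h⟩⟩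
  have hgood : ∀ y, (y, t) ∈ S →
      dT v y t + 6 * v y t ^ 2 * dX v y t + dX (dX (dX v)) y t = 0 := by
    intro y hy
    have h4 : ((dT v y t : ℝ) : ℂ) = -(6 * V y t ^ 2 * V₁ y t) - V₃ y t := by
      have h5 : (fun s => (v y s : ℂ)) =ᶠ[𝓝 t] fun s => V y s := by
        filter_upwards [ht y t hy] with s hs using hV y s hs
      exact (hasDerivAt_dT hv y t).ofReal_comp.unique ((hJ y t hy).dt.congr_of_eventuallyEq h5)
    rw [← hV y t hy, ← h1 y t hy, ← h3 y t hy] at h4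
    have h5 : dT v y t = -(6 * v y t ^ 2 * dX v y t) - dX (dX (dX v)) y t := by exact_mod_cast h4
    rw [h5]; ring
  have hcont : Continuous fun y =>
      dT v y t + 6 * v y t ^ 2 * dX v y t + dX (dX (dX v)) y t := by
    have e0 : Continuous fun y => v y t := hv.continuous.comp (Continuous.prodMk_left t)
    have e1 : Continuous fun y => dT v y t :=
      (contDiff_dT hv).continuous.comp (Continuous.prodMk_left t)
    have e2 : Continuous fun y => dX v y t :=
      (contDiff_dX hv).continuous.comp (Continuous.prodMk_left t)
    have e3 : Continuous fun y => dX (dX (dX v)) y t :=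
      (contDiff_dX (contDiff_dX (contDiff_dX hv))).continuous.comp (Continuous.prodMk_left t)
    fun_prop
  exact (isClosed_singleton (x := (0 : ℝ))).mem_of_frequently_of_tendsto
    ((hd x t).mono fun y hy => hgood y hy) hcont.continuousAt

/-! ### The one-fold transformation of a real solution -/

/-- The Lax system over a real potential. -/
def LaxOver (l : ℂ) (u : ℝ → ℝ → ℝ) (p q : ℝ → ℝ → ℂ) : Prop :=
  ∀ x t, LaxAt l (u x t) (dX u x t : ℝ) (dX (dX u) x t : ℝ) p q x t

/-- The one-fold transformation with real data. -/
def realOneFold (l : ℝ) (u p q : ℝ → ℝ → ℝ) (x t : ℝ) : ℝ :=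
  u x t + 4 * l * p x t * q x t / (p x t ^ 2 + q x t ^ 2)

section

variable {l : ℝ} {u p q : ℝ → ℝ → ℝ}

theorem ofReal_realOneFold (x t : ℝ) : (realOneFold l u p q x t : ℂ) =
    darbouxU l (fun x t => u x t) (fun x t => p x t) (fun x t => q x t) x t := by
  simp only [realOneFold, darbouxU, darbouxSin]; push_cast; ring

theorem contDiff_realOneFold (hu : ContDiff ℝ ∞ (Function.uncurry u))
    (hp : ContDiff ℝ ∞ (Function.uncurry p)) (hq : ContDiff ℝ ∞ (Function.uncurry q))
    (h0 : ∀ x t, p x t ^ 2 + q x t ^ 2 ≠ 0) :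
    ContDiff ℝ ∞ (Function.uncurry (realOneFold l u p q)) :=
  hu.add ((((contDiff_const (c := 4 * l)).mul hp).mul hq).div ((hp.pow 2).add (hq.pow 2))
    fun z => h0 z.1 z.2)

theorem SmoothSol.oneFold (hu : SmoothSol u) (hp : ContDiff ℝ ∞ (Function.uncurry p))
    (hq : ContDiff ℝ ∞ (Function.uncurry q)) (h0 : ∀ x t, p x t ^ 2 + q x t ^ 2 ≠ 0)
    (hL : LaxOver l u (fun x t => p x t) fun x t => q x t) :
    SmoothSol (realOneFold l u p q) ∧ ∀ {l' : ℂ} {P Q : ℝ → ℝ → ℂ}, LaxOver l' u P Q →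
      LaxOver l' (realOneFold l u p q)
        (darbouxFst l l' (fun x t => p x t) (fun x t => q x t) P Q)
        (darbouxSnd l l' (fun x t => p x t) (fun x t => q x t) P Q) := by
  have h0' : ∀ x t, (p x t : ℂ) ^ 2 + (q x t : ℂ) ^ 2 ≠ 0 := fun x t => by exact_mod_cast h0 x t
  obtain ⟨h1, h2⟩ := smoothSol_of_jetAt (contDiff_realOneFold (l := l) hu.contDiff hp hq h0)
    isOpen_univ (fun x t => Eventually.frequently (by simp)) (fun x t _ => ofReal_realOneFold x t)
    fun x t _ => (hu.jetAt x t).darboux (hL x t) (h0' x t)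
  refine ⟨h1, fun {l' P Q} h x t => ?_⟩
  rw [(h2 x t trivial).1, (h2 x t trivial).2, ofReal_realOneFold]
  exact (hL x t).darboux (h x t) (h0' x t)

end

/-! ### The two-fold transformation of a real solution -/

/-- The denominator of the real form of the two-fold transformation. -/
def realTwoFoldDen (l p q : ℂ) : ℝ :=
  l.im ^ 2 * (Complex.normSq p + Complex.normSq q) ^ 2 + 4 * l.re ^ 2 * (p * conj q).im ^ 2

/-- The numerator of the real form of the two-fold transformation. -/
def realTwoFoldNum (l p q : ℂ) : ℝ := 8 * l.re * l.im * (l * p * q * conj (p ^ 2 + q ^ 2)).im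

/-- The increment of the two-fold transformation in real form. -/
def realTwoFold (l p q : ℂ) : ℝ := realTwoFoldNum l p q / realTwoFoldDen l p q

/-- The components of the complex conjugate of a vector. -/
def starVec (v : Fin 2 → ℂ) : Fin 2 → ℂ := fun i => conj (v i)

theorem twoFoldDen_eq (l : ℂ) (v : Fin 2 → ℂ) :
    twoFoldDen l (conj l) v (starVec v) = ((-4 * realTwoFoldDen l (v 0) (v 1) : ℝ) : ℂ) := by
  simp only [twoFoldDen, starVec, realTwoFoldDen]
  generalize v 0 = p
  generalize v 1 = q
  apply Complex.ext
  · simp [Complex.normSq_apply, pow_two]; ring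
  · simp [Complex.normSq_apply, pow_two]; ring

theorem realTwoFoldDen_pos {l p q : ℂ} (hl : l.im ≠ 0) (h : p ≠ 0 ∨ q ≠ 0) :
    0 < realTwoFoldDen l p q := by
  have hN : 0 < Complex.normSq p + Complex.normSq q := by
    rcases h with h | h
    · have := Complex.normSq_pos.2 h; have := Complex.normSq_nonneg q; positivity
    · have := Complex.normSq_pos.2 h; have := Complex.normSq_nonneg p; positivity
  have : 0 < l.im ^ 2 := by positivity
  rw [realTwoFoldDen]; positivity

theorem twoFoldDen_ne_zero {l : ℂ} (hl : l.im ≠ 0) {v : Fin 2 → ℂ} (h : v 0 ≠ 0 ∨ v 1 ≠ 0) :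
    twoFoldDen l (conj l) v (starVec v) ≠ 0 := by
  rw [twoFoldDen_eq, Complex.ofReal_ne_zero]
  exact mul_ne_zero (by norm_num) (realTwoFoldDen_pos hl h).ne'

theorem twoFold_eq (l u : ℂ) (v : Fin 2 → ℂ) :
    twoFold l (conj l) u v (starVec v) = u + (realTwoFold l (v 0) (v 1) : ℝ) := by
  have hnum : 4 * (l ^ 2 - conj l ^ 2) * (l * v 0 * v 1 * (starVec v 0 ^ 2 + starVec v 1 ^ 2) -
      conj l * starVec v 0 * starVec v 1 * (v 0 ^ 2 + v 1 ^ 2)) =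
      ((-4 * realTwoFoldNum l (v 0) (v 1) : ℝ) : ℂ) := by
    simp only [starVec, realTwoFoldNum]
    generalize v 0 = p
    generalize v 1 = q
    apply Complex.ext
    · simp [pow_two]; ring
    · simp [pow_two]; right; ring
  rw [twoFold, hnum, twoFoldDen_eq, realTwoFold, ← Complex.ofReal_div,
    mul_div_mul_left _ _ (by norm_num)]

theorem contDiff_realTwoFold {l : ℂ} (hl : l.im ≠ 0) {p q : ℝ → ℝ → ℂ}
    (hp : ContDiff ℝ ∞ (Function.uncurry p)) (hq : ContDiff ℝ ∞ (Function.uncurry q))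
    (h0 : ∀ x t, p x t ≠ 0 ∨ q x t ≠ 0) :
    ContDiff ℝ ∞ (Function.uncurry fun x t => realTwoFold l (p x t) (q x t)) := by
  have hcj : ∀ {f : ℝ × ℝ → ℂ}, ContDiff ℝ ∞ f → ContDiff ℝ ∞ fun z => conj (f z) :=
    fun hf => Complex.conjCLE.contDiff.comp hf
  have him : ∀ {f : ℝ × ℝ → ℂ}, ContDiff ℝ ∞ f → ContDiff ℝ ∞ fun z => (f z).im :=
    fun hf => Complex.imCLM.contDiff.comp hf
  have hre : ∀ {f : ℝ × ℝ → ℂ}, ContDiff ℝ ∞ f → ContDiff ℝ ∞ fun z => (f z).re :=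
    fun hf => Complex.reCLM.contDiff.comp hf
  have hns : ∀ {f : ℝ × ℝ → ℂ}, ContDiff ℝ ∞ f → ContDiff ℝ ∞ fun z => Complex.normSq (f z) :=
    fun hf => by
      simp only [Complex.normSq_apply]
      exact ((hre hf).mul (hre hf)).add ((him hf).mul (him hf))
  refine ContDiff.div (𝕜 := ℝ) ?_ ?_ fun z => (realTwoFoldDen_pos hl (h0 z.1 z.2)).ne'
  · exact contDiff_const.mul (him (((contDiff_const.mul hp).mul hq).mul
      (hcj ((hp.pow 2).add (hq.pow 2)))))
  · exact (contDiff_const.mul (((hns hp).add (hns hq)).pow 2)).add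
      (contDiff_const.mul ((him (hp.mul (hcj hq))).pow 2))

/-- After the first step the transformed second vector has sum of squares equal to the two-fold
denominator over p₁² + q₁². The second step is therefore regular wherever the two-fold formula and
the first step are. -/
theorem twoFold_eq_iterate {l₁ l₂ u : ℂ} {v₁ v₂ : Fin 2 → ℂ} (s g P Q : ℂ)
    (h1 : v₁ 0 ^ 2 + v₁ 1 ^ 2 ≠ 0) (hd : twoFoldDen l₁ l₂ v₁ v₂ ≠ 0)
    (hs : s = 2 * v₁ 0 * v₁ 1 / (v₁ 0 ^ 2 + v₁ 1 ^ 2))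
    (hg : g = (v₁ 0 ^ 2 - v₁ 1 ^ 2) / (v₁ 0 ^ 2 + v₁ 1 ^ 2))
    (hP : P = l₂ * v₂ 0 - l₁ * (g * v₂ 0 + s * v₂ 1))
    (hQ : Q = l₂ * v₂ 1 - l₁ * (s * v₂ 0 - g * v₂ 1)) :
    P ^ 2 + Q ^ 2 ≠ 0 ∧
      twoFold l₁ l₂ u v₁ v₂ = u + 2 * l₁ * s + 2 * l₂ * (2 * P * Q / (P ^ 2 + Q ^ 2)) := by
  have h2 : P ^ 2 + Q ^ 2 = twoFoldDen l₁ l₂ v₁ v₂ / (v₁ 0 ^ 2 + v₁ 1 ^ 2) := by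
    rw [hP, hQ, hs, hg, twoFoldDen]
    generalize hX : v₁ 0 ^ 2 + v₁ 1 ^ 2 = X at *
    field_simp
    rw [← hX]
    ring
  refine ⟨by rw [h2]; exact div_ne_zero hd h1, ?_⟩
  have h3 : 2 * l₁ * s + 2 * l₂ * (2 * P * Q / (P ^ 2 + Q ^ 2)) =
      (2 * l₁ * s * (twoFoldDen l₁ l₂ v₁ v₂ / (v₁ 0 ^ 2 + v₁ 1 ^ 2)) + 4 * l₂ * P * Q) /
        (twoFoldDen l₁ l₂ v₁ v₂ / (v₁ 0 ^ 2 + v₁ 1 ^ 2)) := by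
    rw [h2]
    have := div_ne_zero hd h1
    field_simp
    ring
  rw [twoFold, add_assoc, h3]
  congr 1
  rw [div_eq_div_iff hd (div_ne_zero hd h1), mul_comm _ (twoFoldDen l₁ l₂ v₁ v₂), mul_div_assoc',
    mul_comm _ (twoFoldDen l₁ l₂ v₁ v₂), mul_div_assoc]
  congr 1
  rw [hP, hQ, hs, hg, twoFoldDen]
  generalize hX : v₁ 0 ^ 2 + v₁ 1 ^ 2 = X at *
  field_simp
  rw [← hX]
  ring

/-- At a zero of p² + q² its x-derivative is 4λp², which is nonzero since (p, q) does not vanish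
there; so the zeros are isolated in x. -/
theorem LaxOver.frequently_ne {l : ℂ} (hl : l ≠ 0) {u : ℝ → ℝ → ℝ} {p q : ℝ → ℝ → ℂ}
    (hL : LaxOver l u p q) (h0 : ∀ x t, p x t ≠ 0 ∨ q x t ≠ 0) (x t : ℝ) :
    ∃ᶠ y in 𝓝 x, p y t ^ 2 + q y t ^ 2 ≠ 0 := by
  by_cases h : p x t ^ 2 + q x t ^ 2 = 0
  · have hd : HasDerivAt (fun y => p y t ^ 2 + q y t ^ 2) (4 * l * p x t ^ 2) x := by
      refine (((hL x t).px.fun_pow 2).add ((hL x t).qx.fun_pow 2)).congr_deriv ?_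
      push_cast
      linear_combination (-2 * l) * h
    have hp : p x t ≠ 0 := fun hp => by
      rw [hp] at h
      have hq : q x t = 0 := by simpa using h
      exact (h0 x t).elim (fun h => h hp) fun h => h hq
    have := hd.eventually_ne (c := 0) (mul_ne_zero (mul_ne_zero (by norm_num : (4 : ℂ) ≠ 0) hl) (pow_ne_zero 2 hp))
    exact this.frequently.filter_mono nhdsWithin_le_nhds
  · have hc : ContinuousAt (fun y => p y t ^ 2 + q y t ^ 2) x :=
      ((hL x t).px.continuousAt.pow 2).add ((hL x t).qx.continuousAt.pow 2)
    exact (hc.eventually_ne h).frequently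

/-- The two steps use λ and its conjugate. The first is complex and undefined where p² + q² = 0, but
the real closed form stays smooth there, so verification off this set is enough. -/
theorem SmoothSol.twoFold {l : ℂ} (hl : l.im ≠ 0) {u : ℝ → ℝ → ℝ} {p q : ℝ → ℝ → ℂ}
    (hu : SmoothSol u) (hp : ContDiff ℝ ∞ (Function.uncurry p))
    (hq : ContDiff ℝ ∞ (Function.uncurry q)) (h0 : ∀ x t, p x t ≠ 0 ∨ q x t ≠ 0)
    (hL : LaxOver l u p q) :
    SmoothSol fun x t => u x t + realTwoFold l (p x t) (q x t) := by
  set p' : ℝ → ℝ → ℂ := fun x t => conj (p x t)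
  set q' : ℝ → ℝ → ℂ := fun x t => conj (q x t)
  have hL' : LaxOver (conj l) u p' q' := fun x t => by
    have := (hL x t).conj
    simp only [Complex.conj_ofReal] at this
    exact this
  set uC : ℝ → ℝ → ℂ := fun x t => u x t
  set v₁ : ℝ → ℝ → ℂ := fun x t => (dX u x t : ℝ)
  set v₂ : ℝ → ℝ → ℂ := fun x t => (dX (dX u) x t : ℝ)
  set v₃ : ℝ → ℝ → ℂ := fun x t => (dX (dX (dX u)) x t : ℝ)
  set P := darbouxFst l (conj l) p q p' q'
  set Q := darbouxSnd l (conj l) p q p' q'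
  have key : ∀ x t, p x t ^ 2 + q x t ^ 2 ≠ 0 → P x t ^ 2 + Q x t ^ 2 ≠ 0 ∧
      ((u x t + realTwoFold l (p x t) (q x t) : ℝ) : ℂ) =
        darbouxU (conj l) (darbouxU l uC p q) P Q x t := fun x t h => by
    have h1 := twoFold_eq_iterate (u := u x t) (v₁ := ![p x t, q x t])
      (v₂ := starVec ![p x t, q x t]) (darbouxSin p q x t) (darbouxCos p q x t) (P x t) (Q x t)
      h (twoFoldDen_ne_zero hl (h0 x t)) rfl rfl rfl rfl
    refine ⟨h1.1, ?_⟩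
    rw [twoFold_eq] at h1
    rw [Complex.ofReal_add]
    exact h1.2
  have hS : IsOpen {z : ℝ × ℝ | p z.1 z.2 ^ 2 + q z.1 z.2 ^ 2 ≠ 0} :=
    isOpen_ne.preimage ((hp.continuous.pow 2).add (hq.continuous.pow 2))
  have hl0 : l ≠ 0 := fun h => hl (by rw [h]; rfl)
  have hJ := fun x t (h : p x t ^ 2 + q x t ^ 2 ≠ 0) =>
    ((hu.jetAt x t).darboux (hL x t) h).darboux ((hL x t).darboux (hL' x t) h) (key x t h).1
  exact (smoothSol_of_jetAt (v := fun x t => u x t + realTwoFold l (p x t) (q x t))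
    (hu.contDiff.add (contDiff_realTwoFold hl hp hq h0)) hS
    (hL.frequently_ne hl0 h0) (fun x t h => (key x t h).2) hJ).1

/-! ### Travelling waves as smooth solutions -/

section

variable {U U₁ : ℝ → ℝ} {c e d L : ℝ} {l k C : ℂ} {p q : ℝ → ℂ}

theorem Profile.dX_travelling (hU : Profile U U₁ c e d L) :
    dX (travelling U c) = travelling U₁ c :=
  funext₂ fun x t => (hasDerivAt_travelling_x (c := c) (t := t) (hU.hasDerivAt (x - c * t))).deriv

theorem Profile.dX_dX_travelling (hU : Profile U U₁ c e d L) :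
    dX (dX (travelling U c)) = travelling (fun y => e + c * U y - 2 * U y ^ 3) c := by
  rw [hU.dX_travelling]
  exact funext₂ fun x t =>
    (hasDerivAt_travelling_x (c := c) (t := t) (hU.hasDerivAt' (x - c * t))).deriv

theorem contDiff_travelling {E : Type*} [NormedAddCommGroup E] [NormedSpace ℝ E] {f : ℝ → E}
    (hf : ContDiff ℝ ∞ f) (c : ℝ) :
    ContDiff ℝ ∞ (Function.uncurry fun x t : ℝ => f (x - c * t)) :=
  hf.comp (contDiff_fst.sub (contDiff_const.mul contDiff_snd))

theorem Profile.smoothSol (hU : Profile U U₁ c e d L) : SmoothSol (travelling U c) where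
  contDiff := contDiff_travelling hU.contDiff c
  eq x t := by
    have h1 : HasDerivAt (fun y => e + c * U y - 2 * U y ^ 3)
        (c * U₁ (x - c * t) - 6 * U (x - c * t) ^ 2 * U₁ (x - c * t)) (x - c * t) := by
      have h := hU.hasDerivAt (x - c * t)
      exact (((h.const_mul c).const_add e).sub ((h.fun_pow 3).const_mul 2)).congr_deriv
        (by push_cast; ring)
    have h2 : dX (dX (dX (travelling U c))) x t =
        c * U₁ (x - c * t) - 6 * U (x - c * t) ^ 2 * U₁ (x - c * t) := by
      rw [hU.dX_dX_travelling]
      exact (hasDerivAt_travelling_x (c := c) (t := t) h1).deriv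
    have h3 : dT (travelling U c) x t = -c * U₁ (x - c * t) := by
      have := (hasDerivAt_travelling_t (c := c) (x := x) (hU.hasDerivAt (x - c * t))).deriv
      exact this
    rw [h2, h3, hU.dX_travelling]
    simp only [travelling]
    ring

theorem Profile.isPeriodicWave (hU : Profile U U₁ c e d L) : IsPeriodicWave U c L :=
  ⟨hU.pos, hU.periodic, hU.smoothSol.isSolution⟩

theorem Profile.neg (hU : Profile U U₁ c e d L) :
    Profile (fun y => -U y) (fun y => -U₁ y) c (-e) d L where
  pos := hU.pos
  hasDerivAt y := (hU.hasDerivAt y).neg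
  hasDerivAt' y := (hU.hasDerivAt' y).neg.congr_deriv (by ring)
  energy y := by linear_combination hU.energy y
  periodic y := by rw [hU.periodic]
  periodic' y := by rw [hU.periodic']

theorem Profile.laxOver_iff (hU : Profile U U₁ c e d L) {P Q : ℝ → ℝ → ℂ} :
    LaxOver l (travelling U c) P Q ↔ ∀ x t, LaxAt l (U (x - c * t)) (U₁ (x - c * t))
      (e + c * U (x - c * t) - 2 * U (x - c * t) ^ 3 : ℝ) P Q x t := by
  rw [LaxOver, hU.dX_dX_travelling, hU.dX_travelling]
  rfl

theorem EigenPair.laxOver (hU : Profile U U₁ c e d L) (h : EigenPair U U₁ c e l k p q) :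
    LaxOver l (travelling U c) (fun x t => p (x - c * t)) fun x t => q (x - c * t) :=
  hU.laxOver_iff.2 h.laxAt

theorem EigenPair.laxOver_second (hU : Profile U U₁ c e d L) (hl : BranchPoint U c e d l)
    (h : EigenPair U U₁ c e l k p q) :
    LaxOver l (travelling U c) (secondFst U c e l C p q) (secondSnd U c e l C p q) :=
  hU.laxOver_iff.2 (h.laxAt_second hU hl C)

theorem EigenPair.vec_ne_zero (hl : BranchPoint U c e d l) (h : EigenPair U U₁ c e l k p q)
    (y : ℝ) : p y ≠ 0 ∨ q y ≠ 0 := by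
  by_contra! hn
  have hs := h.sum y
  rw [hn.1, hn.2] at hs
  exact mul_ne_zero h.ne_zero (eigenDen_ne_zero hl y) (by rw [← hs]; ring)

theorem EigenPair.second_ne_zero (hl : BranchPoint U c e d l) (h : EigenPair U U₁ c e l k p q)
    (x t : ℝ) : secondFst U c e l C p q x t ≠ 0 ∨ secondSnd U c e l C p q x t ≠ 0 := by
  by_contra! hn
  have hs := h.wronskian_second (C := C) hl x t
  rw [hn.1, hn.2] at hs
  exact h.ne_zero (by linear_combination hs)

theorem contDiff_eigenDen (hU : Profile U U₁ c e d L) : ContDiff ℝ ∞ (eigenDen U e l) :=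
  contDiff_const.mul ((contDiff_const.mul (Complex.ofRealCLM.contDiff.comp hU.contDiff)).add
    contDiff_const)

theorem EigenPair.contDiff_second (hU : Profile U U₁ c e d L) (hl : BranchPoint U c e d l)
    (h : EigenPair U U₁ c e l k p q) :
    ContDiff ℝ ∞ (Function.uncurry (secondFst U c e l C p q)) ∧
      ContDiff ℝ ∞ (Function.uncurry (secondSnd U c e l C p q)) := by
  have hT : ContDiff ℝ ∞ (Function.uncurry (timePhase U c e l C)) :=
    ((Complex.ofRealCLM.contDiff.comp contDiff_snd).add
      (contDiff_travelling (contDiff_phase hU hl) c)).add contDiff_const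
  have hp := contDiff_travelling (h.contDiff hU).1 c
  have hq := contDiff_travelling (h.contDiff hU).2 c
  have hD := contDiff_travelling (contDiff_eigenDen (l := l) hU) c
  have hD' := hD.inv fun z => eigenDen_ne_zero hl _
  simp only [Function.uncurry_def, secondFst, secondSnd, div_eq_mul_inv]
  exact ⟨(hT.mul hp).add (hq.mul hD'), (hT.mul hq).sub (hp.mul hD')⟩

end

/-! ### The three-fold transformation as an iterated transformation -/

/-- The one-fold Darboux matrix of `w`, for the parameters `l'` and `l`, applied to `v`. -/
def darbouxVec (l' l : ℂ) (w v : Fin 2 → ℂ) : Fin 2 → ℂ :=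
  ![l * v 0 - l' * ((w 0 ^ 2 - w 1 ^ 2) / (w 0 ^ 2 + w 1 ^ 2) * v 0 +
      2 * w 0 * w 1 / (w 0 ^ 2 + w 1 ^ 2) * v 1),
    l * v 1 - l' * (2 * w 0 * w 1 / (w 0 ^ 2 + w 1 ^ 2) * v 0 -
      (w 0 ^ 2 - w 1 ^ 2) / (w 0 ^ 2 + w 1 ^ 2) * v 1)]

/-- In the quadratic monomials P, Q, n of each vector the expression is trilinear. A Darboux step
acts on these monomials directly (`darbouxVec_quadratic`), which keeps the later polynomial
identities small. -/
theorem threeFoldDen_eq (l₁ l₂ l₃ : ℂ) (v₁ v₂ v₃ : Fin 2 → ℂ) {P₁ P₂ P₃ Q₁ Q₂ Q₃ n₁ n₂ n₃ : ℂ}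
    (hP₁ : P₁ = v₁ 0 ^ 2 + v₁ 1 ^ 2) (hP₂ : P₂ = v₂ 0 ^ 2 + v₂ 1 ^ 2)
    (hP₃ : P₃ = v₃ 0 ^ 2 + v₃ 1 ^ 2) (hQ₁ : Q₁ = v₁ 0 ^ 2 - v₁ 1 ^ 2)
    (hQ₂ : Q₂ = v₂ 0 ^ 2 - v₂ 1 ^ 2) (hQ₃ : Q₃ = v₃ 0 ^ 2 - v₃ 1 ^ 2)
    (hn₁ : n₁ = v₁ 0 * v₁ 1) (hn₂ : n₂ = v₂ 0 * v₂ 1) (hn₃ : n₃ = v₃ 0 * v₃ 1) :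
    threeFoldDen l₁ l₂ l₃ v₁ v₂ v₃ =
      ((l₁ ^ 2 + l₂ ^ 2) * (l₁ ^ 2 + l₃ ^ 2) * (l₂ ^ 2 + l₃ ^ 2) - 8 * l₁ ^ 2 * l₂ ^ 2 * l₃ ^ 2) *
        (P₁ * P₂ * P₃) -
      2 * (l₁ ^ 2 - l₂ ^ 2) * (l₁ ^ 2 - l₃ ^ 2) * l₂ * l₃ * P₁ * (Q₂ * Q₃ + 4 * n₂ * n₃) -
      2 * (l₂ ^ 2 - l₁ ^ 2) * (l₂ ^ 2 - l₃ ^ 2) * l₁ * l₃ * P₂ * (Q₁ * Q₃ + 4 * n₁ * n₃) -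
      2 * (l₃ ^ 2 - l₁ ^ 2) * (l₃ ^ 2 - l₂ ^ 2) * l₁ * l₂ * P₃ * (Q₁ * Q₂ + 4 * n₁ * n₂) := by
  have h1 : v₁ 0 ^ 2 = (P₁ + Q₁) / 2 := by rw [hP₁, hQ₁]; ring
  have h2 : v₂ 0 ^ 2 = (P₂ + Q₂) / 2 := by rw [hP₂, hQ₂]; ring
  have h3 : v₃ 0 ^ 2 = (P₃ + Q₃) / 2 := by rw [hP₃, hQ₃]; ring
  have g1 : v₁ 1 ^ 2 = (P₁ - Q₁) / 2 := by rw [hP₁, hQ₁]; ring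
  have g2 : v₂ 1 ^ 2 = (P₂ - Q₂) / 2 := by rw [hP₂, hQ₂]; ring
  have g3 : v₃ 1 ^ 2 = (P₃ - Q₃) / 2 := by rw [hP₃, hQ₃]; ring
  rw [threeFoldDen, h1, h2, h3, g1, g2, g3, hn₁, hn₂, hn₃]
  ring

theorem threeFoldNum_eq (l₁ l₂ l₃ : ℂ) (v₁ v₂ v₃ : Fin 2 → ℂ) {P₁ P₂ P₃ Q₁ Q₂ Q₃ n₁ n₂ n₃ : ℂ}
    (hP₁ : P₁ = v₁ 0 ^ 2 + v₁ 1 ^ 2) (hP₂ : P₂ = v₂ 0 ^ 2 + v₂ 1 ^ 2)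
    (hP₃ : P₃ = v₃ 0 ^ 2 + v₃ 1 ^ 2) (hQ₁ : Q₁ = v₁ 0 ^ 2 - v₁ 1 ^ 2)
    (hQ₂ : Q₂ = v₂ 0 ^ 2 - v₂ 1 ^ 2) (hQ₃ : Q₃ = v₃ 0 ^ 2 - v₃ 1 ^ 2)
    (hn₁ : n₁ = v₁ 0 * v₁ 1) (hn₂ : n₂ = v₂ 0 * v₂ 1) (hn₃ : n₃ = v₃ 0 * v₃ 1) :
    threeFoldNum l₁ l₂ l₃ v₁ v₂ v₃ =
      (l₃ ^ 2 - l₁ ^ 2) * (l₃ ^ 2 - l₂ ^ 2) * l₃ * n₃ *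
        ((l₁ ^ 2 + l₂ ^ 2) * (P₁ * P₂) - 2 * l₁ * l₂ * (Q₁ * Q₂)) +
      (l₂ ^ 2 - l₁ ^ 2) * (l₂ ^ 2 - l₃ ^ 2) * l₂ * n₂ *
        ((l₁ ^ 2 + l₃ ^ 2) * (P₁ * P₃) - 2 * l₁ * l₃ * (Q₁ * Q₃)) +
      (l₁ ^ 2 - l₂ ^ 2) * (l₁ ^ 2 - l₃ ^ 2) * l₁ * n₁ *
        ((l₂ ^ 2 + l₃ ^ 2) * (P₂ * P₃) - 2 * l₂ * l₃ * (Q₂ * Q₃)) -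
      8 * (l₁ ^ 4 + l₂ ^ 4 + l₃ ^ 4 - l₁ ^ 2 * l₂ ^ 2 - l₁ ^ 2 * l₃ ^ 2 - l₂ ^ 2 * l₃ ^ 2) *
        (l₁ * l₂ * l₃) * (n₁ * n₂ * n₃) := by
  rw [threeFoldNum, hP₁, hP₂, hP₃, hQ₁, hQ₂, hQ₃, hn₁, hn₂, hn₃]
  ring

theorem darbouxVec_quadratic {l' l : ℂ} {w v : Fin 2 → ℂ} {s g P Q n : ℂ}
    (hw : w 0 ^ 2 + w 1 ^ 2 ≠ 0)
    (hs : s = 2 * w 0 * w 1 / (w 0 ^ 2 + w 1 ^ 2))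
    (hg : g = (w 0 ^ 2 - w 1 ^ 2) / (w 0 ^ 2 + w 1 ^ 2))
    (hP : P = v 0 ^ 2 + v 1 ^ 2) (hQ : Q = v 0 ^ 2 - v 1 ^ 2) (hn : n = v 0 * v 1) :
    darbouxVec l' l w v 0 ^ 2 + darbouxVec l' l w v 1 ^ 2 =
      (l ^ 2 + l' ^ 2) * P - 2 * l * l' * (g * Q + 2 * s * n) ∧
    darbouxVec l' l w v 0 ^ 2 - darbouxVec l' l w v 1 ^ 2 =
      (l ^ 2 - l' ^ 2) * Q - 2 * l * l' * g * P + 2 * l' ^ 2 * g * (g * Q + 2 * s * n) ∧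
    darbouxVec l' l w v 0 * darbouxVec l' l w v 1 =
      (l ^ 2 - l' ^ 2) * n - l * l' * s * P + l' ^ 2 * s * (g * Q + 2 * s * n) := by
  have h : s ^ 2 + g ^ 2 = 1 := by
    rw [hs, hg, div_pow, div_pow, ← add_div, div_eq_one_iff_eq (pow_ne_zero 2 hw)]
    ring
  have e0 : darbouxVec l' l w v 0 = l * v 0 - l' * (g * v 0 + s * v 1) := by
    rw [hs, hg]; rfl
  have e1 : darbouxVec l' l w v 1 = l * v 1 - l' * (s * v 0 - g * v 1) := by
    rw [hs, hg]; rfl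
  rw [e0, e1, hP, hQ, hn]
  refine ⟨?_, ?_, ?_⟩
  · linear_combination (l' ^ 2 * (v 0 ^ 2 + v 1 ^ 2)) * h
  · linear_combination (-l' ^ 2 * (v 0 ^ 2 - v 1 ^ 2)) * h
  · linear_combination (-l' ^ 2 * (v 0 * v 1)) * h

theorem darbouxVec_wronskian {l' l : ℂ} {w : Fin 2 → ℂ} (v v' : Fin 2 → ℂ)
    (hw : w 0 ^ 2 + w 1 ^ 2 ≠ 0) :
    darbouxVec l' l w v 0 * darbouxVec l' l w v' 1 - darbouxVec l' l w v 1 * darbouxVec l' l w v' 0 =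
      (l ^ 2 - l' ^ 2) * (v 0 * v' 1 - v 1 * v' 0) := by
  simp only [darbouxVec, Matrix.cons_val_zero, Matrix.cons_val_one]
  generalize hX : w 0 ^ 2 + w 1 ^ 2 = X at *
  field_simp
  linear_combination (-(v 0 * v' 1 - v 1 * v' 0) * l' ^ 2 * (X + (w 0 ^ 2 + w 1 ^ 2))) * hX

/-! ### The three-fold transformation as a step with λ₃ followed by a two-fold one. -/

section

variable {l₁ l₂ l₃ u : ℂ} {v₁ v₂ v₃ : Fin 2 → ℂ}

theorem twoFoldDen_darbouxVec (h3 : v₃ 0 ^ 2 + v₃ 1 ^ 2 ≠ 0) :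
    twoFoldDen l₁ l₂ (darbouxVec l₃ l₁ v₃ v₁) (darbouxVec l₃ l₂ v₃ v₂) * (v₃ 0 ^ 2 + v₃ 1 ^ 2) =
      threeFoldDen l₁ l₂ l₃ v₁ v₂ v₃ := by
  set s := 2 * v₃ 0 * v₃ 1 / (v₃ 0 ^ 2 + v₃ 1 ^ 2) with hs
  set g := (v₃ 0 ^ 2 - v₃ 1 ^ 2) / (v₃ 0 ^ 2 + v₃ 1 ^ 2) with hg
  have h : s ^ 2 + g ^ 2 = 1 := by
    rw [hs, hg, div_pow, div_pow, ← add_div, div_eq_one_iff_eq (pow_ne_zero 2 h3)]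
    ring
  obtain ⟨a1, a2, a3⟩ := darbouxVec_quadratic (l' := l₃) (l := l₁) (v := v₁) h3 hs hg rfl rfl rfl
  obtain ⟨b1, b2, b3⟩ := darbouxVec_quadratic (l' := l₃) (l := l₂) (v := v₂) h3 hs hg rfl rfl rfl
  have hQ : g * (v₃ 0 ^ 2 + v₃ 1 ^ 2) = v₃ 0 ^ 2 - v₃ 1 ^ 2 := div_mul_cancel₀ _ h3
  have hn : s * (v₃ 0 ^ 2 + v₃ 1 ^ 2) / 2 = v₃ 0 * v₃ 1 := by
    rw [hs, div_mul_cancel₀ _ h3]; ring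
  have hd : ∀ V W : Fin 2 → ℂ, twoFoldDen l₁ l₂ V W =
      (l₁ ^ 2 + l₂ ^ 2) * (V 0 ^ 2 + V 1 ^ 2) * (W 0 ^ 2 + W 1 ^ 2) -
        2 * l₁ * l₂ * (4 * (V 0 * V 1) * (W 0 * W 1) + (V 0 ^ 2 - V 1 ^ 2) * (W 0 ^ 2 - W 1 ^ 2)) :=
    fun V W => by rw [twoFoldDen]; ring
  rw [hd, a1, a2, a3, b1, b2, b3,
    threeFoldDen_eq l₁ l₂ l₃ v₁ v₂ v₃ rfl rfl rfl rfl rfl hQ rfl rfl hn]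
  generalize v₁ 0 ^ 2 + v₁ 1 ^ 2 = P₁
  generalize v₁ 0 ^ 2 - v₁ 1 ^ 2 = Q₁
  generalize v₁ 0 * v₁ 1 = n₁
  generalize v₂ 0 ^ 2 + v₂ 1 ^ 2 = P₂
  generalize v₂ 0 ^ 2 - v₂ 1 ^ 2 = Q₂
  generalize v₂ 0 * v₂ 1 = n₂
  generalize v₃ 0 ^ 2 + v₃ 1 ^ 2 = P₃
  linear_combination (-2 * l₁ * l₂ * P₃ * (4 * l₁ * l₂ * l₃ ^ 2 * P₁ * P₂ -
    4 * l₁ * l₃ ^ 3 * P₁ * (g * Q₂ + 2 * s * n₂) - 4 * l₂ * l₃ ^ 3 * P₂ * (g * Q₁ + 2 * s * n₁) +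
    4 * l₃ ^ 4 * (g * Q₁ + 2 * s * n₁) * (g * Q₂ + 2 * s * n₂))) * h

theorem threeFold_eq_iterate (h3 : v₃ 0 ^ 2 + v₃ 1 ^ 2 ≠ 0)
    (hd : twoFoldDen l₁ l₂ (darbouxVec l₃ l₁ v₃ v₁) (darbouxVec l₃ l₂ v₃ v₂) ≠ 0) :
    threeFold l₁ l₂ l₃ u v₁ v₂ v₃ = twoFold l₁ l₂ (oneFold l₃ u v₃) (darbouxVec l₃ l₁ v₃ v₁)
      (darbouxVec l₃ l₂ v₃ v₂) := by
  have hD := twoFoldDen_darbouxVec (l₁ := l₁) (l₂ := l₂) (l₃ := l₃) (v₁ := v₁) (v₂ := v₂) h3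
  set s := 2 * v₃ 0 * v₃ 1 / (v₃ 0 ^ 2 + v₃ 1 ^ 2) with hs
  set g := (v₃ 0 ^ 2 - v₃ 1 ^ 2) / (v₃ 0 ^ 2 + v₃ 1 ^ 2) with hg
  obtain ⟨a1, a2, a3⟩ := darbouxVec_quadratic (l' := l₃) (l := l₁) (v := v₁) h3 hs hg rfl rfl rfl
  obtain ⟨b1, b2, b3⟩ := darbouxVec_quadratic (l' := l₃) (l := l₂) (v := v₂) h3 hs hg rfl rfl rfl
  have hQ : g * (v₃ 0 ^ 2 + v₃ 1 ^ 2) = v₃ 0 ^ 2 - v₃ 1 ^ 2 := div_mul_cancel₀ _ h3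
  have hn : s * (v₃ 0 ^ 2 + v₃ 1 ^ 2) / 2 = v₃ 0 * v₃ 1 := by
    rw [hs, div_mul_cancel₀ _ h3]; ring
  have key : 4 * threeFoldNum l₁ l₂ l₃ v₁ v₂ v₃ = 2 * l₃ * s * threeFoldDen l₁ l₂ l₃ v₁ v₂ v₃ +
      4 * (l₁ ^ 2 - l₂ ^ 2) * (l₁ * (darbouxVec l₃ l₁ v₃ v₁ 0 * darbouxVec l₃ l₁ v₃ v₁ 1) *
        (darbouxVec l₃ l₂ v₃ v₂ 0 ^ 2 + darbouxVec l₃ l₂ v₃ v₂ 1 ^ 2) -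
        l₂ * (darbouxVec l₃ l₂ v₃ v₂ 0 * darbouxVec l₃ l₂ v₃ v₂ 1) *
        (darbouxVec l₃ l₁ v₃ v₁ 0 ^ 2 + darbouxVec l₃ l₁ v₃ v₁ 1 ^ 2)) * (v₃ 0 ^ 2 + v₃ 1 ^ 2) := by
    rw [a1, a3, b1, b3, threeFoldDen_eq l₁ l₂ l₃ v₁ v₂ v₃ rfl rfl rfl rfl rfl hQ rfl rfl hn,
      threeFoldNum_eq l₁ l₂ l₃ v₁ v₂ v₃ rfl rfl rfl rfl rfl hQ rfl rfl hn]
    generalize v₁ 0 ^ 2 + v₁ 1 ^ 2 = P₁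
    generalize v₁ 0 ^ 2 - v₁ 1 ^ 2 = Q₁
    generalize v₁ 0 * v₁ 1 = n₁
    generalize v₂ 0 ^ 2 + v₂ 1 ^ 2 = P₂
    generalize v₂ 0 ^ 2 - v₂ 1 ^ 2 = Q₂
    generalize v₂ 0 * v₂ 1 = n₂
    generalize v₃ 0 ^ 2 + v₃ 1 ^ 2 = P₃
    ring
  have e1 : oneFold l₃ u v₃ = u + 2 * l₃ * s := by
    rw [oneFold, oneFoldDen, hs]; ring
  rw [threeFold, twoFold, e1, key, ← hD]
  field_simp
  ring

end

/-! ### Dependence of the two-fold transformation on the direction of the eigenfunction -/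

theorem realTwoFoldDen_lower (l p q : ℂ) :
    l.im ^ 2 / 4 * (‖p‖ + ‖q‖) ^ 4 ≤ realTwoFoldDen l p q := by
  rw [realTwoFoldDen, Complex.normSq_eq_norm_sq, Complex.normSq_eq_norm_sq]
  have h1 : (‖p‖ + ‖q‖) ^ 4 ≤ 4 * (‖p‖ ^ 2 + ‖q‖ ^ 2) ^ 2 := by
    have h2 : (‖p‖ + ‖q‖) ^ 2 ≤ 2 * (‖p‖ ^ 2 + ‖q‖ ^ 2) := by nlinarith [sq_nonneg (‖p‖ - ‖q‖)]
    calc (‖p‖ + ‖q‖) ^ 4 = ((‖p‖ + ‖q‖) ^ 2) ^ 2 := by ring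
      _ ≤ (2 * (‖p‖ ^ 2 + ‖q‖ ^ 2)) ^ 2 := by gcongr
      _ = _ := by ring
  have := mul_le_mul_of_nonneg_left h1 (by positivity : 0 ≤ l.im ^ 2 / 4)
  have : 0 ≤ 4 * l.re ^ 2 * (p * conj q).im ^ 2 := by positivity
  linarith

theorem realTwoFoldDen_upper (l p q : ℂ) :
    realTwoFoldDen l p q ≤ 5 * ‖l‖ ^ 2 * (‖p‖ + ‖q‖) ^ 4 := by
  rw [realTwoFoldDen, Complex.normSq_eq_norm_sq, Complex.normSq_eq_norm_sq]
  have hp := norm_nonneg p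
  have hq := norm_nonneg q
  have h1 : (p * conj q).im ^ 2 ≤ ((‖p‖ + ‖q‖) ^ 2) ^ 2 := by
    rw [sq_le_sq, abs_of_nonneg (sq_nonneg (‖p‖ + ‖q‖))]
    refine (Complex.abs_im_le_norm _).trans ?_
    rw [norm_mul, RCLike.norm_conj]
    nlinarith
  have h2 : (‖p‖ ^ 2 + ‖q‖ ^ 2) ^ 2 ≤ ((‖p‖ + ‖q‖) ^ 2) ^ 2 := by
    gcongr; nlinarith
  have h3 : l.im ^ 2 ≤ ‖l‖ ^ 2 := by
    rw [← sq_abs]; exact pow_le_pow_left₀ (abs_nonneg _) (Complex.abs_im_le_norm l) 2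
  have h4 : l.re ^ 2 ≤ ‖l‖ ^ 2 := by
    rw [← sq_abs]; exact pow_le_pow_left₀ (abs_nonneg _) (Complex.abs_re_le_norm l) 2
  calc _ ≤ ‖l‖ ^ 2 * ((‖p‖ + ‖q‖) ^ 2) ^ 2 + 4 * ‖l‖ ^ 2 * ((‖p‖ + ‖q‖) ^ 2) ^ 2 := by gcongr
    _ = _ := by ring

theorem ofReal_realTwoFoldDen (l p q : ℂ) : (realTwoFoldDen l p q : ℂ) =
    -((l ^ 2 + conj l ^ 2) * ((p ^ 2 + q ^ 2) * conj (p ^ 2 + q ^ 2)) - 2 * (l * conj l) *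
      (4 * (p * q) * conj (p * q) + (p ^ 2 - q ^ 2) * conj (p ^ 2 - q ^ 2))) / 4 := by
  have h := twoFoldDen_eq l ![p, q]
  simp only [twoFoldDen, starVec, Matrix.cons_val_zero, Matrix.cons_val_one] at h
  push_cast at h
  simp only [map_mul, map_add, map_sub, map_pow]
  linear_combination (1 / 4 : ℂ) * h

/-- The increment depends only on the projective point (p : q). Every 2×2 minor of the quadratics
pq, p² + q², p² - q² taken at two points contains the factor pq' - qp', and the cross difference can
be regrouped into such minors. -/
theorem realTwoFold_cross_le (l p q p' q' : ℂ) :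
    ‖l * p * q * conj (p ^ 2 + q ^ 2) * realTwoFoldDen l p' q' -
        l * p' * q' * conj (p' ^ 2 + q' ^ 2) * realTwoFoldDen l p q‖ ≤
      8 * ‖l‖ ^ 3 * (‖p * q' - q * p'‖ * ((‖p‖ + ‖q‖) * (‖p'‖ + ‖q'‖)) *
        ((‖p‖ + ‖q‖) ^ 2 * (‖p'‖ + ‖q'‖) ^ 2)) := by
  set S := ‖p‖ + ‖q‖ with hS
  set S' := ‖p'‖ + ‖q'‖ with hS'
  set w := p * q' - q * p' with hw
  set B := realTwoFoldDen l p q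
  set B' := realTwoFoldDen l p' q'
  have sq : ∀ p q : ℂ, ‖p * q‖ ≤ (‖p‖ + ‖q‖) ^ 2 ∧ ‖p ^ 2 + q ^ 2‖ ≤ (‖p‖ + ‖q‖) ^ 2 ∧
      ‖p ^ 2 - q ^ 2‖ ≤ (‖p‖ + ‖q‖) ^ 2 := fun p q => by
    have hp := norm_nonneg p
    have hq := norm_nonneg q
    have e1 := norm_add_le (p ^ 2) (q ^ 2)
    have e2 := norm_sub_le (p ^ 2) (q ^ 2)
    rw [norm_pow, norm_pow] at e1 e2
    refine ⟨by rw [norm_mul]; nlinarith, by nlinarith, by nlinarith⟩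
  obtain ⟨n1, n2, n3⟩ := sq p q
  obtain ⟨m1, m2, m3⟩ := sq p' q'
  rw [← hS] at n1 n2 n3
  rw [← hS'] at m1 m2 m3
  have bil : ‖p * p' - q * q'‖ ≤ S * S' ∧ ‖p * p' + q * q'‖ ≤ S * S' ∧
      ‖p * q' + q * p'‖ ≤ S * S' := by
    have e1 := norm_sub_le (p * p') (q * q')
    have e2 := norm_add_le (p * p') (q * q')
    have e3 := norm_add_le (p * q') (q * p')
    simp only [norm_mul] at e1 e2 e3
    have := norm_nonneg p; have := norm_nonneg q; have := norm_nonneg p'; have := norm_nonneg q'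
    rw [hS, hS']
    refine ⟨?_, ?_, ?_⟩ <;> nlinarith [mul_nonneg (norm_nonneg p) (norm_nonneg p'),
      mul_nonneg (norm_nonneg p) (norm_nonneg q'), mul_nonneg (norm_nonneg q) (norm_nonneg p'),
      mul_nonneg (norm_nonneg q) (norm_nonneg q')]
  obtain ⟨b1, b2, b3⟩ := bil
  have d1 : ‖(p * q) * (p' ^ 2 + q' ^ 2) - (p' * q') * (p ^ 2 + q ^ 2)‖ ≤ ‖w‖ * (S * S') := by
    rw [show (p * q) * (p' ^ 2 + q' ^ 2) - (p' * q') * (p ^ 2 + q ^ 2) =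
      -w * (p * p' - q * q') by rw [hw]; ring, norm_mul, norm_neg]
    gcongr
  have d2 : ‖(p * q) * (p' ^ 2 - q' ^ 2) - (p' * q') * (p ^ 2 - q ^ 2)‖ ≤ ‖w‖ * (S * S') := by
    rw [show (p * q) * (p' ^ 2 - q' ^ 2) - (p' * q') * (p ^ 2 - q ^ 2) =
      -w * (p * p' + q * q') by rw [hw]; ring, norm_mul, norm_neg]
    gcongr
  have d3 : ‖(p ^ 2 + q ^ 2) * (p' ^ 2 - q' ^ 2) - (p' ^ 2 + q' ^ 2) * (p ^ 2 - q ^ 2)‖ ≤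
      2 * ‖w‖ * (S * S') := by
    rw [show (p ^ 2 + q ^ 2) * (p' ^ 2 - q' ^ 2) - (p' ^ 2 + q' ^ 2) * (p ^ 2 - q ^ 2) =
      -2 * w * (p * q' + q * p') by rw [hw]; ring, norm_mul, norm_mul, norm_neg, RCLike.norm_ofNat]
    gcongr
  set X := l * p * q * conj (p ^ 2 + q ^ 2) with hX
  set X' := l * p' * q' * conj (p' ^ 2 + q' ^ 2) with hX'
  -- Adding and subtracting one mixed product splits the difference into four summands, each
  -- carrying one minor or its conjugate.
  have e : X * B' - X' * B = -(l / 4) * ((l ^ 2 + conj l ^ 2) *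
      (conj (p ^ 2 + q ^ 2) * conj (p' ^ 2 + q' ^ 2) *
        ((p * q) * (p' ^ 2 + q' ^ 2) - (p' * q') * (p ^ 2 + q ^ 2))) -
      2 * (l * conj l) * (-(4 * ((p * q) * (p' * q') *
          conj ((p * q) * (p' ^ 2 + q' ^ 2) - (p' * q') * (p ^ 2 + q ^ 2)))) +
        ((p * q) * (p' ^ 2 - q' ^ 2) - (p' * q') * (p ^ 2 - q ^ 2)) *
          (conj (p ^ 2 + q ^ 2) * conj (p' ^ 2 - q' ^ 2)) +
        (p' * q') * (p ^ 2 - q ^ 2) *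
          conj ((p ^ 2 + q ^ 2) * (p' ^ 2 - q' ^ 2) - (p' ^ 2 + q' ^ 2) * (p ^ 2 - q ^ 2)))) := by
    simp only [B, B', X, X', ofReal_realTwoFoldDen]
    simp only [map_mul, map_add, map_sub, map_pow]
    ring
  have t1 : ‖conj (p ^ 2 + q ^ 2) * conj (p' ^ 2 + q' ^ 2) *
      ((p * q) * (p' ^ 2 + q' ^ 2) - (p' * q') * (p ^ 2 + q ^ 2))‖ ≤
      ‖w‖ * (S * S') * (S ^ 2 * S' ^ 2) := by
    rw [norm_mul, norm_mul, RCLike.norm_conj, RCLike.norm_conj, mul_comm]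
    gcongr
  have t2 : ‖(p * q) * (p' * q') *
      conj ((p * q) * (p' ^ 2 + q' ^ 2) - (p' * q') * (p ^ 2 + q ^ 2))‖ ≤
      ‖w‖ * (S * S') * (S ^ 2 * S' ^ 2) := by
    rw [norm_mul, norm_mul (p * q), RCLike.norm_conj, mul_comm]
    gcongr
  have t3 : ‖((p * q) * (p' ^ 2 - q' ^ 2) - (p' * q') * (p ^ 2 - q ^ 2)) *
      (conj (p ^ 2 + q ^ 2) * conj (p' ^ 2 - q' ^ 2))‖ ≤ ‖w‖ * (S * S') * (S ^ 2 * S' ^ 2) := by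
    rw [norm_mul, norm_mul (conj _), RCLike.norm_conj, RCLike.norm_conj]
    gcongr
  have t4 : ‖(p' * q') * (p ^ 2 - q ^ 2) * conj ((p ^ 2 + q ^ 2) * (p' ^ 2 - q' ^ 2) -
      (p' ^ 2 + q' ^ 2) * (p ^ 2 - q ^ 2))‖ ≤ 2 * (‖w‖ * (S * S') * (S ^ 2 * S' ^ 2)) := by
    rw [norm_mul, norm_mul (p' * q'), RCLike.norm_conj]
    calc _ = ‖(p ^ 2 + q ^ 2) * (p' ^ 2 - q' ^ 2) - (p' ^ 2 + q' ^ 2) * (p ^ 2 - q ^ 2)‖ *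
          (‖p ^ 2 - q ^ 2‖ * ‖p' * q'‖) := by ring
      _ ≤ 2 * ‖w‖ * (S * S') * (S ^ 2 * S' ^ 2) := by gcongr
      _ = _ := by ring
  have hl2 : ‖l ^ 2 + conj l ^ 2‖ ≤ 2 * ‖l‖ ^ 2 := by
    refine (norm_add_le _ _).trans (le_of_eq ?_)
    rw [norm_pow, norm_pow, RCLike.norm_conj]; ring
  have hll : ‖2 * (l * conj l)‖ = 2 * ‖l‖ ^ 2 := by
    rw [norm_mul, norm_mul, RCLike.norm_conj, RCLike.norm_ofNat]; ring
  set Z := ‖w‖ * (S * S') * (S ^ 2 * S' ^ 2)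
  have hZ : 0 ≤ Z := by positivity
  rw [e, norm_mul, norm_neg, norm_div, RCLike.norm_ofNat]
  refine (mul_le_mul_of_nonneg_left ((norm_sub_le _ _).trans (add_le_add
    ((norm_mul_le _ _).trans (mul_le_mul hl2 t1 (norm_nonneg _) (by positivity)))
    ((norm_mul_le _ _).trans (mul_le_mul hll.le ((norm_add₃_le).trans
      (add_le_add (add_le_add ((norm_neg _).le.trans ((norm_mul_le _ _).trans
        (mul_le_mul (RCLike.norm_ofNat 4).le t2 (norm_nonneg _) (by norm_num)))) t3) t4))
      (norm_nonneg _) (by positivity))))) (by positivity)).trans ?_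
  have : 0 ≤ ‖l‖ ^ 3 * Z := by positivity
  linarith

/-- A Lipschitz bound for the chordal distance |pq' - qp'| / (|v||v'|) on the projective line. The
denominators are bounded below by the fourth powers of the sizes, which cancels the homogeneity of
the cross difference. -/
theorem exists_realTwoFold_sub_le {l : ℂ} (hl : l.im ≠ 0) : ∃ C : ℝ, 0 < C ∧
    ∀ p q p' q' : ℂ, (p ≠ 0 ∨ q ≠ 0) → (p' ≠ 0 ∨ q' ≠ 0) →
      |realTwoFold l p q - realTwoFold l p' q'| * ((‖p‖ + ‖q‖) * (‖p'‖ + ‖q'‖)) ≤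
        C * ‖p * q' - q * p'‖ := by
  refine ⟨8 * |l.re * l.im| * (8 * ‖l‖ ^ 3) / (l.im ^ 2 / 4) ^ 2 + 1, by positivity,
    fun p q p' q' h h' => ?_⟩
  set S := ‖p‖ + ‖q‖ with hS
  set S' := ‖p'‖ + ‖q'‖ with hS'
  set w := p * q' - q * p' with hw
  have pos : ∀ {p q : ℂ}, (p ≠ 0 ∨ q ≠ 0) → 0 < ‖p‖ + ‖q‖ := fun h => by
    rcases h with h | h
    · have := norm_pos_iff.2 h; positivity
    · have := norm_pos_iff.2 h; positivity
  have hS0 : 0 < S := pos h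
  have hS0' : 0 < S' := pos h'
  have hB := realTwoFoldDen_lower l p q
  have hB' := realTwoFoldDen_lower l p' q'
  have hBp := realTwoFoldDen_pos hl h
  have hBp' := realTwoFoldDen_pos hl h'
  set B := realTwoFoldDen l p q
  set B' := realTwoFoldDen l p' q'
  set X := l * p * q * conj (p ^ 2 + q ^ 2) with hX
  set X' := l * p' * q' * conj (p' ^ 2 + q' ^ 2) with hX'
  have hmain : ‖X * B' - X' * B‖ ≤ 8 * ‖l‖ ^ 3 * (‖w‖ * (S * S') * (S ^ 2 * S' ^ 2)) :=
    realTwoFold_cross_le l p q p' q'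
  have hdiff : realTwoFold l p q - realTwoFold l p' q' =
      8 * (l.re * l.im) * (X * B' - X' * B).im / (B * B') := by
    simp only [realTwoFold, realTwoFoldNum]
    rw [div_sub_div _ _ hBp.ne' hBp'.ne']
    congr 1
    simp only [X, X', Complex.sub_im, Complex.im_mul_ofReal]
    ring
  have hBB : (l.im ^ 2 / 4) ^ 2 * (S ^ 4 * S' ^ 4) ≤ B * B' := by
    calc _ = (l.im ^ 2 / 4 * S ^ 4) * (l.im ^ 2 / 4 * S' ^ 4) := by ring
      _ ≤ _ := mul_le_mul hB hB' (by positivity) hBp.le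
  have hl4 : 0 < (l.im ^ 2 / 4) ^ 2 := by positivity
  rw [hdiff, abs_div, abs_mul, abs_mul, abs_of_pos (mul_pos hBp hBp'), div_mul_eq_mul_div,
    div_le_iff₀ (mul_pos hBp hBp'), abs_of_pos (by norm_num : (0 : ℝ) < 8)]
  have him := (Complex.abs_im_le_norm (X * B' - X' * B)).trans hmain
  calc 8 * |l.re * l.im| * |(X * B' - X' * B).im| * (S * S')
      ≤ 8 * |l.re * l.im| * (8 * ‖l‖ ^ 3 * (‖w‖ * (S * S') * (S ^ 2 * S' ^ 2))) * (S * S') := by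
        gcongr
    _ = 8 * |l.re * l.im| * (8 * ‖l‖ ^ 3) / (l.im ^ 2 / 4) ^ 2 * ‖w‖ *
        ((l.im ^ 2 / 4) ^ 2 * (S ^ 4 * S' ^ 4)) := by
        field_simp
    _ ≤ (8 * |l.re * l.im| * (8 * ‖l‖ ^ 3) / (l.im ^ 2 / 4) ^ 2 + 1) * ‖w‖ *
        ((l.im ^ 2 / 4) ^ 2 * (S ^ 4 * S' ^ 4)) := by
        gcongr; linarith
    _ ≤ _ := by gcongr

/-! ### The eigenfunction of the two-fold potential -/

/-- First component of the solution of the spatial Lax equation, at the parameter `l`, for the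
potential obtained from `(p, q)` by the two-fold transformation. -/
def twoFoldFst (l p q : ℂ) : ℂ :=
  -(l * conj (p ^ 2 + q ^ 2) * q - conj l * (2 * conj (p * q) * p - conj (p ^ 2 - q ^ 2) * q)) /
    realTwoFoldDen l p q

/-- Second component of that solution. -/
def twoFoldSnd (l p q : ℂ) : ℂ :=
  (l * conj (p ^ 2 + q ^ 2) * p - conj l * (conj (p ^ 2 - q ^ 2) * p + 2 * conj (p * q) * q)) /
    realTwoFoldDen l p q

theorem ofReal_realTwoFoldNum (l p q : ℂ) : (realTwoFoldNum l p q : ℂ) =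
    -((l ^ 2 - conj l ^ 2) * (l * (p * q) * conj (p ^ 2 + q ^ 2) -
      conj l * conj (p * q) * (p ^ 2 + q ^ 2))) := by
  simp only [realTwoFoldNum, map_add, map_mul, map_pow]
  apply Complex.ext
  · simp [pow_two]; ring
  · simp [pow_two]; right; ring

theorem hasDerivAt_twoFoldFst_Snd {l : ℂ} (hl : l.im ≠ 0) {u : ℝ} {p q : ℝ → ℂ} {x : ℝ}
    (h0 : p x ≠ 0 ∨ q x ≠ 0) (hp : HasDerivAt p (l * p x + u * q x) x)
    (hq : HasDerivAt q (-(u * p x) - l * q x) x) :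
    HasDerivAt (fun y => twoFoldFst l (p y) (q y)) (l * twoFoldFst l (p x) (q x) +
      (u + realTwoFold l (p x) (q x) : ℝ) * twoFoldSnd l (p x) (q x)) x ∧
    HasDerivAt (fun y => twoFoldSnd l (p y) (q y))
      (-((u + realTwoFold l (p x) (q x) : ℝ) * twoFoldFst l (p x) (q x)) -
        l * twoFoldSnd l (p x) (q x)) x := by
  have hp' := hasDerivAt_conj hp
  have hq' := hasDerivAt_conj hq
  simp only [map_add, map_sub, map_mul, map_neg, Complex.conj_ofReal] at hp' hq'
  have hB0 : (realTwoFoldDen l (p x) (q x) : ℂ) ≠ 0 :=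
    Complex.ofReal_ne_zero.2 (realTwoFoldDen_pos hl h0).ne'
  have hB : HasDerivAt (fun y => (realTwoFoldDen l (p y) (q y) : ℂ))
      (-((l ^ 2 - conj l ^ 2) * (l * (p x ^ 2 - q x ^ 2) * conj (p x ^ 2 + q x ^ 2) -
        conj l * (p x ^ 2 + q x ^ 2) * conj (p x ^ 2 - q x ^ 2))) / 2) x := by
    simp only [ofReal_realTwoFoldDen, map_mul, map_add, map_sub, map_pow]
    have e1 := ((hp.fun_pow 2).add (hq.fun_pow 2)).mul ((hp'.fun_pow 2).add (hq'.fun_pow 2))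
    have e2 := ((hp.mul hq).const_mul 4).mul (hp'.mul hq')
    have e3 := ((hp.fun_pow 2).sub (hq.fun_pow 2)).mul ((hp'.fun_pow 2).sub (hq'.fun_pow 2))
    refine ((((e1.const_mul (l ^ 2 + conj l ^ 2)).sub
      ((e2.add e3).const_mul (2 * (l * conj l)))).neg).div_const 4).congr_deriv ?_
    simp only [Pi.add_apply, Pi.sub_apply, Pi.mul_apply]
    push_cast
    ring
  have hN := ofReal_realTwoFoldNum l (p x) (q x)
  have hD := ofReal_realTwoFoldDen l (p x) (q x)
  simp only [map_mul, map_add, map_sub, map_pow] at hN hD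
  have hP := (hp'.fun_pow 2).add (hq'.fun_pow 2)
  have hQ := (hp'.fun_pow 2).sub (hq'.fun_pow 2)
  have hn := (hp'.mul hq').const_mul 2
  simp only [twoFoldFst, twoFoldSnd, realTwoFold, Complex.ofReal_add, Complex.ofReal_div]
  simp only [map_mul, map_add, map_sub, map_pow] at hB ⊢
  constructor
  · refine (((((hP.const_mul l).mul hq).sub (((hn.mul hp).sub (hQ.mul hq)).const_mul
      (conj l))).neg).fun_div hB hB0).congr_deriv ?_
    simp only [Pi.add_apply, Pi.sub_apply, Pi.mul_apply, Pi.neg_apply]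
    field_simp
    rw [hN, hD]
    push_cast
    ring
  · refine ((((hP.const_mul l).mul hp).sub (((hQ.mul hp).add (hn.mul hq)).const_mul
      (conj l))).fun_div hB hB0).congr_deriv ?_
    simp only [Pi.add_apply, Pi.sub_apply, Pi.mul_apply]
    field_simp
    rw [hN, hD]
    push_cast
    ring

/-- The transformed vector is cubic over quartic, hence of size inverse to (p, q). The lower bound
comes from its Wronskian with (p, q). -/
theorem twoFoldFst_Snd_bounds {l : ℂ} (hl : l.im ≠ 0) : ∃ m M : ℝ, 0 < m ∧ 0 < M ∧
    ∀ p q : ℂ, (p ≠ 0 ∨ q ≠ 0) →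
      m ≤ (‖p‖ + ‖q‖) * (‖twoFoldFst l p q‖ + ‖twoFoldSnd l p q‖) ∧
      (‖p‖ + ‖q‖) * (‖twoFoldFst l p q‖ + ‖twoFoldSnd l p q‖) ≤ M := by
  have hl0 : 0 < ‖l‖ := norm_pos_iff.2 fun h => hl (by rw [h]; rfl)
  refine ⟨|l.im| / (20 * ‖l‖ ^ 2), 32 * ‖l‖ / l.im ^ 2, by positivity, by positivity,
    fun p q h => ?_⟩
  set S := ‖p‖ + ‖q‖ with hS
  have hp := norm_nonneg p
  have hq := norm_nonneg q
  have hS0 : 0 < S := by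
    rcases h with h | h
    · have := norm_pos_iff.2 h; positivity
    · have := norm_pos_iff.2 h; positivity
  have hB := realTwoFoldDen_lower l p q
  have hB' := realTwoFoldDen_upper l p q
  have hBp := realTwoFoldDen_pos hl h
  rw [← hS] at hB hB'
  have hB0 : (realTwoFoldDen l p q : ℂ) ≠ 0 := Complex.ofReal_ne_zero.2 hBp.ne'
  constructor
  · have e : (p * twoFoldSnd l p q - q * twoFoldFst l p q) * realTwoFoldDen l p q =
        l * ((p ^ 2 + q ^ 2) * conj (p ^ 2 + q ^ 2)) - conj l *
          ((p ^ 2 - q ^ 2) * conj (p ^ 2 - q ^ 2) + 4 * (p * q * conj (p * q))) := by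
      simp only [twoFoldFst, twoFoldSnd]
      field_simp
      ring
    -- In the imaginary part the conjugate reverses a sign, all summands agree in sign, and nothing
    -- can cancel.
    have e' : ((p * twoFoldSnd l p q - q * twoFoldFst l p q) * realTwoFoldDen l p q).im =
        l.im * (Complex.normSq (p ^ 2 + q ^ 2) + Complex.normSq (p ^ 2 - q ^ 2) +
          4 * Complex.normSq (p * q)) := by
      rw [e]
      simp only [Complex.mul_conj]
      simp
      ring
    have h4 : S ^ 4 / 4 ≤ Complex.normSq (p ^ 2 + q ^ 2) + Complex.normSq (p ^ 2 - q ^ 2) +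
        4 * Complex.normSq (p * q) := by
      have par := parallelogram_law_with_norm ℝ (p ^ 2) (q ^ 2)
      simp only [norm_pow] at par
      simp only [Complex.normSq_eq_norm_sq, norm_mul]
      have h2 : S ^ 2 ≤ 2 * (‖p‖ ^ 2 + ‖q‖ ^ 2) := by nlinarith [sq_nonneg (‖p‖ - ‖q‖)]
      have h3 : (S ^ 2) ^ 2 ≤ (2 * (‖p‖ ^ 2 + ‖q‖ ^ 2)) ^ 2 := by gcongr
      nlinarith [sq_nonneg (‖p‖ * ‖q‖), sq_nonneg (‖p‖ ^ 2), sq_nonneg (‖q‖ ^ 2)]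
    have h5 : |l.im| * (S ^ 4 / 4) ≤
        ‖p * twoFoldSnd l p q - q * twoFoldFst l p q‖ * realTwoFoldDen l p q := by
      have e'' := Complex.abs_im_le_norm
        ((p * twoFoldSnd l p q - q * twoFoldFst l p q) * realTwoFoldDen l p q)
      rw [e', abs_mul, norm_mul, Complex.norm_real, Real.norm_of_nonneg hBp.le] at e''
      refine le_trans ?_ e''
      gcongr
      exact h4.trans (le_abs_self _)
    have h6 : ‖p * twoFoldSnd l p q - q * twoFoldFst l p q‖ ≤
        S * (‖twoFoldFst l p q‖ + ‖twoFoldSnd l p q‖) := by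
      refine (norm_sub_le _ _).trans ?_
      rw [norm_mul, norm_mul, hS]
      nlinarith [mul_nonneg hp (norm_nonneg (twoFoldFst l p q)),
        mul_nonneg hq (norm_nonneg (twoFoldSnd l p q))]
    rw [div_le_iff₀ (by positivity)]
    have h7 : |l.im| * (S ^ 4 / 4) ≤ S * (‖twoFoldFst l p q‖ + ‖twoFoldSnd l p q‖) *
        (5 * ‖l‖ ^ 2 * S ^ 4) := h5.trans (mul_le_mul h6 hB' hBp.le (by positivity))
    have h8 : 0 < S ^ 4 := by positivity
    refine le_of_mul_le_mul_right ?_ h8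
    linarith
  · have sq : ‖p * q‖ ≤ S ^ 2 ∧ ‖p ^ 2 + q ^ 2‖ ≤ S ^ 2 ∧ ‖p ^ 2 - q ^ 2‖ ≤ S ^ 2 := by
      have e1 := norm_add_le (p ^ 2) (q ^ 2)
      have e2 := norm_sub_le (p ^ 2) (q ^ 2)
      rw [norm_pow, norm_pow] at e1 e2
      refine ⟨by rw [norm_mul]; nlinarith, by nlinarith, by nlinarith⟩
    obtain ⟨s1, s2, s3⟩ := sq
    have hpS : ‖p‖ ≤ S := by linarith
    have hqS : ‖q‖ ≤ S := by linarith
    have cj : ∀ z : ℂ, ‖conj z‖ = ‖z‖ := fun z => RCLike.norm_conj z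
    have a1 : ‖l * conj (p ^ 2 + q ^ 2) * q - conj l *
        (2 * conj (p * q) * p - conj (p ^ 2 - q ^ 2) * q)‖ ≤ 4 * ‖l‖ * S ^ 3 := by
      refine (norm_sub_le _ _).trans ?_
      have b := norm_sub_le (2 * conj (p * q) * p) (conj (p ^ 2 - q ^ 2) * q)
      rw [norm_mul, norm_mul, norm_mul (conj (p ^ 2 - q ^ 2)), cj, cj, RCLike.norm_ofNat] at b
      rw [norm_mul, norm_mul, norm_mul (conj l), cj, cj]
      calc _ ≤ ‖l‖ * S ^ 2 * S + ‖l‖ * (2 * S ^ 2 * S + S ^ 2 * S) := by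
            gcongr; exact b.trans (by gcongr)
        _ = _ := by ring
    have a2 : ‖l * conj (p ^ 2 + q ^ 2) * p - conj l *
        (conj (p ^ 2 - q ^ 2) * p + 2 * conj (p * q) * q)‖ ≤ 4 * ‖l‖ * S ^ 3 := by
      refine (norm_sub_le _ _).trans ?_
      have b := norm_add_le (conj (p ^ 2 - q ^ 2) * p) (2 * conj (p * q) * q)
      rw [norm_mul, norm_mul (2 * _), norm_mul 2, cj, cj, RCLike.norm_ofNat] at b
      rw [norm_mul, norm_mul, norm_mul (conj l), cj, cj]
      calc _ ≤ ‖l‖ * S ^ 2 * S + ‖l‖ * (S ^ 2 * S + 2 * S ^ 2 * S) := by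
            gcongr; exact b.trans (by gcongr)
        _ = _ := by ring
    rw [twoFoldFst, twoFoldSnd, norm_div, norm_div, norm_neg, Complex.norm_real,
      Real.norm_of_nonneg hBp.le, ← add_div, mul_div_assoc', div_le_iff₀ hBp]
    calc _ ≤ S * (4 * ‖l‖ * S ^ 3 + 4 * ‖l‖ * S ^ 3) := by gcongr
      _ = 32 * ‖l‖ / l.im ^ 2 * (l.im ^ 2 / 4 * S ^ 4) := by field_simp; ring
      _ ≤ _ := by gcongr

/-! ### Algebraic solitons given by quadratic polynomials in the phase -/

/-- Continuous `L`-periodic functions. -/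
structure ContPer (L : ℝ) (f : ℝ → ℝ) : Prop where
  continuous : Continuous f
  periodic : ∀ y, f (y + L) = f y

theorem ContPer.bound {L : ℝ} {f : ℝ → ℝ} (h : ContPer L f) (hL : 0 < L) :
    ∃ M, 0 < M ∧ ∀ y, |f y| ≤ M :=
  exists_bound_of_periodic h.continuous hL h.periodic

theorem discrim_neg_of_ne_zero {d₀ d₁ d₂ : ℝ} (hd₂ : d₂ ≠ 0)
    (hd : ∀ T, d₀ + d₁ * T + d₂ * T ^ 2 ≠ 0) : 0 < 4 * d₀ * d₂ - d₁ ^ 2 := by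
  by_contra! hn
  obtain ⟨T, hT⟩ := exists_quadratic_eq_zero (b := d₁) (c := d₀) hd₂
    ⟨√(d₁ ^ 2 - 4 * d₀ * d₂), by rw [Real.mul_self_sqrt (by linarith), discrim]; ring⟩
  exact hd T (by linarith)

/-- Complete the square: 4d₂(d₀ + d₁T + d₂T²) = (2d₂T + d₁)² + (4d₀d₂ - d₁²). Absence of real zeros
makes the last bracket positive, and periodicity bounds it below uniformly in y. -/
theorem exists_quadratic_lower_bound {L : ℝ} (hL : 0 < L) {d₀ d₁ d₂ : ℝ → ℝ} (h₀ : ContPer L d₀)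
    (h₁ : ContPer L d₁) (h₂ : ContPer L d₂) (hd₂ : ∀ y, d₂ y ≠ 0)
    (hd : ∀ y T, d₀ y + d₁ y * T + d₂ y * T ^ 2 ≠ 0) :
    ∃ K, 0 < K ∧ ∀ y T, 1 + T ^ 2 ≤ K * |d₀ y + d₁ y * T + d₂ y * T ^ 2| := by
  obtain ⟨δ, hδ, hΔ⟩ := exists_lower_bound_of_periodic (f := fun y => 4 * d₀ y * d₂ y - d₁ y ^ 2)
    (((continuous_const.mul h₀.continuous).mul h₂.continuous).sub (h₁.continuous.pow 2)) hL
    (fun y => by simp only [h₀.periodic, h₁.periodic, h₂.periodic])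
    fun y => discrim_neg_of_ne_zero (hd₂ y) (hd y)
  obtain ⟨m, hm, hm'⟩ := exists_lower_bound_of_periodic (f := fun y => |d₂ y|)
    h₂.continuous.abs hL (fun y => by simp only [h₂.periodic]) fun y => abs_pos.2 (hd₂ y)
  obtain ⟨M₁, hM₁, b₁⟩ := h₁.bound hL
  obtain ⟨M₂, hM₂, b₂⟩ := h₂.bound hL
  refine ⟨(1 / δ + (1 + M₁ ^ 2 / δ) / (2 * m ^ 2)) * (4 * M₂), by positivity, fun y T => ?_⟩
  have hΔ := hΔ y
  have hm' := hm' y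
  have b₁ := b₁ y
  have b₂ := b₂ y
  set Z := (2 * d₂ y * T + d₁ y) ^ 2 + (4 * d₀ y * d₂ y - d₁ y ^ 2) with hZ
  have hZ1 : Z ≤ 4 * M₂ * |d₀ y + d₁ y * T + d₂ y * T ^ 2| := by
    have : Z = 4 * d₂ y * (d₀ y + d₁ y * T + d₂ y * T ^ 2) := by rw [hZ]; ring
    refine (le_abs_self Z).trans ?_
    rw [this, abs_mul, abs_mul, abs_of_pos (by norm_num : (0 : ℝ) < 4)]
    gcongr
  have hZδ : δ ≤ Z := by nlinarith [sq_nonneg (2 * d₂ y * T + d₁ y)]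
  have h1 : 1 ≤ 1 / δ * Z := by rw [div_mul_eq_mul_div, one_mul, le_div_iff₀ hδ]; linarith
  have h2 : T ^ 2 ≤ (1 + M₁ ^ 2 / δ) / (2 * m ^ 2) * Z := by
    rw [div_mul_eq_mul_div, le_div_iff₀ (by positivity)]
    have e1 : m ^ 2 ≤ d₂ y ^ 2 := by rw [← sq_abs (d₂ y)]; gcongr
    have e2 : d₁ y ^ 2 ≤ M₁ ^ 2 := by rw [← sq_abs (d₁ y)]; gcongr
    have e3 : M₁ ^ 2 ≤ M₁ ^ 2 / δ * Z := by
      rw [div_mul_eq_mul_div, le_div_iff₀ hδ]; gcongr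
    have e4 : (2 * d₂ y * T) ^ 2 ≤ 2 * (2 * d₂ y * T + d₁ y) ^ 2 + 2 * d₁ y ^ 2 := by
      nlinarith [sq_nonneg (2 * d₂ y * T + 2 * d₁ y)]
    have e5 : (2 * d₂ y * T + d₁ y) ^ 2 ≤ Z := by linarith
    nlinarith [mul_le_mul_of_nonneg_left e1 (sq_nonneg T)]
  calc 1 + T ^ 2 ≤ (1 / δ + (1 + M₁ ^ 2 / δ) / (2 * m ^ 2)) * Z := by linarith
    _ ≤ (1 / δ + (1 + M₁ ^ 2 / δ) / (2 * m ^ 2)) *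
        (4 * M₂ * |d₀ y + d₁ y * T + d₂ y * T ^ 2|) := by gcongr
    _ = _ := by ring

/-- For fixed y the variable T is affine in η, so linear over quadratic gives a rational function
with decay 1/|η|. One y whose numerator is nonzero for every T distinguishes the wave from its
background on all lines at once. -/
theorem isAlgebraicSolitonOn_of_quadratic {w : ℝ → ℝ} {v : ℝ → ℝ → ℝ} {c L c₀ σ : ℝ}
    {h n₀ n₁ d₀ d₁ d₂ : ℝ → ℝ} (hw : IsPeriodicWave w c L) (hwc : Continuous w)
    (hv : IsSolution v) (hσ : σ ≠ 0) (hh : ContPer L h) (hn₀ : ContPer L n₀) (hn₁ : ContPer L n₁)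
    (hd₀ : ContPer L d₀) (hd₁ : ContPer L d₁) (hd₂ : ContPer L d₂) (hd₂' : ∀ y, d₂ y ≠ 0)
    (hd : ∀ y T, d₀ y + d₁ y * T + d₂ y * T ^ 2 ≠ 0)
    (heq : ∀ x t T, T = σ * (x - c₀ * t) + h (x - c * t) → v x t = w (x - c * t) +
      (n₀ (x - c * t) + n₁ (x - c * t) * T) /
        (d₀ (x - c * t) + d₁ (x - c * t) * T + d₂ (x - c * t) * T ^ 2))
    (hne : ∃ y, ∀ T, n₀ y + n₁ y * T ≠ 0) : IsAlgebraicSolitonOn w c L c₀ v := by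
  have hL := hw.1
  refine ⟨hw, hv, fun y η => w y + (n₀ y + n₁ y * (σ * η + h y)) /
    (d₀ y + d₁ y * (σ * η + h y) + d₂ y * (σ * η + h y) ^ 2), ?_, fun x t => heq x t _ rfl, ?_,
    fun y => ?_, ?_, fun η => ?_⟩
  · have c0 := hn₀.continuous
    have c1 := hn₁.continuous
    have c2 := hd₀.continuous
    have c3 := hd₁.continuous
    have c4 := hd₂.continuous
    have c5 := hh.continuous
    exact (hwc.comp continuous_fst).add (Continuous.div (by fun_prop) (by fun_prop)
      fun z => hd z.1 _)
  · intro y η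
    simp only [hn₀.periodic, hn₁.periodic, hd₀.periodic, hd₁.periodic, hd₂.periodic, hh.periodic]
    rw [hw.2.1 y]
  · open Polynomial in
    set T : ℝ[X] := C σ * X + C (h y)
    refine ⟨C (w y) * (C (d₀ y) + C (d₁ y) * T + C (d₂ y) * T ^ 2) + (C (n₀ y) + C (n₁ y) * T),
      C (d₀ y) + C (d₁ y) * T + C (d₂ y) * T ^ 2, fun η => ?_⟩
    have := hd y (σ * η + h y)
    simp only [T, eval_add, eval_mul, eval_C, eval_pow, eval_X]
    exact ⟨this, by rw [add_div (w y * _), mul_div_cancel_right₀ _ this]⟩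
  · obtain ⟨K, hK, hq⟩ := exists_quadratic_lower_bound hL hd₀ hd₁ hd₂ hd₂' hd
    obtain ⟨N₀, hN₀, b₀⟩ := hn₀.bound hL
    obtain ⟨N₁, hN₁, b₁⟩ := hn₁.bound hL
    obtain ⟨H, hH, bh⟩ := hh.bound hL
    have hσ' := abs_pos.2 hσ
    refine ⟨(N₀ + N₁) * ((1 + H) / |σ| + 1) * 2 * K, fun y η => ?_⟩
    set T := σ * η + h y with hT
    have hq := hq y T
    have hT0 := abs_nonneg T
    have h1 : |n₀ y + n₁ y * T| ≤ (N₀ + N₁) * (1 + |T|) := by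
      refine (abs_add_le _ _).trans ?_
      rw [abs_mul]
      nlinarith [b₀ y, mul_le_mul_of_nonneg_right (b₁ y) hT0, mul_nonneg hN₀.le hT0]
    have h2 : 1 + |η| ≤ ((1 + H) / |σ| + 1) * (1 + |T|) := by
      have e : |σ| * |η| ≤ |T| + H := by
        rw [← abs_mul, show σ * η = T - h y by rw [hT]; ring]
        exact (abs_sub _ _).trans (by linarith [bh y])
      have : |η| ≤ (1 + H) / |σ| * (1 + |T|) := by
        rw [div_mul_eq_mul_div, le_div_iff₀ hσ']
        nlinarith [mul_nonneg hH.le hT0]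
      nlinarith
    have h3 : (1 + |T|) ^ 2 ≤ 2 * (1 + T ^ 2) := by
      nlinarith [sq_nonneg (1 - |T|), sq_abs T]
    rw [add_sub_cancel_left, abs_div, div_le_div_iff₀ (abs_pos.2 (hd y T)) (by positivity)]
    calc |n₀ y + n₁ y * T| * (1 + |η|)
        ≤ ((N₀ + N₁) * (1 + |T|)) * (((1 + H) / |σ| + 1) * (1 + |T|)) := by gcongr
      _ = (N₀ + N₁) * ((1 + H) / |σ| + 1) * (1 + |T|) ^ 2 := by ring
      _ ≤ (N₀ + N₁) * ((1 + H) / |σ| + 1) *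
          (2 * (K * |d₀ y + d₁ y * T + d₂ y * T ^ 2|)) := by
        have := h3.trans (mul_le_mul_of_nonneg_left hq zero_le_two)
        gcongr
      _ = _ := by ring
  · obtain ⟨y, hy⟩ := hne
    refine ⟨y, fun he => ?_⟩
    have := div_ne_zero (hy (σ * η + h y)) (hd y (σ * η + h y))
    exact this (by linarith)

/-! ### The one-fold transformation of a second solution -/

section

variable {U U₁ : ℝ → ℝ} {c e d L l τ : ℝ}

theorem phase_ofReal_im (y : ℝ) : (phase U c e l y).im = 0 := by
  have h : phase U c e l y = ((∫ s in (0 : ℝ)..y, -(l ^ 2 * (4 * l ^ 2 + 2 * U s ^ 2 - c)) /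
      (4 * l ^ 2 * U s + e) ^ 2 : ℝ) : ℂ) := by
    rw [phase, ← intervalIntegral.integral_ofReal]
    refine intervalIntegral.integral_congr fun s _ => ?_
    simp only [phaseRate]
    push_cast
    ring
  rw [h, Complex.ofReal_im]

theorem exists_real_timePhase (hU : Profile U U₁ c e d L) (hl : BranchPoint U c e d l)
    (hτ : phase U c e l L = τ) (hτ0 : τ ≠ 0) (C : ℝ) : ∃ h, ContPer L h ∧ ∀ x t,
      timePhase U c e l C x t = ((τ / L * (x - (c - L / τ) * t) + h (x - c * t) : ℝ) : ℂ) := by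
  have hL := hU.pos.ne'
  have hre : ∀ y, phase U c e l y = ((phase U c e l y).re : ℂ) := fun y =>
    Complex.ext rfl (by rw [phase_ofReal_im, Complex.ofReal_im])
  refine ⟨fun y => (phase U c e l y).re - τ / L * y + C, ⟨?_, fun y => ?_⟩, fun x t => ?_⟩
  · have : Continuous (phase U c e l) := (contDiff_phase hU hl).continuous
    fun_prop
  · rw [phase_add_period hU hl, hτ, Complex.add_re, Complex.ofReal_re]
    field_simp
    ring
  · rw [timePhase, hre]
    push_cast
    have h1 : (L : ℂ) ≠ 0 := Complex.ofReal_ne_zero.2 hL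
    have h2 : (τ : ℂ) ≠ 0 := Complex.ofReal_ne_zero.2 hτ0
    field_simp
    ring

/-- The data of a real second solution. -/
theorem exists_real_second (hU : Profile U U₁ c e d L) (hl : BranchPoint U c e d l)
    (hτ : phase U c e l L = τ) (hτ0 : τ ≠ 0) {ψ : ℝ → ℝ → Fin 2 → ℂ}
    (hψ : IsSecondSolution U c L l ψ) (hr : IsRealValued ψ) :
    ∃ (p q : ℝ → ℝ) (k : ℝ) (h : ℝ → ℝ) (P Q : ℝ → ℝ → ℝ),
      EigenPair U U₁ c e l k (fun y => p y) (fun y => q y) ∧ ContPer L h ∧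
      (∀ x t, ψ x t 0 = P x t ∧ ψ x t 1 = Q x t) ∧
      (∀ x t T, T = τ / L * (x - (c - L / τ) * t) + h (x - c * t) →
        P x t = T * p (x - c * t) + q (x - c * t) / (2 * (4 * l ^ 2 * U (x - c * t) + e)) ∧
        Q x t = T * q (x - c * t) - p (x - c * t) / (2 * (4 * l ^ 2 * U (x - c * t) + e))) ∧
      ContDiff ℝ ∞ (Function.uncurry P) ∧ ContDiff ℝ ∞ (Function.uncurry Q) ∧
      LaxOver l (travelling U c) (fun x t => P x t) (fun x t => Q x t) ∧
      ∀ x t, P x t ^ 2 + Q x t ^ 2 ≠ 0 := by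
  obtain ⟨p, q, k, C, hE, hφ⟩ := exists_real_eigenPair_of_isSecondSolution hU hl hψ hr
  obtain ⟨h, hh, hT⟩ := exists_real_timePhase hU hl hτ hτ0 C
  have hP : ∀ x t, ψ x t 0 = ((ψ x t 0).re : ℂ) := fun x t =>
    Complex.ext rfl (by rw [hr, Complex.ofReal_im])
  have hQ : ∀ x t, ψ x t 1 = ((ψ x t 1).re : ℂ) := fun x t =>
    Complex.ext rfl (by rw [hr, Complex.ofReal_im])
  have e0 : (fun x t => ψ x t 0) = secondFst U c e l C (fun y => p y) fun y => q y :=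
    funext₂ fun x t => (hφ x t).1
  have e1 : (fun x t => ψ x t 1) = secondSnd U c e l C (fun y => p y) fun y => q y :=
    funext₂ fun x t => (hφ x t).2
  obtain ⟨s0, s1⟩ := hE.contDiff_second (C := C) hU hl
  refine ⟨p, q, k, h, fun x t => (ψ x t 0).re, fun x t => (ψ x t 1).re, hE, hh,
    fun x t => ⟨hP x t, hQ x t⟩, fun x t T hTT => ?_, ?_, ?_, ?_, fun x t h0 => ?_⟩
  · have hT' := hT x t
    rw [← hTT] at hT'
    have h1 := (hφ x t).1
    have h2 := (hφ x t).2
    rw [hP, secondFst, hT', eigenDen] at h1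
    rw [hQ, secondSnd, hT', eigenDen] at h2
    exact ⟨by exact_mod_cast h1, by exact_mod_cast h2⟩
  · rw [← e0] at s0
    exact Complex.reCLM.contDiff.comp s0
  · rw [← e1] at s1
    exact Complex.reCLM.contDiff.comp s1
  · simp only [← hP, ← hQ, e0, e1]
    exact hE.laxOver_second hU hl
  · have h1 : (ψ x t 0).re = 0 := by nlinarith [sq_nonneg (ψ x t 0).re, sq_nonneg (ψ x t 1).re]
    have h2 : (ψ x t 1).re = 0 := by nlinarith [sq_nonneg (ψ x t 0).re, sq_nonneg (ψ x t 1).re]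
    have := hE.second_ne_zero (C := C) hl x t
    rw [← (hφ x t).1, ← (hφ x t).2, hP, hQ, h1, h2] at this
    simp at this

/-- For the second solution the sum of squares is k(1 + D²T²)/D and the product is quadratic in T.
The ratio of T² coefficients turns U into U - 4l²(4l² + 2U² - c)/D, which `hwU` identifies with w.
-/
theorem exists_isAlgebraicSolitonOn_oneFold (hU : Profile U U₁ c e d L)
    (hl : BranchPoint U c e d l) (hτ : phase U c e l L = τ) (hτ0 : τ ≠ 0) {w : ℝ → ℝ}
    (hw : IsPeriodicWave w c L) (hwc : Continuous w)
    (hwU : ∀ y, w y * (4 * l ^ 2 * U y + e) = e * U y - 2 * l ^ 2 * (4 * l ^ 2 - c)) {y₀ : ℝ}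
    (hy₀ : U₁ y₀ = 0) {ψ : ℝ → ℝ → Fin 2 → ℂ} (hψ : IsSecondSolution U c L l ψ)
    (hr : IsRealValued ψ) :
    ∃ v : ℝ → ℝ → ℝ, (∀ x t, oneFoldDen (ψ x t) ≠ 0 ∧
        (v x t : ℂ) = oneFold l (U (x - c * t)) (ψ x t)) ∧
      IsAlgebraicSolitonOn w c L (c - L / τ) v := by
  obtain ⟨p, q, k, h, P, Q, hE, hh, hψPQ, hPQ, sP, sQ, hlax, h0⟩ :=
    exists_real_second hU hl hτ hτ0 hψ hr
  have hsol := (hU.smoothSol.oneFold sP sQ h0 hlax).1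
  have hD : ∀ y, 4 * l ^ 2 * U y + e ≠ 0 := fun y => by exact_mod_cast hl.den_ne_zero y
  have hl0 : l ≠ 0 := by exact_mod_cast hl.ne_zero
  have hk : k ≠ 0 := by exact_mod_cast hE.ne_zero
  have hsum : ∀ y, p y ^ 2 + q y ^ 2 = k * (2 * (4 * l ^ 2 * U y + e)) := fun y => by
    have := hE.sum y
    rw [eigenDen] at this
    exact_mod_cast this
  have hdiff : ∀ y, p y ^ 2 - q y ^ 2 = k * (4 * l * U₁ y) := fun y => by
    exact_mod_cast hE.diff y
  have hprod : ∀ y, p y * q y = -(k * (l * (4 * l ^ 2 + 2 * U y ^ 2 - c))) := fun y => by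
    exact_mod_cast hE.prod y
  refine ⟨_, fun x t => ⟨?_, ?_⟩, isAlgebraicSolitonOn_of_quadratic (σ := τ / L) (h := h)
    (n₀ := fun y => 8 * l ^ 2 * (4 * l ^ 2 + 2 * U y ^ 2 - c) / (2 * (4 * l ^ 2 * U y + e)))
    (n₁ := fun y => -(16 * l ^ 2 * U₁ y)) (d₀ := fun _ => 1) (d₁ := fun _ => 0)
    (d₂ := fun y => (2 * (4 * l ^ 2 * U y + e)) ^ 2) hw hwc hsol.isSolution
    (div_ne_zero hτ0 hU.pos.ne') hh ?_ ?_ ?_ ?_ ?_ ?_ ?_ ?_ ?_⟩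
  · rw [oneFoldDen, (hψPQ x t).1, (hψPQ x t).2]
    exact_mod_cast h0 x t
  · rw [oneFold, oneFoldDen, (hψPQ x t).1, (hψPQ x t).2, realOneFold]
    push_cast
    rfl
  · exact ⟨Continuous.div (by have := hU.continuous; fun_prop)
      (by have := hU.continuous; fun_prop) fun y => mul_ne_zero two_ne_zero (hD y),
      fun y => by simp only [hU.periodic]⟩
  · exact ⟨by have := hU.continuous'; fun_prop, fun y => by simp only [hU.periodic']⟩
  · exact ⟨continuous_const, fun _ => rfl⟩
  · exact ⟨continuous_const, fun _ => rfl⟩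
  · exact ⟨by have := hU.continuous; fun_prop, fun y => by simp only [hU.periodic]⟩
  · exact fun y => pow_ne_zero 2 (mul_ne_zero two_ne_zero (hD y))
  · intro y T
    have : 0 ≤ (2 * (4 * l ^ 2 * U y + e)) ^ 2 * T ^ 2 := by positivity
    exact fun h => by linarith
  · intro x t T hT
    obtain ⟨e1, e2⟩ := hPQ x t T hT
    rw [realOneFold, e1, e2]
    simp only [travelling]
    have hs := hsum (x - c * t)
    have hd := hdiff (x - c * t)
    have hn := hprod (x - c * t)
    have hw' := hwU (x - c * t)
    have hD' := hD (x - c * t)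
    generalize U₁ (x - c * t) = u₁ at *
    generalize p (x - c * t) = p₀ at *
    generalize q (x - c * t) = q₀ at *
    generalize hu : U (x - c * t) = u at *
    set D := 2 * (4 * l ^ 2 * u + e) with hDD
    have hDne : D ≠ 0 := mul_ne_zero two_ne_zero hD'
    have hden : (T * p₀ + q₀ / D) ^ 2 + (T * q₀ - p₀ / D) ^ 2 = k * (1 + D ^ 2 * T ^ 2) / D := by
      field_simp
      linear_combination (D ^ 2 * T ^ 2 + 1) * hs
    have hpos : 1 + D ^ 2 * T ^ 2 ≠ 0 := by positivity
    have hnum : (T * p₀ + q₀ / D) * (T * q₀ - p₀ / D) =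
        k * (-(l * (4 * l ^ 2 + 2 * u ^ 2 - c)) * (T ^ 2 - 1 / D ^ 2) - T * (4 * l * u₁) / D) := by
      field_simp
      linear_combination (D ^ 2 * T ^ 2 - 1) * hn - T * D * hd
    have hwv : w (x - c * t) = u - 4 * l ^ 2 * (4 * l ^ 2 + 2 * u ^ 2 - c) / D := by
      refine mul_right_cancel₀ hDne ?_
      rw [sub_mul, div_mul_cancel₀ _ hDne, hDD]
      linear_combination 2 * hw'
    rw [mul_assoc (4 * l), hden, hnum, hwv, zero_mul, add_zero]
    field_simp
    ring
  -- At a critical point of U the term linear in T drops out. The constant term cannot vanish: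
  -- otherwise pq = 0 and p² = q², hence p² + q² = 0.
  · refine ⟨y₀, fun T => ?_⟩
    rw [hy₀, mul_zero, neg_zero, zero_mul, add_zero]
    refine div_ne_zero (mul_ne_zero (by positivity) fun h1 => ?_)
      (mul_ne_zero two_ne_zero (hD y₀))
    have hs := hsum y₀
    have hd := hdiff y₀
    have hn := hprod y₀
    rw [hy₀] at hd
    rw [h1] at hn
    have : (p y₀ ^ 2 + q y₀ ^ 2) ^ 2 = 0 := by
      linear_combination (p y₀ ^ 2 - q y₀ ^ 2) * hd + 4 * p y₀ * q y₀ * hn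
    rw [hs] at this
    exact mul_ne_zero hk (mul_ne_zero two_ne_zero (hD y₀)) (pow_eq_zero_iff two_ne_zero |>.1 this)

end

/-! ### Uniform convergence as `t → ±∞` -/

theorem tendsto_iSup_ofReal {g : ℝ → ℝ → ℝ} {m M C : ℝ} (hm : 0 < m)
    (h : ∀ x t, |g x t| * (m * |t| - M) ≤ C) {F : Filter ℝ}
    (hF : Tendsto (fun t : ℝ => |t|) F atTop) :
    Tendsto (fun t => ⨆ x : ℝ, ENNReal.ofReal |g x t|) F (𝓝 0) := by
  have h1 : Tendsto (fun t : ℝ => m * |t| - M) F atTop :=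
    tendsto_atTop_add_const_right _ _ (hF.const_mul_atTop hm)
  have h2 : Tendsto (fun t : ℝ => ENNReal.ofReal (C / (m * |t| - M))) F (𝓝 0) := by
    rw [← ENNReal.ofReal_zero]
    exact ENNReal.tendsto_ofReal (h1.const_div_atTop C)
  refine tendsto_of_tendsto_of_tendsto_of_le_of_le' tendsto_const_nhds h2
    (Eventually.of_forall fun _ => zero_le) ?_
  filter_upwards [h1.eventually_gt_atTop 0] with t ht
  exact iSup_le fun x => ENNReal.ofReal_le_ofReal (by rw [le_div_iff₀ ht]; exact h x t)

theorem tendsto_iInf_iSup_ofReal {v : ℝ → ℝ → ℝ} {w : ℝ → ℝ} {c L m M C : ℝ} (hL : 0 < L)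
    (hw : Function.Periodic w L) (hm : 0 < m)
    (h : ∀ x t, |v x t - w (x - c * t)| * (m * |t| - M) ≤ C) {F : Filter ℝ}
    (hF : Tendsto (fun t : ℝ => |t|) F atTop) :
    Tendsto (fun t : ℝ => ⨅ x₀ ∈ Set.Icc 0 L, ⨆ x : ℝ, ENNReal.ofReal |v x t - w (x - x₀)|)
      F (𝓝 0) := by
  refine tendsto_of_tendsto_of_tendsto_of_le_of_le tendsto_const_nhds
    (tendsto_iSup_ofReal (g := fun x t => v x t - w (x - c * t)) hm h hF)
    (fun _ => zero_le) fun t => ?_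
  -- The comparison translate is ct reduced modulo the period.
  refine iInf₂_le_of_le (toIcoMod hL 0 (c * t))
    (Set.Ico_subset_Icc_self (by simpa using toIcoMod_mem_Ico hL 0 (c * t))) (le_of_eq ?_)
  refine iSup_congr fun x => ?_
  have h1 : x - toIcoMod hL 0 (c * t) = x - c * t + toIcoDiv hL 0 (c * t) • L := by
    have := self_sub_toIcoMod hL 0 (c * t)
    linarith
  rw [h1, (hw.zsmul _) (x - c * t)]

/-! ### The two-fold transformation of a second solution -/

theorem realTwoFold_smul {l s : ℂ} (hs : s ≠ 0) (p q : ℂ) :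
    realTwoFold l (s * p) (s * q) = realTwoFold l p q := by
  have hN : 0 < Complex.normSq s := Complex.normSq_pos.2 hs
  have h1 : realTwoFoldNum l (s * p) (s * q) = Complex.normSq s ^ 2 * realTwoFoldNum l p q := by
    have : l * (s * p) * (s * q) * conj ((s * p) ^ 2 + (s * q) ^ 2) =
        ((Complex.normSq s ^ 2 : ℝ) : ℂ) * (l * p * q * conj (p ^ 2 + q ^ 2)) := by
      push_cast
      rw [Complex.normSq_eq_conj_mul_self]
      simp only [map_add, map_mul, map_pow]
      ring
    rw [realTwoFoldNum, realTwoFoldNum, this, Complex.im_ofReal_mul]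
    ring
  have h2 : realTwoFoldDen l (s * p) (s * q) = Complex.normSq s ^ 2 * realTwoFoldDen l p q := by
    have : s * p * conj (s * q) = (Complex.normSq s : ℂ) * (p * conj q) := by
      rw [Complex.normSq_eq_conj_mul_self, map_mul]; ring
    rw [realTwoFoldDen, realTwoFoldDen, this, Complex.im_ofReal_mul, map_mul, map_mul]
    ring
  rw [realTwoFold, realTwoFold, h1, h2, mul_div_mul_left _ _ (by positivity)]

/-- Up to scale these vectors are all directions except (1, -1). The increment has its extreme value
-4 Re λ there and nowhere else, because the difference from it is Re λ times a positive sum of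
squares over the denominator. -/
theorem realTwoFold_ne {l : ℂ} (hre : l.re ≠ 0) (him : l.im ≠ 0) (z : ℂ) :
    realTwoFold l (z - 1) (-(z + 1)) ≠ realTwoFold l 1 (-1) := by
  have h1 : realTwoFold l 1 (-1) = -4 * l.re := by
    have a : realTwoFoldNum l 1 (-1) = -16 * l.re * l.im ^ 2 := by
      simp [realTwoFoldNum]; ring
    have b : realTwoFoldDen l 1 (-1) = 4 * l.im ^ 2 := by
      simp [realTwoFoldDen]; ring
    rw [realTwoFold, a, b]
    field_simp
    norm_num
  have h0 : z - 1 ≠ 0 ∨ -(z + 1) ≠ 0 := by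
    by_contra! h
    have : (2 : ℂ) = 0 := by linear_combination -h.1 - h.2
    norm_num at this
  have hB := realTwoFoldDen_pos him h0
  rw [h1, realTwoFold, ne_eq, div_eq_iff hB.ne']
  intro h
  have h3 : realTwoFoldNum l (z - 1) (-(z + 1)) + 4 * l.re * realTwoFoldDen l (z - 1) (-(z + 1)) =
      32 * l.re * (l.im ^ 2 * (1 + z.im ^ 2) + (l.im * z.re - l.re * z.im) ^ 2 +
        l.re ^ 2 * z.im ^ 2) := by
    simp [realTwoFoldNum, realTwoFoldDen, pow_two, Complex.normSq_apply]
    ring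
  rw [h] at h3
  have h4 : 0 < l.im ^ 2 * (1 + z.im ^ 2) + (l.im * z.re - l.re * z.im) ^ 2 +
      l.re ^ 2 * z.im ^ 2 := by
    have : 0 < l.im ^ 2 := by positivity
    positivity
  exact (mul_ne_zero (mul_ne_zero (by norm_num : (32 : ℝ) ≠ 0) hre) h4.ne') (by linarith)

section

variable {U U₁ : ℝ → ℝ} {c e d L : ℝ} {l k C : ℂ} {p q : ℝ → ℂ}

/-- Where q = -p, the factor p/D can be taken out of the second solution, leaving (z - 1, -(z + 1))
with z = TD. -/
theorem EigenPair.realTwoFold_second_ne (hre : l.re ≠ 0) (him : l.im ≠ 0)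
    (hl : BranchPoint U c e d l) (h : EigenPair U U₁ c e l k p q) {x t : ℝ}
    (hx : q (x - c * t) = -p (x - c * t)) :
    realTwoFold l (secondFst U c e l C p q x t) (secondSnd U c e l C p q x t) ≠
      realTwoFold l (p (x - c * t)) (q (x - c * t)) := by
  have hp : p (x - c * t) ≠ 0 := by
    rcases h.vec_ne_zero hl (x - c * t) with h | h
    · exact h
    · rw [hx] at h; exact neg_ne_zero.1 h
  have hD := eigenDen_ne_zero hl (x - c * t)
  simp only [secondFst, secondSnd, hx]
  generalize timePhase U c e l C x t = T
  generalize p (x - c * t) = a at *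
  generalize eigenDen U e l (x - c * t) = D at *
  have e1 : T * a + -a / D = a / D * (T * D - 1) := by field_simp; ring
  have e2 : T * -a - a / D = a / D * -(T * D + 1) := by field_simp; ring
  have e3 := realTwoFold_smul (l := l) hp 1 (-1)
  rw [mul_one, mul_neg_one] at e3
  rw [e1, e2, realTwoFold_smul (div_ne_zero hp hD), e3]
  exact realTwoFold_ne hre him _

theorem exists_second_lower (hU : Profile U U₁ c e d L) (hl : BranchPoint U c e d l)
    (hτ : (phase U c e l L).im ≠ 0) {ψ : ℝ → ℝ → Fin 2 → ℂ} (hψ : IsSecondSolution U c L l ψ) :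
    ∃ m M : ℝ, 0 < m ∧ ∀ x t, m * (|x| + |t|) - M ≤ ‖ψ x t 0‖ + ‖ψ x t 1‖ := by
  obtain ⟨m, M, hm, h⟩ := growsLinearly_of_isSecondSolution hU hl hτ hψ
  exact ⟨m, M, hm, fun x t => (h x t).1.trans (norm_fin_two_bounds _).1⟩

theorem exists_isRogueWaveOn_twoFold (hre : l.re ≠ 0) (him : l.im ≠ 0)
    (hU : Profile U U₁ c e d L) (hl : BranchPoint U c e d l) (hτ : (phase U c e l L).im ≠ 0)
    {w : ℝ → ℝ} (hw : IsPeriodicWave w c L)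
    (hwU : ∀ {k p q}, EigenPair U U₁ c e l k p q →
      ∀ y, w y = U y + realTwoFold l (p y) (q y))
    (h0 : ∀ {k p q}, EigenPair U U₁ c e l k p q → q 0 = -p 0)
    {ψ : ℝ → ℝ → Fin 2 → ℂ} (hψ : IsSecondSolution U c L l ψ) :
    ∃ v : ℝ → ℝ → ℝ, (∀ x t, twoFoldDen l (conj l) (ψ x t) (starVec (ψ x t)) ≠ 0 ∧
        (v x t : ℂ) = twoFold l (conj l) (U (x - c * t)) (ψ x t) (starVec (ψ x t))) ∧
      IsRogueWaveOn w c L v := by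
  obtain ⟨m, M, hm, hlow⟩ := exists_second_lower hU hl hτ hψ
  obtain ⟨p, q, k, C, hE, hφ⟩ := exists_eigenPair_of_isSecondSolution hU hl hψ
  obtain ⟨s0, s1⟩ := hE.contDiff_second (C := C) hU hl
  obtain ⟨m', _, hm', _, hb⟩ := hE.bounds hU hl
  obtain ⟨C₀, hC₀, hcmp⟩ := exists_realTwoFold_sub_le him
  have hne : ∀ x t, ψ x t 0 ≠ 0 ∨ ψ x t 1 ≠ 0 := fun x t => by
    rw [(hφ x t).1, (hφ x t).2]; exact hE.second_ne_zero hl x t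
  have hsol := hU.smoothSol.twoFold him s0 s1 (hE.second_ne_zero hl) (hE.laxOver_second hU hl)
  have e0 : secondFst U c e l C p q = fun x t => ψ x t 0 := funext₂ fun x t => (hφ x t).1.symm
  have e1 : secondSnd U c e l C p q = fun x t => ψ x t 1 := funext₂ fun x t => (hφ x t).2.symm
  set v : ℝ → ℝ → ℝ := fun x t => travelling U c x t + realTwoFold l (ψ x t 0) (ψ x t 1)
  have hv : IsSolution v := by
    have := hsol.isSolution
    rwa [e0, e1] at this
  have hdiff : ∀ x t, |v x t - w (x - c * t)| * (m * (|x| + |t|) - M) ≤ C₀ * ‖k‖ / m' := by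
    intro x t
    have h1 := hcmp _ _ _ _ (hne x t) (hE.vec_ne_zero hl (x - c * t))
    have h2 := hE.wronskian_second (C := C) hl x t
    rw [← (hφ x t).1, ← (hφ x t).2] at h2
    rw [show ψ x t 0 * q (x - c * t) - ψ x t 1 * p (x - c * t) = k by linear_combination -h2] at h1
    rw [show v x t - w (x - c * t) = realTwoFold l (ψ x t 0) (ψ x t 1) -
      realTwoFold l (p (x - c * t)) (q (x - c * t)) by
        rw [hwU hE]; simp only [v, travelling]; ring]
    rw [le_div_iff₀ hm']
    refine le_trans ?_ h1
    rw [mul_assoc]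
    refine mul_le_mul_of_nonneg_left ?_ (abs_nonneg _)
    exact (mul_le_mul_of_nonneg_right (hlow x t) hm'.le).trans
      (mul_le_mul_of_nonneg_left (hb _).1 (by positivity))
  have hdiff' : ∀ x t, |v x t - w (x - c * t)| * (m * |t| - M) ≤ C₀ * ‖k‖ / m' := fun x t => by
    refine le_trans (mul_le_mul_of_nonneg_left ?_ (abs_nonneg _)) (hdiff x t)
    nlinarith [abs_nonneg x]
  refine ⟨v, fun x t => ⟨twoFoldDen_ne_zero him (hne x t), ?_⟩, hw, hv, fun t x₀ _ => ?_,
    tendsto_iInf_iSup_ofReal hw.1 hw.2.1 hm hdiff' tendsto_abs_atTop_atTop,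
    tendsto_iInf_iSup_ofReal hw.1 hw.2.1 hm hdiff' tendsto_abs_atBot_atTop⟩
  · rw [twoFold_eq]
    simp only [v, travelling]
    push_cast
    rfl
  -- Suppose v(·, t) is the translate by x₀. Along x = ct + nL the decay of the deviation gives w(ct
  -- - x₀) = w(0). Then v equals w(0) at x = ct, contrary to strict extremality in the direction (1,
  -- -1).
  · by_contra! hcon
    have hper : ∀ (n : ℕ) (y : ℝ), w (y + n * L) = w y := fun n y => (hw.2.1.nat_mul n) y
    have hn : ∀ n : ℕ, |w (c * t - x₀) - w 0| * (m * (n * L - |c * t|) - M) ≤ C₀ * ‖k‖ / m' := by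
      intro n
      have h1 := hdiff (c * t + n * L) t
      rw [hcon, show c * t + n * L - x₀ = c * t - x₀ + n * L by ring, hper,
        show c * t + n * L - c * t = 0 + n * L by ring, hper] at h1
      refine le_trans (mul_le_mul_of_nonneg_left ?_ (abs_nonneg _)) h1
      have h2 : n * L - |c * t| ≤ |c * t + n * L| := by
        have := neg_abs_le (c * t); linarith [le_abs_self (c * t + n * L)]
      have := abs_nonneg t
      nlinarith
    have heq : w (c * t - x₀) = w 0 := by
      by_contra hne'
      have hpos : 0 < |w (c * t - x₀) - w 0| := abs_pos.2 (sub_ne_zero.2 hne')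
      have hL := hw.1
      obtain ⟨n, hn'⟩ := exists_nat_gt
        ((C₀ * ‖k‖ / m' / |w (c * t - x₀) - w 0| + M + m * |c * t|) / (m * L))
      rw [div_lt_iff₀ (by positivity)] at hn'
      have h3 := hn n
      have h4 : C₀ * ‖k‖ / m' / |w (c * t - x₀) - w 0| < m * (n * L - |c * t|) - M := by linarith
      rw [div_lt_iff₀ hpos] at h4
      linarith
    have h5 := hcon (c * t)
    rw [heq, hwU hE] at h5
    have h6 : realTwoFold l (ψ (c * t) t 0) (ψ (c * t) t 1) = realTwoFold l (p 0) (q 0) := by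
      simp only [v, travelling, sub_self] at h5
      linarith
    rw [(hφ _ _).1, (hφ _ _).2] at h6
    have h7 := hE.realTwoFold_second_ne (C := C) hre him hl (x := c * t) (t := t)
      (by rw [sub_self]; exact h0 hE)
    rw [sub_self] at h7
    exact h7 h6

end

/-! ### Two-fold transformations of a bounded and of a growing eigenfunction differ -/

/-- A real potential cancels from (|f|² + |g|²)' = 2 Re λ (|f|² - |g|²). Multiplying by exp(-2|Re
λ|x) therefore makes the energy nonincreasing. -/
theorem eq_zero_of_lax_x {l : ℂ} {u : ℝ → ℝ} {f g : ℝ → ℂ}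
    (hf : ∀ x, HasDerivAt f (l * f x + u x * g x) x)
    (hg : ∀ x, HasDerivAt g (-(u x * f x) - l * g x) x) (h0 : f 0 = 0 ∧ g 0 = 0) {x : ℝ}
    (hx : 0 ≤ x) : f x = 0 ∧ g x = 0 := by
  set h : ℝ → ℝ := fun x => Complex.normSq (f x) + Complex.normSq (g x)
  have hd : ∀ x, HasDerivAt h
      (2 * l.re * (Complex.normSq (f x) - Complex.normSq (g x))) x := fun x => by
    have h1 : HasDerivAt (fun y => f y * conj (f y) + g y * conj (g y))
        ((l + conj l) * (f x * conj (f x) - g x * conj (g x))) x := by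
      refine (((hf x).mul (hasDerivAt_conj (hf x))).add
        ((hg x).mul (hasDerivAt_conj (hg x)))).congr_deriv ?_
      simp only [map_add, map_sub, map_mul, map_neg, Complex.conj_ofReal]
      ring
    have h2 := Complex.reCLM.hasFDerivAt.comp_hasDerivAt x h1
    refine (h2.congr_deriv ?_).congr_of_eventuallyEq (Eventually.of_forall fun y => ?_)
    · simp only [Complex.mul_conj, Complex.add_conj, Complex.reCLM_apply]
      rw [← Complex.ofReal_sub, ← Complex.ofReal_mul, Complex.ofReal_re]
    · simp only [h, Function.comp_apply, Complex.mul_conj, Complex.reCLM_apply, Complex.add_re,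
        Complex.ofReal_re]
  have hE : ∀ x, HasDerivAt (fun y => h y * Real.exp (-(2 * |l.re|) * y))
      ((2 * l.re * (Complex.normSq (f x) - Complex.normSq (g x)) - 2 * |l.re| * h x) *
        Real.exp (-(2 * |l.re|) * x)) x := fun x => by
    have h1 : HasDerivAt (fun y => Real.exp (-(2 * |l.re|) * y))
        (Real.exp (-(2 * |l.re|) * x) * -(2 * |l.re|)) x := by
      have := ((hasDerivAt_id x).const_mul (-(2 * |l.re|))).exp
      simpa using this
    exact ((hd x).mul h1).congr_deriv (by ring)
  have hanti : Antitone fun y => h y * Real.exp (-(2 * |l.re|) * y) := by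
    refine antitone_of_deriv_nonpos (fun x => (hE x).differentiableAt) fun x => ?_
    rw [(hE x).deriv]
    refine mul_nonpos_of_nonpos_of_nonneg ?_ (Real.exp_pos _).le
    have e1 := Complex.normSq_nonneg (f x)
    have e2 := Complex.normSq_nonneg (g x)
    have e3 := le_abs_self l.re
    have e4 := neg_abs_le l.re
    simp only [h]
    nlinarith
  have h2 := hanti hx
  simp only [h, h0.1, h0.2, map_zero, add_zero, zero_mul] at h2
  have h3 := Real.exp_pos (-(2 * |l.re|) * x)
  have e1 := Complex.normSq_nonneg (f x)
  have e2 := Complex.normSq_nonneg (g x)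
  have h4 : Complex.normSq (f x) + Complex.normSq (g x) ≤ 0 := by
    by_contra! hn
    have := mul_pos hn h3
    linarith
  exact ⟨Complex.normSq_eq_zero.1 (by linarith), Complex.normSq_eq_zero.1 (by linarith)⟩

/-- If the increments agreed everywhere, both transformed vectors would solve one spatial equation.
Their sizes are inverse to those of the original vectors, so one tends to 0 and the other stays
between positive bounds. The constant Wronskian is then 0, the two are proportional, and this
contradicts their sizes. -/
theorem exists_realTwoFold_ne {l : ℂ} (hl : l.im ≠ 0) {u : ℝ → ℝ} {p q p' q' : ℝ → ℂ} {m M : ℝ}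
    (hm : 0 < m) (hp : ∀ x, HasDerivAt p (l * p x + u x * q x) x)
    (hq : ∀ x, HasDerivAt q (-(u x * p x) - l * q x) x)
    (hp' : ∀ x, HasDerivAt p' (l * p' x + u x * q' x) x)
    (hq' : ∀ x, HasDerivAt q' (-(u x * p' x) - l * q' x) x) (h0 : ∀ x, p x ≠ 0 ∨ q x ≠ 0)
    (hb : ∀ x, m ≤ ‖p' x‖ + ‖q' x‖ ∧ ‖p' x‖ + ‖q' x‖ ≤ M)
    (ht : Tendsto (fun x => ‖p x‖ + ‖q x‖) atTop atTop) :
    ∃ x, realTwoFold l (p x) (q x) ≠ realTwoFold l (p' x) (q' x) := by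
  by_contra! hcon
  have h0' : ∀ x, p' x ≠ 0 ∨ q' x ≠ 0 := fun x => by
    by_contra! h
    have := (hb x).1
    rw [h.1, h.2, norm_zero, add_zero] at this
    linarith
  obtain ⟨n, N, hn, hN, hbd⟩ := twoFoldFst_Snd_bounds hl
  set V : ℝ → ℝ := fun x => u x + realTwoFold l (p x) (q x)
  set F := fun x => twoFoldFst l (p x) (q x)
  set G := fun x => twoFoldSnd l (p x) (q x)
  set F' := fun x => twoFoldFst l (p' x) (q' x)
  set G' := fun x => twoFoldSnd l (p' x) (q' x)
  have hFG : ∀ x, HasDerivAt F (l * F x + V x * G x) x ∧ HasDerivAt G (-(V x * F x) - l * G x) x :=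
    fun x => hasDerivAt_twoFoldFst_Snd hl (h0 x) (hp x) (hq x)
  have hFG' : ∀ x, HasDerivAt F' (l * F' x + V x * G' x) x ∧
      HasDerivAt G' (-(V x * F' x) - l * G' x) x := fun x => by
    have := hasDerivAt_twoFoldFst_Snd hl (h0' x) (hp' x) (hq' x)
    rw [← hcon x] at this
    exact this
  have hS : ∀ x, n ≤ (‖p x‖ + ‖q x‖) * (‖F x‖ + ‖G x‖) ∧
      (‖p x‖ + ‖q x‖) * (‖F x‖ + ‖G x‖) ≤ N := fun x => hbd _ _ (h0 x)
  have hS' : ∀ x, n ≤ (‖p' x‖ + ‖q' x‖) * (‖F' x‖ + ‖G' x‖) ∧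
      (‖p' x‖ + ‖q' x‖) * (‖F' x‖ + ‖G' x‖) ≤ N := fun x => hbd _ _ (h0' x)
  have hM : 0 < M := hm.trans_le ((hb 0).1.trans (hb 0).2)
  have hup' : ∀ x, ‖F' x‖ + ‖G' x‖ ≤ N / m := fun x => by
    rw [le_div_iff₀ hm, mul_comm]
    exact (mul_le_mul_of_nonneg_right (hb x).1 (by positivity)).trans (hS' x).2
  have hlo' : ∀ x, n / M ≤ ‖F' x‖ + ‖G' x‖ := fun x => by
    rw [div_le_iff₀ hM, mul_comm]
    exact (hS' x).1.trans (mul_le_mul_of_nonneg_right (hb x).2 (by positivity))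
  have hlim : Tendsto (fun x => ‖F x‖ + ‖G x‖) atTop (𝓝 0) := by
    refine tendsto_of_tendsto_of_tendsto_of_le_of_le' tendsto_const_nhds
      (ht.const_div_atTop N) (Eventually.of_forall fun x => by positivity) ?_
    filter_upwards [ht.eventually_gt_atTop 0] with x hx
    rw [le_div_iff₀ hx, mul_comm]
    exact (hS x).2
  have hW : ∀ x, F x * G' x - G x * F' x = F 0 * G' 0 - G 0 * F' 0 := fun x => by
    have hd : ∀ x, HasDerivAt (fun x => F x * G' x - G x * F' x) 0 x := fun x =>
      (((hFG x).1.mul (hFG' x).2).sub ((hFG x).2.mul (hFG' x).1)).congr_deriv (by ring)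
    exact is_const_of_deriv_eq_zero (fun y => (hd y).differentiableAt) (fun y => (hd y).deriv) x 0
  have hW0 : F 0 * G' 0 - G 0 * F' 0 = 0 := by
    have h1 : Tendsto (fun x => (‖F x‖ + ‖G x‖) * (N / m)) atTop (𝓝 (0 * (N / m))) :=
      hlim.mul_const _
    rw [zero_mul] at h1
    have h2 : ‖F 0 * G' 0 - G 0 * F' 0‖ ≤ 0 := ge_of_tendsto' h1 fun x => by
      rw [← hW x]
      refine (norm_sub_le _ _).trans ?_
      rw [norm_mul, norm_mul]
      refine le_trans ?_ (mul_le_mul_of_nonneg_left (hup' x) (by positivity))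
      nlinarith [mul_nonneg (norm_nonneg (F x)) (norm_nonneg (F' x)),
        mul_nonneg (norm_nonneg (G x)) (norm_nonneg (G' x))]
    exact norm_le_zero_iff.1 h2
  obtain ⟨κ, hκ⟩ : ∃ κ : ℂ, F 0 = κ * F' 0 ∧ G 0 = κ * G' 0 := by
    by_cases hF : F' 0 = 0
    · have hG : G' 0 ≠ 0 := fun hG => by
        have := hlo' 0
        rw [hF, hG, norm_zero, add_zero] at this
        have : 0 < n / M := by positivity
        linarith
      refine ⟨G 0 / G' 0, ?_, by field_simp⟩
      rw [hF, mul_zero, sub_zero] at hW0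
      rw [hF, mul_zero]
      exact (mul_eq_zero.1 hW0).resolve_right hG
    · refine ⟨F 0 / F' 0, by field_simp, ?_⟩
      field_simp
      linear_combination -hW0
  have hκ0 : κ ≠ 0 := fun h => by
    have := (hS 0).1
    rw [hκ.1, hκ.2, h, zero_mul, zero_mul, norm_zero, add_zero, mul_zero] at this
    linarith
  have heq : ∀ x, 0 ≤ x → F x = κ * F' x ∧ G x = κ * G' x := fun x hx => by
    have := eq_zero_of_lax_x (l := l) (u := V) (f := fun x => F x - κ * F' x)
      (g := fun x => G x - κ * G' x)
      (fun x => ((hFG x).1.sub ((hFG' x).1.const_mul κ)).congr_deriv (by ring))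
      (fun x => ((hFG x).2.sub ((hFG' x).2.const_mul κ)).congr_deriv (by ring))
      ⟨sub_eq_zero.2 hκ.1, sub_eq_zero.2 hκ.2⟩ hx
    exact ⟨sub_eq_zero.1 this.1, sub_eq_zero.1 this.2⟩
  have hκn := norm_pos_iff.2 hκ0
  have hc : ‖κ‖ * (n / M) ≤ 0 := by
    refine ge_of_tendsto hlim ?_
    filter_upwards [eventually_ge_atTop 0] with x hx
    rw [(heq x hx).1, (heq x hx).2, norm_mul, norm_mul, ← mul_add]
    exact mul_le_mul_of_nonneg_left (hlo' x) hκn.le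
  have : 0 < ‖κ‖ * (n / M) := by positivity
  linarith

/-! ### Bounds for the one-fold Darboux matrix -/

/-- The Darboux matrix is l - l'R with R² = 1, so l + l'R inverts it up to the factor l² - l'². For
real a and b the entries of R are at most 1 in absolute value. -/
theorem darbouxVec_bounds {l : ℂ} {l' a b : ℝ} (h0 : a ^ 2 + b ^ 2 ≠ 0) (v : Fin 2 → ℂ) :
    ‖l ^ 2 - l' ^ 2‖ * (‖v 0‖ + ‖v 1‖) ≤ (‖l‖ + 2 * |l'|) *
      (‖darbouxVec l' l ![a, b] v 0‖ + ‖darbouxVec l' l ![a, b] v 1‖) ∧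
    ‖darbouxVec l' l ![a, b] v 0‖ + ‖darbouxVec l' l ![a, b] v 1‖ ≤
      (‖l‖ + 2 * |l'|) * (‖v 0‖ + ‖v 1‖) := by
  have hpos : 0 < a ^ 2 + b ^ 2 := lt_of_le_of_ne (by positivity) (Ne.symm h0)
  set g : ℝ := (a ^ 2 - b ^ 2) / (a ^ 2 + b ^ 2) with hg
  set s : ℝ := 2 * a * b / (a ^ 2 + b ^ 2) with hs
  have hg1 : |g| ≤ 1 := by
    rw [hg, abs_div, abs_of_pos hpos, div_le_one hpos, abs_le]
    constructor <;> nlinarith [sq_nonneg a, sq_nonneg b]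
  have hs1 : |s| ≤ 1 := by
    rw [hs, abs_div, abs_of_pos hpos, div_le_one hpos, abs_le]
    constructor <;> nlinarith [sq_nonneg (a + b), sq_nonneg (a - b)]
  have hsg : s ^ 2 + g ^ 2 = 1 := by
    rw [hs, hg]; field_simp; ring
  have hsg' : (s : ℂ) ^ 2 + (g : ℂ) ^ 2 = 1 := by exact_mod_cast hsg
  have e0 : darbouxVec l' l ![a, b] v 0 = l * v 0 - l' * (g * v 0 + s * v 1) := by
    rw [hg, hs]; push_cast; rfl
  have e1 : darbouxVec l' l ![a, b] v 1 = l * v 1 - l' * (s * v 0 - g * v 1) := by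
    rw [hg, hs]; push_cast; rfl
  set A := darbouxVec l' l ![a, b] v 0
  set B := darbouxVec l' l ![a, b] v 1
  have key : ∀ x y : ℂ, ‖(g : ℂ) * x + s * y‖ ≤ ‖x‖ + ‖y‖ ∧ ‖(s : ℂ) * x - g * y‖ ≤ ‖x‖ + ‖y‖ := by
    intro x y
    have t1 := norm_add_le ((g : ℂ) * x) (s * y)
    have t2 := norm_sub_le ((s : ℂ) * x) (g * y)
    simp only [norm_mul, Complex.norm_real, Real.norm_eq_abs] at t1 t2
    have := norm_nonneg x
    have := norm_nonneg y
    constructor <;> nlinarith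
  constructor
  · have f0 : (l ^ 2 - l' ^ 2) * v 0 = l * A + l' * (g * A + s * B) := by
      rw [e0, e1]; linear_combination (l' : ℂ) ^ 2 * v 0 * hsg'
    have f1 : (l ^ 2 - l' ^ 2) * v 1 = l * B + l' * (s * A - g * B) := by
      rw [e0, e1]; linear_combination (l' : ℂ) ^ 2 * v 1 * hsg'
    have n0 := norm_add_le (l * A) (l' * (g * A + s * B))
    have n1 := norm_add_le (l * B) (l' * (s * A - g * B))
    rw [← f0] at n0
    rw [← f1] at n1
    simp only [norm_mul, Complex.norm_real, Real.norm_eq_abs] at n0 n1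
    have k0 := mul_le_mul_of_nonneg_left (key A B).1 (abs_nonneg l')
    have k1 := mul_le_mul_of_nonneg_left (key A B).2 (abs_nonneg l')
    nlinarith
  · have n0 := norm_sub_le (l * v 0) (l' * (g * v 0 + s * v 1))
    have n1 := norm_sub_le (l * v 1) (l' * (s * v 0 - g * v 1))
    rw [← e0] at n0
    rw [← e1] at n1
    simp only [norm_mul, Complex.norm_real, Real.norm_eq_abs] at n0 n1
    have k0 := mul_le_mul_of_nonneg_left (key (v 0) (v 1)).1 (abs_nonneg l')
    have k1 := mul_le_mul_of_nonneg_left (key (v 0) (v 1)).2 (abs_nonneg l')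
    nlinarith

theorem darbouxVec_ne_zero {l : ℂ} {l' a b : ℝ} (h0 : a ^ 2 + b ^ 2 ≠ 0)
    (hll : l ^ 2 - (l' : ℂ) ^ 2 ≠ 0) {v : Fin 2 → ℂ} (hv : v 0 ≠ 0 ∨ v 1 ≠ 0) :
    darbouxVec l' l ![(a : ℂ), b] v 0 ≠ 0 ∨ darbouxVec l' l ![(a : ℂ), b] v 1 ≠ 0 := by
  by_contra! h
  have h1 := (darbouxVec_bounds (l := l) (l' := l') h0 v).1
  rw [h.1, h.2, norm_zero, add_zero, mul_zero] at h1
  have h2 := norm_pos_iff.2 hll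
  rcases hv with hv | hv
  · have := norm_pos_iff.2 hv
    have : 0 < ‖l ^ 2 - (l' : ℂ) ^ 2‖ * (‖v 0‖ + ‖v 1‖) := by positivity
    linarith
  · have := norm_pos_iff.2 hv
    have : 0 < ‖l ^ 2 - (l' : ℂ) ^ 2‖ * (‖v 0‖ + ‖v 1‖) := by positivity
    linarith

theorem darbouxVec_starVec {l : ℂ} {l' a b : ℝ} (v : Fin 2 → ℂ) :
    darbouxVec l' (conj l) ![(a : ℂ), b] (starVec v) =
      starVec (darbouxVec l' l ![(a : ℂ), b] v) := by
  funext i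
  fin_cases i <;> simp [darbouxVec, starVec, map_ofNat]

theorem threeFoldDen_ne_zero {l : ℂ} (hl : l.im ≠ 0) {l' a b : ℝ} (h0 : a ^ 2 + b ^ 2 ≠ 0)
    (hll : l ^ 2 - (l' : ℂ) ^ 2 ≠ 0) {v : Fin 2 → ℂ} (hv : v 0 ≠ 0 ∨ v 1 ≠ 0) :
    threeFoldDen l (conj l) l' v (starVec v) ![(a : ℂ), b] ≠ 0 := by
  have h3 : (![(a : ℂ), b] : Fin 2 → ℂ) 0 ^ 2 + (![(a : ℂ), b] : Fin 2 → ℂ) 1 ^ 2 ≠ 0 := by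
    simp only [Matrix.cons_val_zero, Matrix.cons_val_one]
    exact_mod_cast h0
  rw [← twoFoldDen_darbouxVec h3, darbouxVec_starVec]
  exact mul_ne_zero (twoFoldDen_ne_zero hl (darbouxVec_ne_zero h0 hll hv)) h3

theorem threeFold_eq {l : ℂ} (hl : l.im ≠ 0) {l' a b u : ℝ} (h0 : a ^ 2 + b ^ 2 ≠ 0)
    (hll : l ^ 2 - (l' : ℂ) ^ 2 ≠ 0) {v : Fin 2 → ℂ} (hv : v 0 ≠ 0 ∨ v 1 ≠ 0) :
    threeFold l (conj l) l' u v (starVec v) ![(a : ℂ), b] =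
      ((u + 4 * l' * a * b / (a ^ 2 + b ^ 2) + realTwoFold l (darbouxVec l' l ![(a : ℂ), b] v 0)
        (darbouxVec l' l ![(a : ℂ), b] v 1) : ℝ) : ℂ) := by
  have h3 : (![(a : ℂ), b] : Fin 2 → ℂ) 0 ^ 2 + (![(a : ℂ), b] : Fin 2 → ℂ) 1 ^ 2 ≠ 0 := by
    simp only [Matrix.cons_val_zero, Matrix.cons_val_one]
    exact_mod_cast h0
  rw [threeFold_eq_iterate h3 (by
    rw [darbouxVec_starVec]
    exact twoFoldDen_ne_zero hl (darbouxVec_ne_zero h0 hll hv)), darbouxVec_starVec, twoFold_eq,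
    oneFold, oneFoldDen]
  simp only [Matrix.cons_val_zero, Matrix.cons_val_one]
  push_cast
  ring

/-! ### The three-fold transformation as a quadratic function of the real eigenfunction -/

/-- The numerator of `threeFold + u`, where `threeFold` is the three-fold transformation of `u`. -/
def sumNum (l₁ l₂ l₃ u : ℂ) (v₁ v₂ v₃ : Fin 2 → ℂ) : ℂ :=
  4 * threeFoldNum l₁ l₂ l₃ v₁ v₂ v₃ + 2 * u * threeFoldDen l₁ l₂ l₃ v₁ v₂ v₃

theorem threeFold_eq_neg_add {l₁ l₂ l₃ u : ℂ} {v₁ v₂ v₃ : Fin 2 → ℂ}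
    (h : threeFoldDen l₁ l₂ l₃ v₁ v₂ v₃ ≠ 0) : threeFold l₁ l₂ l₃ u v₁ v₂ v₃ =
      -u + sumNum l₁ l₂ l₃ u v₁ v₂ v₃ / threeFoldDen l₁ l₂ l₃ v₁ v₂ v₃ := by
  rw [threeFold, sumNum, add_div, mul_div_cancel_right₀ _ h]
  ring

/-- `F` is a quadratic form. -/
def IsQuad (F : (Fin 2 → ℂ) → ℂ) : Prop :=
  ∃ A B C : ℂ, ∀ v, F v = A * v 0 ^ 2 + B * (v 0 * v 1) + C * v 1 ^ 2

/-- Polarization expresses every coefficient through values of F, so continuity, periodicity and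
reality of the coefficients are inherited from F. -/
theorem IsQuad.expand {F : (Fin 2 → ℂ) → ℂ} (h : IsQuad F) (T a₀ a₁ b₀ b₁ : ℂ) :
    F ![T * a₀ + b₀, T * a₁ + b₁] = F ![b₀, b₁] +
      (F ![a₀ + b₀, a₁ + b₁] - F ![a₀, a₁] - F ![b₀, b₁]) * T + F ![a₀, a₁] * T ^ 2 := by
  obtain ⟨A, B, C, h⟩ := h
  simp only [h, Matrix.cons_val_zero, Matrix.cons_val_one]
  ring

theorem isQuad_threeFoldDen (l₁ l₂ l₃ : ℂ) (v₁ v₂ : Fin 2 → ℂ) :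
    IsQuad (threeFoldDen l₁ l₂ l₃ v₁ v₂) := by
  refine ⟨threeFoldDen l₁ l₂ l₃ v₁ v₂ ![1, 0],
    threeFoldDen l₁ l₂ l₃ v₁ v₂ ![1, 1] - threeFoldDen l₁ l₂ l₃ v₁ v₂ ![1, 0] -
      threeFoldDen l₁ l₂ l₃ v₁ v₂ ![0, 1],
    threeFoldDen l₁ l₂ l₃ v₁ v₂ ![0, 1], fun v => ?_⟩
  simp only [threeFoldDen, Matrix.cons_val_zero, Matrix.cons_val_one]
  ring

theorem isQuad_threeFoldNum (l₁ l₂ l₃ : ℂ) (v₁ v₂ : Fin 2 → ℂ) :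
    IsQuad (threeFoldNum l₁ l₂ l₃ v₁ v₂) := by
  refine ⟨threeFoldNum l₁ l₂ l₃ v₁ v₂ ![1, 0],
    threeFoldNum l₁ l₂ l₃ v₁ v₂ ![1, 1] - threeFoldNum l₁ l₂ l₃ v₁ v₂ ![1, 0] -
      threeFoldNum l₁ l₂ l₃ v₁ v₂ ![0, 1],
    threeFoldNum l₁ l₂ l₃ v₁ v₂ ![0, 1], fun v => ?_⟩
  simp only [threeFoldNum, Matrix.cons_val_zero, Matrix.cons_val_one]
  ring

theorem isQuad_sumNum (l₁ l₂ l₃ u : ℂ) (v₁ v₂ : Fin 2 → ℂ) :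
    IsQuad (sumNum l₁ l₂ l₃ u v₁ v₂) := by
  obtain ⟨A, B, C, h⟩ := isQuad_threeFoldNum l₁ l₂ l₃ v₁ v₂
  obtain ⟨A', B', C', h'⟩ := isQuad_threeFoldDen l₁ l₂ l₃ v₁ v₂
  refine ⟨4 * A + 2 * u * A', 4 * B + 2 * u * B', 4 * C + 2 * u * C', fun v => ?_⟩
  rw [sumNum, h, h']
  ring

theorem threeFoldDen_im (l : ℂ) (l' a b : ℝ) (v : Fin 2 → ℂ) :
    (threeFoldDen l (conj l) l' v (starVec v) ![(a : ℂ), b]).im = 0 := by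
  rw [← Complex.conj_eq_iff_im]
  simp only [threeFoldDen, starVec, Matrix.cons_val_zero, Matrix.cons_val_one, map_add, map_sub,
    map_mul, map_pow, Complex.conj_conj, Complex.conj_ofReal, map_ofNat]
  ring

theorem threeFoldNum_im (l : ℂ) (l' a b : ℝ) (v : Fin 2 → ℂ) :
    (threeFoldNum l (conj l) l' v (starVec v) ![(a : ℂ), b]).im = 0 := by
  rw [← Complex.conj_eq_iff_im]
  simp only [threeFoldNum, starVec, Matrix.cons_val_zero, Matrix.cons_val_one, map_add, map_sub,
    map_mul, map_pow, Complex.conj_conj, Complex.conj_ofReal, map_ofNat]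
  ring

theorem sumNum_im (l : ℂ) (l' u a b : ℝ) (v : Fin 2 → ℂ) :
    (sumNum l (conj l) l' u v (starVec v) ![(a : ℂ), b]).im = 0 := by
  have h1 : (4 : ℂ) = ((4 : ℝ) : ℂ) := by norm_num
  have h2 : (2 : ℂ) * u = ((2 * u : ℝ) : ℂ) := by push_cast; ring
  rw [sumNum, h1, h2, Complex.add_im, Complex.im_ofReal_mul, Complex.im_ofReal_mul,
    threeFoldNum_im, threeFoldDen_im]
  ring

/-- Eigenfunctions are periodic only up to sign; being even in each vector, the expression is truly
periodic. -/
theorem threeFoldDen_sign {l₁ l₂ l₃ s s' : ℂ} (hs : s = 1 ∨ s = -1) (hs' : s' = 1 ∨ s' = -1)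
    (p q a b : ℂ) :
    threeFoldDen l₁ l₂ l₃ ![s * p, s * q] (starVec ![s * p, s * q]) ![s' * a, s' * b] =
      threeFoldDen l₁ l₂ l₃ ![p, q] (starVec ![p, q]) ![a, b] := by
  simp only [threeFoldDen, starVec, Matrix.cons_val_zero, Matrix.cons_val_one]
  rcases hs with rfl | rfl <;> rcases hs' with rfl | rfl <;> simp only [map_mul, map_one, map_neg] <;>
    ring

theorem threeFoldNum_sign {l₁ l₂ l₃ s s' : ℂ} (hs : s = 1 ∨ s = -1) (hs' : s' = 1 ∨ s' = -1)
    (p q a b : ℂ) :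
    threeFoldNum l₁ l₂ l₃ ![s * p, s * q] (starVec ![s * p, s * q]) ![s' * a, s' * b] =
      threeFoldNum l₁ l₂ l₃ ![p, q] (starVec ![p, q]) ![a, b] := by
  simp only [threeFoldNum, starVec, Matrix.cons_val_zero, Matrix.cons_val_one]
  rcases hs with rfl | rfl <;> rcases hs' with rfl | rfl <;> simp only [map_mul, map_one, map_neg] <;>
    ring

theorem continuous_threeFoldDen {l₁ l₂ l₃ : ℂ} {p q a b : ℝ → ℂ} (hp : Continuous p)
    (hq : Continuous q) (ha : Continuous a) (hb : Continuous b) :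
    Continuous fun y => threeFoldDen l₁ l₂ l₃ ![p y, q y] (starVec ![p y, q y]) ![a y, b y] := by
  have hp' : Continuous fun y => conj (p y) := Complex.continuous_conj.comp hp
  have hq' : Continuous fun y => conj (q y) := Complex.continuous_conj.comp hq
  simp only [threeFoldDen, starVec, Matrix.cons_val_zero, Matrix.cons_val_one]
  fun_prop

theorem continuous_threeFoldNum {l₁ l₂ l₃ : ℂ} {p q a b : ℝ → ℂ} (hp : Continuous p)
    (hq : Continuous q) (ha : Continuous a) (hb : Continuous b) :
    Continuous fun y => threeFoldNum l₁ l₂ l₃ ![p y, q y] (starVec ![p y, q y]) ![a y, b y] := by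
  have hp' : Continuous fun y => conj (p y) := Complex.continuous_conj.comp hp
  have hq' : Continuous fun y => conj (q y) := Complex.continuous_conj.comp hq
  simp only [threeFoldNum, starVec, Matrix.cons_val_zero, Matrix.cons_val_one]
  fun_prop

/-! ### The transformations of the periodic eigenfunctions -/

/-- On periodic eigenfunctions the derivative u₁ enters only through products of two differences p²
- q², so the energy relation removes it and a polynomial identity in u remains. Hence the three-fold
transformation reflects u to -u. -/
theorem sumNum_eq_zero {l₁ l₂ l₃ u u₁ c e k₁ k₂ k₃ : ℂ} {v₁ v₂ v₃ : Fin 2 → ℂ}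
    (hc : c = 2 * (l₁ ^ 2 + l₂ ^ 2 + l₃ ^ 2)) (he : e = 4 * l₁ * l₂ * l₃)
    (hu : u₁ ^ 2 = -u ^ 4 + c * u ^ 2 + 2 * e * u -
      (l₃ ^ 2 - (l₁ + l₂) ^ 2) * (l₃ ^ 2 - (l₁ - l₂) ^ 2))
    (hP₁ : v₁ 0 ^ 2 + v₁ 1 ^ 2 = k₁ * (2 * (4 * l₁ ^ 2 * u + e)))
    (hQ₁ : v₁ 0 ^ 2 - v₁ 1 ^ 2 = k₁ * (4 * l₁ * u₁))
    (hn₁ : v₁ 0 * v₁ 1 = -(k₁ * (l₁ * (4 * l₁ ^ 2 + 2 * u ^ 2 - c))))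
    (hP₂ : v₂ 0 ^ 2 + v₂ 1 ^ 2 = k₂ * (2 * (4 * l₂ ^ 2 * u + e)))
    (hQ₂ : v₂ 0 ^ 2 - v₂ 1 ^ 2 = k₂ * (4 * l₂ * u₁))
    (hn₂ : v₂ 0 * v₂ 1 = -(k₂ * (l₂ * (4 * l₂ ^ 2 + 2 * u ^ 2 - c))))
    (hP₃ : v₃ 0 ^ 2 + v₃ 1 ^ 2 = k₃ * (2 * (4 * l₃ ^ 2 * u + e)))
    (hQ₃ : v₃ 0 ^ 2 - v₃ 1 ^ 2 = k₃ * (4 * l₃ * u₁))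
    (hn₃ : v₃ 0 * v₃ 1 = -(k₃ * (l₃ * (4 * l₃ ^ 2 + 2 * u ^ 2 - c)))) :
    sumNum l₁ l₂ l₃ u v₁ v₂ v₃ = 0 := by
  rw [sumNum, threeFoldNum_eq l₁ l₂ l₃ v₁ v₂ v₃ hP₁.symm hP₂.symm hP₃.symm hQ₁.symm hQ₂.symm
    hQ₃.symm hn₁.symm hn₂.symm hn₃.symm, threeFoldDen_eq l₁ l₂ l₃ v₁ v₂ v₃ hP₁.symm hP₂.symm
    hP₃.symm hQ₁.symm hQ₂.symm hQ₃.symm hn₁.symm hn₂.symm hn₃.symm]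
  subst he
  subst hc
  have h2 : ∀ k k' l l' : ℂ, k * (4 * l * u₁) * (k' * (4 * l' * u₁)) = k * k' * (16 * l * l') *
      (-u ^ 4 + 2 * (l₁ ^ 2 + l₂ ^ 2 + l₃ ^ 2) * u ^ 2 + 2 * (4 * l₁ * l₂ * l₃) * u -
      (l₃ ^ 2 - (l₁ + l₂) ^ 2) * (l₃ ^ 2 - (l₁ - l₂) ^ 2)) := fun k k' l l' => by
    rw [← hu]; ring
  rw [h2, h2, h2]
  ring

/-- On eigenfunctions the denominator collapses to 64k₁k₂l₁l₂(l₁² - l₂²)²(l₁l₂ + l₃u). Its last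
factor is the denominator of the Möbius relation `hw`. -/
theorem twoFold_eigen {l₁ l₂ l₃ u u₁ c e k₁ k₂ w : ℂ} {v₁ v₂ : Fin 2 → ℂ}
    (hc : c = 2 * (l₁ ^ 2 + l₂ ^ 2 + l₃ ^ 2)) (he : e = 4 * l₁ * l₂ * l₃)
    (hu : u₁ ^ 2 = -u ^ 4 + c * u ^ 2 + 2 * e * u -
      (l₃ ^ 2 - (l₁ + l₂) ^ 2) * (l₃ ^ 2 - (l₁ - l₂) ^ 2))
    (hP₁ : v₁ 0 ^ 2 + v₁ 1 ^ 2 = k₁ * (2 * (4 * l₁ ^ 2 * u + e)))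
    (hQ₁ : v₁ 0 ^ 2 - v₁ 1 ^ 2 = k₁ * (4 * l₁ * u₁))
    (hn₁ : v₁ 0 * v₁ 1 = -(k₁ * (l₁ * (4 * l₁ ^ 2 + 2 * u ^ 2 - c))))
    (hP₂ : v₂ 0 ^ 2 + v₂ 1 ^ 2 = k₂ * (2 * (4 * l₂ ^ 2 * u + e)))
    (hQ₂ : v₂ 0 ^ 2 - v₂ 1 ^ 2 = k₂ * (4 * l₂ * u₁))
    (hn₂ : v₂ 0 * v₂ 1 = -(k₂ * (l₂ * (4 * l₂ ^ 2 + 2 * u ^ 2 - c))))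
    (hw : w * (l₁ * l₂ + l₃ * u) = -(l₁ * l₂ * u) + l₃ * (l₃ ^ 2 - l₁ ^ 2 - l₂ ^ 2))
    (hd : twoFoldDen l₁ l₂ v₁ v₂ ≠ 0) : twoFold l₁ l₂ u v₁ v₂ = w := by
  have e1 : twoFoldDen l₁ l₂ v₁ v₂ =
      (l₁ ^ 2 + l₂ ^ 2) * ((v₁ 0 ^ 2 + v₁ 1 ^ 2) * (v₂ 0 ^ 2 + v₂ 1 ^ 2)) -
        2 * l₁ * l₂ * (4 * ((v₁ 0 * v₁ 1) * (v₂ 0 * v₂ 1)) +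
          (v₁ 0 ^ 2 - v₁ 1 ^ 2) * (v₂ 0 ^ 2 - v₂ 1 ^ 2)) := by
    rw [twoFoldDen]; ring
  rw [hP₁, hP₂, hQ₁, hQ₂, hn₁, hn₂] at e1
  subst he
  subst hc
  have e2 : twoFoldDen l₁ l₂ v₁ v₂ =
      64 * k₁ * k₂ * l₁ * l₂ * (l₁ ^ 2 - l₂ ^ 2) ^ 2 * (l₁ * l₂ + l₃ * u) := by
    rw [e1]
    linear_combination (-32 * k₁ * k₂ * l₁ ^ 2 * l₂ ^ 2) * hu
  have e3 : 4 * (l₁ ^ 2 - l₂ ^ 2) * (l₁ * v₁ 0 * v₁ 1 * (v₂ 0 ^ 2 + v₂ 1 ^ 2) -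
      l₂ * v₂ 0 * v₂ 1 * (v₁ 0 ^ 2 + v₁ 1 ^ 2)) = 4 * (l₁ ^ 2 - l₂ ^ 2) *
      (l₁ * (v₁ 0 * v₁ 1) * (v₂ 0 ^ 2 + v₂ 1 ^ 2) -
        l₂ * (v₂ 0 * v₂ 1) * (v₁ 0 ^ 2 + v₁ 1 ^ 2)) := by ring
  rw [hP₁, hP₂, hn₁, hn₂] at e3
  rw [twoFold, hP₁, hP₂, e3, ← eq_sub_iff_add_eq', div_eq_iff hd, e2]
  linear_combination (-64 * k₁ * k₂ * l₁ * l₂ * (l₁ ^ 2 - l₂ ^ 2) ^ 2) * hw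

/-- For the point where U = λ₁ + λ₂ + λ₃ and all eigenfunctions point along (1, -1). The third
vector enters only through its component sum, to which its eigenfunction part does not contribute.
-/
theorem sumNum_of_neg (l₁ l₂ l₃ p p' a b : ℂ) :
    sumNum l₁ l₂ l₃ (l₁ + l₂ + l₃) ![p, -p] ![p', -p'] ![a, b] =
      8 * p ^ 2 * p' ^ 2 * (l₁ - l₂) ^ 2 * l₃ * (l₁ + l₃) ^ 2 * (l₂ + l₃) ^ 2 * (a + b) ^ 2 := by
  simp only [sumNum, threeFoldNum, threeFoldDen, Matrix.cons_val_zero, Matrix.cons_val_one]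
  ring

/-- The hypothesis makes (p + q)² vanish. -/
theorem EigenPair.snd_eq_neg {U U₁ : ℝ → ℝ} {c e : ℝ} {l k : ℂ} {p q : ℝ → ℂ}
    (h : EigenPair U U₁ c e l k p q) {y : ℝ}
    (hy : 4 * l ^ 2 * U y + e = l * (4 * l ^ 2 + 2 * U y ^ 2 - c)) : q y = -p y := by
  have hs := h.sum y
  have hp := h.prod y
  rw [eigenDen, hy] at hs
  have : (p y + q y) ^ 2 = 0 := by linear_combination hs + 2 * hp
  exact eq_neg_of_add_eq_zero_right (pow_eq_zero_iff two_ne_zero |>.1 this)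

/-! ### The three-fold transformation with a complex pair and a real eigenvalue -/

/-- The denominator of the three-fold transformation, for a complex eigenfunction `(p, q)`, its
conjugate, and a real eigenfunction `(a, b)`. -/
def realThreeFoldDen (l : ℂ) (l' : ℝ) (p q : ℂ) (a b : ℝ) : ℝ :=
  (threeFoldDen l (conj l) l' ![p, q] (starVec ![p, q]) ![(a : ℂ), b]).re

/-- The numerator of the sum of a potential and its three-fold transformation. -/
def realSumNum (l : ℂ) (l' u : ℝ) (p q : ℂ) (a b : ℝ) : ℝ :=
  (sumNum l (conj l) l' u ![p, q] (starVec ![p, q]) ![(a : ℂ), b]).re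

section

variable {l : ℂ} {l' u a b : ℝ} {p q : ℂ}

theorem ofReal_realThreeFoldDen : (realThreeFoldDen l l' p q a b : ℂ) =
    threeFoldDen l (conj l) l' ![p, q] (starVec ![p, q]) ![(a : ℂ), b] :=
  Complex.ext rfl (by rw [threeFoldDen_im, Complex.ofReal_im])

theorem ofReal_realSumNum : (realSumNum l l' u p q a b : ℂ) =
    sumNum l (conj l) l' u ![p, q] (starVec ![p, q]) ![(a : ℂ), b] :=
  Complex.ext rfl (by rw [sumNum_im, Complex.ofReal_im])

theorem realThreeFoldDen_expand (T a₀ a₁ b₀ b₁ : ℝ) :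
    realThreeFoldDen l l' p q (T * a₀ + b₀) (T * a₁ + b₁) = realThreeFoldDen l l' p q b₀ b₁ +
      (realThreeFoldDen l l' p q (a₀ + b₀) (a₁ + b₁) - realThreeFoldDen l l' p q a₀ a₁ -
        realThreeFoldDen l l' p q b₀ b₁) * T + realThreeFoldDen l l' p q a₀ a₁ * T ^ 2 := by
  apply Complex.ofReal_injective
  push_cast
  simp only [ofReal_realThreeFoldDen]
  push_cast
  exact (isQuad_threeFoldDen _ _ _ _ _).expand _ _ _ _ _

theorem realSumNum_expand (T a₀ a₁ b₀ b₁ : ℝ) :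
    realSumNum l l' u p q (T * a₀ + b₀) (T * a₁ + b₁) = realSumNum l l' u p q b₀ b₁ +
      (realSumNum l l' u p q (a₀ + b₀) (a₁ + b₁) - realSumNum l l' u p q a₀ a₁ -
        realSumNum l l' u p q b₀ b₁) * T + realSumNum l l' u p q a₀ a₁ * T ^ 2 := by
  apply Complex.ofReal_injective
  push_cast
  simp only [ofReal_realSumNum]
  push_cast
  exact (isQuad_sumNum _ _ _ _ _ _).expand _ _ _ _ _

end

theorem contPer_realThreeFoldDen {l : ℂ} {l' L : ℝ} {p q : ℝ → ℂ} {a b : ℝ → ℝ} {s s' : ℂ}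
    (hp : Continuous p) (hq : Continuous q) (ha : Continuous a) (hb : Continuous b)
    (hs : s = 1 ∨ s = -1) (hs' : s' = 1 ∨ s' = -1)
    (hpq : ∀ y, p (y + L) = s * p y ∧ q (y + L) = s * q y)
    (hab : ∀ y, (a (y + L) : ℂ) = s' * a y ∧ (b (y + L) : ℂ) = s' * b y) :
    ContPer L fun y => realThreeFoldDen l l' (p y) (q y) (a y) (b y) where
  continuous := Complex.continuous_re.comp (continuous_threeFoldDen hp hq
    (Complex.continuous_ofReal.comp ha) (Complex.continuous_ofReal.comp hb))
  periodic y := by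
    rw [realThreeFoldDen, (hpq y).1, (hpq y).2, (hab y).1, (hab y).2,
      threeFoldDen_sign hs hs', ← realThreeFoldDen]

theorem contPer_realSumNum {l : ℂ} {l' L : ℝ} {u : ℝ → ℝ} {p q : ℝ → ℂ} {a b : ℝ → ℝ} {s s' : ℂ}
    (hu : ContPer L u) (hp : Continuous p) (hq : Continuous q) (ha : Continuous a)
    (hb : Continuous b) (hs : s = 1 ∨ s = -1) (hs' : s' = 1 ∨ s' = -1)
    (hpq : ∀ y, p (y + L) = s * p y ∧ q (y + L) = s * q y)
    (hab : ∀ y, (a (y + L) : ℂ) = s' * a y ∧ (b (y + L) : ℂ) = s' * b y) :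
    ContPer L fun y => realSumNum l l' (u y) (p y) (q y) (a y) (b y) where
  continuous := by
    have h1 := continuous_threeFoldDen (l₁ := l) (l₂ := conj l) (l₃ := l') hp hq
      (Complex.continuous_ofReal.comp ha) (Complex.continuous_ofReal.comp hb)
    have h2 := continuous_threeFoldNum (l₁ := l) (l₂ := conj l) (l₃ := l') hp hq
      (Complex.continuous_ofReal.comp ha) (Complex.continuous_ofReal.comp hb)
    exact Complex.continuous_re.comp ((continuous_const.mul h2).add
      ((continuous_const.mul (Complex.continuous_ofReal.comp hu.continuous)).mul h1))
  periodic y := by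
    rw [realSumNum, sumNum, hu.periodic, (hpq y).1, (hpq y).2, (hab y).1, (hab y).2,
      threeFoldDen_sign hs hs', threeFoldNum_sign hs hs', ← sumNum, ← realSumNum]

/-! ### Iterating the one-fold and the two-fold transformations -/

/-- The two-fold transformation, with the eigenfunction `(F, G)`, of the one-fold transformation. -/
def realThreeFold (l : ℂ) (l' : ℝ) (u P Q : ℝ → ℝ → ℝ) (F G : ℝ → ℝ → ℂ) (x t : ℝ) : ℝ :=
  realOneFold l' u P Q x t +
    realTwoFold l (darbouxFst l' l (fun x t => P x t) (fun x t => Q x t) F G x t)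
      (darbouxSnd l' l (fun x t => P x t) (fun x t => Q x t) F G x t)

section

variable {l : ℂ} {l' : ℝ} {u P Q : ℝ → ℝ → ℝ} {F G : ℝ → ℝ → ℂ}

theorem contDiff_darboux (hP : ContDiff ℝ ∞ (Function.uncurry P))
    (hQ : ContDiff ℝ ∞ (Function.uncurry Q)) (h0 : ∀ x t, P x t ^ 2 + Q x t ^ 2 ≠ 0)
    (hF : ContDiff ℝ ∞ (Function.uncurry F)) (hG : ContDiff ℝ ∞ (Function.uncurry G)) :
    ContDiff ℝ ∞ (Function.uncurry
      (darbouxFst l' l (fun x t => P x t) (fun x t => Q x t) F G)) ∧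
    ContDiff ℝ ∞ (Function.uncurry
      (darbouxSnd l' l (fun x t => P x t) (fun x t => Q x t) F G)) := by
  have hden : ContDiff ℝ ∞ fun z : ℝ × ℝ => P z.1 z.2 ^ 2 + Q z.1 z.2 ^ 2 :=
    (hP.pow 2).add (hQ.pow 2)
  have hs : ContDiff ℝ ∞ fun z : ℝ × ℝ =>
      ((2 * P z.1 z.2 * Q z.1 z.2 / (P z.1 z.2 ^ 2 + Q z.1 z.2 ^ 2) : ℝ) : ℂ) :=
    Complex.ofRealCLM.contDiff.comp
      (((contDiff_const.mul hP).mul hQ).div hden fun z => h0 z.1 z.2)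
  have hc : ContDiff ℝ ∞ fun z : ℝ × ℝ =>
      (((P z.1 z.2 ^ 2 - Q z.1 z.2 ^ 2) / (P z.1 z.2 ^ 2 + Q z.1 z.2 ^ 2) : ℝ) : ℂ) :=
    Complex.ofRealCLM.contDiff.comp (((hP.pow 2).sub (hQ.pow 2)).div hden fun z => h0 z.1 z.2)
  push_cast at hs hc
  exact ⟨(contDiff_const.mul hF).sub (contDiff_const.mul ((hc.mul hF).add (hs.mul hG))),
    (contDiff_const.mul hG).sub (contDiff_const.mul ((hs.mul hF).sub (hc.mul hG)))⟩

theorem darboux_ne_zero (hll : l ^ 2 - (l' : ℂ) ^ 2 ≠ 0) {x t : ℝ}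
    (h0 : P x t ^ 2 + Q x t ^ 2 ≠ 0) (hFG : F x t ≠ 0 ∨ G x t ≠ 0) :
    darbouxFst l' l (fun x t => P x t) (fun x t => Q x t) F G x t ≠ 0 ∨
      darbouxSnd l' l (fun x t => P x t) (fun x t => Q x t) F G x t ≠ 0 :=
  darbouxVec_ne_zero (v := ![F x t, G x t]) h0 hll hFG

theorem ofReal_realThreeFold (him : l.im ≠ 0) (hll : l ^ 2 - (l' : ℂ) ^ 2 ≠ 0) {x t : ℝ}
    (h0 : P x t ^ 2 + Q x t ^ 2 ≠ 0) (hFG : F x t ≠ 0 ∨ G x t ≠ 0) :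
    (realThreeFold l l' u P Q F G x t : ℂ) = threeFold l (conj l) l' (u x t)
      ![F x t, G x t] (starVec ![F x t, G x t]) ![(P x t : ℂ), Q x t] := by
  rw [threeFold_eq him h0 hll (v := ![F x t, G x t]) hFG]
  rfl

theorem SmoothSol.threeFold (hu : SmoothSol u) (him : l.im ≠ 0)
    (hll : l ^ 2 - (l' : ℂ) ^ 2 ≠ 0) (hP : ContDiff ℝ ∞ (Function.uncurry P))
    (hQ : ContDiff ℝ ∞ (Function.uncurry Q)) (h0 : ∀ x t, P x t ^ 2 + Q x t ^ 2 ≠ 0)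
    (hL : LaxOver l' u (fun x t => P x t) fun x t => Q x t)
    (hF : ContDiff ℝ ∞ (Function.uncurry F)) (hG : ContDiff ℝ ∞ (Function.uncurry G))
    (hFG : ∀ x t, F x t ≠ 0 ∨ G x t ≠ 0) (hL' : LaxOver l u F G) :
    SmoothSol (realThreeFold l l' u P Q F G) := by
  obtain ⟨h1, h2⟩ := hu.oneFold hP hQ h0 hL
  obtain ⟨h3, h4⟩ := contDiff_darboux (l := l) (l' := l') hP hQ h0 hF hG
  exact h1.twoFold him h3 h4 (fun x t => darboux_ne_zero hll (h0 x t) (hFG x t)) (h2 hL')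

/-- The one-fold part is common to both waves, so only two-fold increments are compared. The Darboux
matrix multiplies Wronskians by l² - l'² and shrinks vectors by at most a fixed factor. -/
theorem exists_realThreeFold_sub_le (him : l.im ≠ 0) (hll : l ^ 2 - (l' : ℂ) ^ 2 ≠ 0) :
    ∃ C, 0 < C ∧ ∀ (u P Q : ℝ → ℝ → ℝ) (F G F' G' : ℝ → ℝ → ℂ) (x t : ℝ),
      P x t ^ 2 + Q x t ^ 2 ≠ 0 → (F x t ≠ 0 ∨ G x t ≠ 0) → (F' x t ≠ 0 ∨ G' x t ≠ 0) →
      |realThreeFold l l' u P Q F G x t - realThreeFold l l' u P Q F' G' x t| *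
        ((‖F x t‖ + ‖G x t‖) * (‖F' x t‖ + ‖G' x t‖)) ≤
          C * ‖F x t * G' x t - G x t * F' x t‖ := by
  obtain ⟨C, hC, h⟩ := exists_realTwoFold_sub_le him
  have hn := norm_pos_iff.2 hll
  have hK : 0 < ‖l‖ + 2 * |l'| := by
    have : 0 < ‖l‖ := norm_pos_iff.2 fun h => him (by rw [h, Complex.zero_im])
    positivity
  refine ⟨C * (‖l‖ + 2 * |l'|) ^ 2 / ‖l ^ 2 - (l' : ℂ) ^ 2‖, by positivity,
    fun u P Q F G F' G' x t h0 hFG hFG' => ?_⟩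
  have h1 := h _ _ _ _ (darboux_ne_zero hll h0 hFG) (darboux_ne_zero hll h0 hFG')
  have hw : (![(P x t : ℂ), Q x t] : Fin 2 → ℂ) 0 ^ 2 +
      (![(P x t : ℂ), Q x t] : Fin 2 → ℂ) 1 ^ 2 ≠ 0 := by
    simp only [Matrix.cons_val_zero, Matrix.cons_val_one]
    exact_mod_cast h0
  have h2 := darbouxVec_wronskian (l := l) (l' := l') ![F x t, G x t] ![F' x t, G' x t] hw
  have b1 := (darbouxVec_bounds (l := l) (l' := l') h0 ![F x t, G x t]).1
  have b2 := (darbouxVec_bounds (l := l) (l' := l') h0 ![F' x t, G' x t]).1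
  simp only [realThreeFold, add_sub_add_left_eq_sub]
  set M0 := darbouxFst l' l (fun x t => P x t) (fun x t => Q x t) F G x t
  set M1 := darbouxSnd l' l (fun x t => P x t) (fun x t => Q x t) F G x t
  set N0 := darbouxFst l' l (fun x t => P x t) (fun x t => Q x t) F' G' x t
  set N1 := darbouxSnd l' l (fun x t => P x t) (fun x t => Q x t) F' G' x t
  change M0 * N1 - M1 * N0 = (l ^ 2 - (l' : ℂ) ^ 2) * (F x t * G' x t - G x t * F' x t) at h2
  change ‖l ^ 2 - (l' : ℂ) ^ 2‖ * (‖F x t‖ + ‖G x t‖) ≤ (‖l‖ + 2 * |l'|) * (‖M0‖ + ‖M1‖) at b1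
  change ‖l ^ 2 - (l' : ℂ) ^ 2‖ * (‖F' x t‖ + ‖G' x t‖) ≤ (‖l‖ + 2 * |l'|) * (‖N0‖ + ‖N1‖) at b2
  rw [h2, norm_mul] at h1
  have b3 := mul_le_mul b1 b2 (by positivity) (by positivity)
  rw [div_mul_eq_mul_div, le_div_iff₀ hn]
  refine le_of_mul_le_mul_right ?_ hn
  set Δ := |realTwoFold l M0 M1 - realTwoFold l N0 N1|
  have hΔ : 0 ≤ Δ := abs_nonneg _
  calc _ = Δ * (‖l ^ 2 - (l' : ℂ) ^ 2‖ * (‖F x t‖ + ‖G x t‖) *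
        (‖l ^ 2 - (l' : ℂ) ^ 2‖ * (‖F' x t‖ + ‖G' x t‖))) := by ring
    _ ≤ Δ * ((‖l‖ + 2 * |l'|) * (‖M0‖ + ‖M1‖) * ((‖l‖ + 2 * |l'|) * (‖N0‖ + ‖N1‖))) :=
      mul_le_mul_of_nonneg_left b3 hΔ
    _ = (‖l‖ + 2 * |l'|) ^ 2 * (Δ * ((‖M0‖ + ‖M1‖) * (‖N0‖ + ‖N1‖))) := by ring
    _ ≤ (‖l‖ + 2 * |l'|) ^ 2 * (C * (‖l ^ 2 - (l' : ℂ) ^ 2‖ *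
        ‖F x t * G' x t - G x t * F' x t‖)) := by gcongr
    _ = _ := by ring

end

/-! ### The three-fold transformation contains an algebraic soliton and a rogue wave -/

section

variable {U U₁ : ℝ → ℝ} {c e d L l' τ : ℝ} {l : ℂ}

theorem EigenPair.realSumNum_eq_zero {k : ℂ} {k' : ℝ} {p q : ℝ → ℂ} {a b : ℝ → ℝ}
    (hU : Profile U U₁ c e d L) (hc : (c : ℂ) = 2 * (l ^ 2 + conj l ^ 2 + l' ^ 2))
    (he : (e : ℂ) = 4 * l * conj l * l')
    (hd : (d : ℂ) = (l' ^ 2 - (l + conj l) ^ 2) * (l' ^ 2 - (l - conj l) ^ 2))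
    (h : EigenPair U U₁ c e l k p q)
    (h' : EigenPair U U₁ c e l' k' (fun y => a y) fun y => b y) (y : ℝ) :
    realSumNum l l' (U y) (p y) (q y) (a y) (b y) = 0 := by
  apply Complex.ofReal_injective
  rw [ofReal_realSumNum, Complex.ofReal_zero]
  have hs := h.sum y
  have hf := h.diff y
  have hp := h.prod y
  have hs' := congrArg conj hs
  have hf' := congrArg conj hf
  have hp' := congrArg conj hp
  simp only [eigenDen, map_add, map_sub, map_mul, map_pow, map_neg, Complex.conj_ofReal,
    map_ofNat] at hs' hf' hp'
  have hen : (U₁ y : ℂ) ^ 2 = -(U y : ℂ) ^ 4 + c * (U y : ℂ) ^ 2 + 2 * e * U y - d := by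
    exact_mod_cast hU.energy y
  rw [hd] at hen
  exact sumNum_eq_zero hc he hen hs hf hp hs' hf' hp' (h'.sum y) (h'.diff y) (h'.prod y)

/-- With periodic eigenfunctions for the complex pair, numerator and denominator are quadratic forms
evaluated at T(a, b) + (f, g). The T² coefficient of the numerator of the sum with U is its value on
three periodic eigenfunctions, which is zero, so the deviation from -U is linear over quadratic. -/
theorem isAlgebraicSolitonOn_realThreeFold {k : ℂ} {k' : ℝ} {p q : ℝ → ℂ} {a b h : ℝ → ℝ}
    {P Q : ℝ → ℝ → ℝ} {σ c₀ : ℝ}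
    (hU : Profile U U₁ c e d L) (hl : BranchPoint U c e d l) (hl' : BranchPoint U c e d l')
    (him : l.im ≠ 0) (hll : l ^ 2 - (l' : ℂ) ^ 2 ≠ 0)
    (hc : (c : ℂ) = 2 * (l ^ 2 + conj l ^ 2 + l' ^ 2)) (he : (e : ℂ) = 4 * l * conj l * l')
    (hd : (d : ℂ) = (l' ^ 2 - (l + conj l) ^ 2) * (l' ^ 2 - (l - conj l) ^ 2))
    (hU0 : (U 0 : ℂ) = l + conj l + l') (hE : EigenPair U U₁ c e l k p q)
    (hE' : EigenPair U U₁ c e l' k' (fun y => a y) fun y => b y) (hσ : σ ≠ 0) (hh : ContPer L h)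
    (hPQ : ∀ x t T, T = σ * (x - c₀ * t) + h (x - c * t) →
      P x t = T * a (x - c * t) + b (x - c * t) / (2 * (4 * l' ^ 2 * U (x - c * t) + e)) ∧
      Q x t = T * b (x - c * t) - a (x - c * t) / (2 * (4 * l' ^ 2 * U (x - c * t) + e)))
    (hsol : IsSolution (realThreeFold l l' (travelling U c) P Q
      (fun x t => p (x - c * t)) fun x t => q (x - c * t))) :
    IsAlgebraicSolitonOn (fun y => -U y) c L c₀ (realThreeFold l l' (travelling U c) P Q
      (fun x t => p (x - c * t)) fun x t => q (x - c * t)) := by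
  have hD : ∀ y, 4 * l' ^ 2 * U y + e ≠ 0 := fun y => by exact_mod_cast hl'.den_ne_zero y
  have hD2 : ∀ y, 2 * (4 * l' ^ 2 * U y + e) ≠ 0 := fun y => mul_ne_zero two_ne_zero (hD y)
  have hl0 : (l' : ℂ) ≠ 0 := hl'.ne_zero
  have ha : Continuous a := Complex.continuous_re.comp hE'.continuous.1
  have hb : Continuous b := Complex.continuous_re.comp hE'.continuous.2
  have hab0 : ∀ y, a y ^ 2 + b y ^ 2 ≠ 0 := fun y => by
    have h1 := hE'.sum y
    have h2 : (a y : ℂ) ^ 2 + (b y : ℂ) ^ 2 ≠ 0 := by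
      rw [h1]; exact mul_ne_zero hE'.ne_zero (eigenDen_ne_zero hl' y)
    exact_mod_cast h2
  have hT0 : ∀ y T, (T * a y + b y / (2 * (4 * l' ^ 2 * U y + e))) ^ 2 +
      (T * b y + -(a y / (2 * (4 * l' ^ 2 * U y + e)))) ^ 2 ≠ 0 := fun y T => by
    have h1 : (T * a y + b y / (2 * (4 * l' ^ 2 * U y + e))) ^ 2 +
        (T * b y + -(a y / (2 * (4 * l' ^ 2 * U y + e)))) ^ 2 =
        (a y ^ 2 + b y ^ 2) * (T ^ 2 + (1 / (2 * (4 * l' ^ 2 * U y + e))) ^ 2) := by ring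
    rw [h1]
    have h2 : 0 < (1 / (2 * (4 * l' ^ 2 * U y + e))) ^ 2 :=
      pow_two_pos_of_ne_zero (one_div_ne_zero (hD2 y))
    exact mul_ne_zero (hab0 y) (by positivity)
  have hne := hE.vec_ne_zero hl
  obtain ⟨s, hs, hsp⟩ := hE.antiperiodic hU hl
  obtain ⟨s', hs', hsp'⟩ := hE'.antiperiodic hU hl'
  have hUc := hU.continuous
  set f : ℝ → ℝ := fun y => b y / (2 * (4 * l' ^ 2 * U y + e)) with hf
  set g : ℝ → ℝ := fun y => -(a y / (2 * (4 * l' ^ 2 * U y + e))) with hg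
  have hfc : Continuous f := hb.div (by fun_prop) hD2
  have hgc : Continuous g := (ha.div (by fun_prop) hD2).neg
  have hfg : ∀ y, (f (y + L) : ℂ) = s' * f y ∧ (g (y + L) : ℂ) = s' * g y := fun y => by
    simp only [hf, hg, hU.periodic]
    push_cast
    rw [(hsp' y).1, (hsp' y).2]
    exact ⟨by ring, by ring⟩
  have hafg : ∀ y, ((a (y + L) + f (y + L) : ℝ) : ℂ) = s' * (a y + f y : ℝ) ∧
      ((b (y + L) + g (y + L) : ℝ) : ℂ) = s' * (b y + g y : ℝ) := fun y => by
    push_cast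
    rw [(hsp' y).1, (hsp' y).2, (hfg y).1, (hfg y).2]
    exact ⟨by ring, by ring⟩
  have hcp := hE.continuous
  have hD1 := contPer_realThreeFoldDen (l := l) (l' := l') hcp.1 hcp.2 ha hb hs hs' hsp hsp'
  have hD3 := contPer_realThreeFoldDen (l := l) (l' := l') hcp.1 hcp.2 hfc hgc hs hs' hsp hfg
  have hD4 := contPer_realThreeFoldDen (l := l) (l' := l') hcp.1 hcp.2 (ha.add hfc) (hb.add hgc)
    hs hs' hsp hafg
  have hUp : ContPer L U := ⟨hUc, hU.periodic⟩
  have hS3 := contPer_realSumNum (l := l) (l' := l') hUp hcp.1 hcp.2 hfc hgc hs hs' hsp hfg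
  have hS4 := contPer_realSumNum (l := l) (l' := l') hUp hcp.1 hcp.2 (ha.add hfc) (hb.add hgc)
    hs hs' hsp hafg
  have hS1 : ∀ y, realSumNum l l' (U y) (p y) (q y) (a y) (b y) = 0 :=
    hE.realSumNum_eq_zero hU hc he hd hE'
  have hden : ∀ y {A B : ℝ}, A ^ 2 + B ^ 2 ≠ 0 → realThreeFoldDen l l' (p y) (q y) A B ≠ 0 :=
    fun y A B hAB h1 => threeFoldDen_ne_zero him hAB hll (v := ![p y, q y]) (hne y)
      (by rw [← ofReal_realThreeFoldDen, h1, Complex.ofReal_zero])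
  refine isAlgebraicSolitonOn_of_quadratic (σ := σ) (h := h)
    (n₀ := fun y => realSumNum l l' (U y) (p y) (q y) (f y) (g y))
    (n₁ := fun y => realSumNum l l' (U y) (p y) (q y) (a y + f y) (b y + g y) -
      realSumNum l l' (U y) (p y) (q y) (f y) (g y))
    (d₀ := fun y => realThreeFoldDen l l' (p y) (q y) (f y) (g y))
    (d₁ := fun y => realThreeFoldDen l l' (p y) (q y) (a y + f y) (b y + g y) -
      realThreeFoldDen l l' (p y) (q y) (a y) (b y) -
      realThreeFoldDen l l' (p y) (q y) (f y) (g y))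
    (d₂ := fun y => realThreeFoldDen l l' (p y) (q y) (a y) (b y))
    hU.neg.isPeriodicWave hUc.neg hsol hσ hh hS3 ?_ hD3 ?_ hD1 (fun y => hden y (hab0 y))
    (fun y T => ?_) (fun x t T hT => ?_) ⟨0, fun T => ?_⟩
  · exact ⟨hS4.continuous.sub hS3.continuous, fun y => congrArg₂ _ (hS4.periodic y)
      (hS3.periodic y)⟩
  · exact ⟨(hD4.continuous.sub hD1.continuous).sub hD3.continuous, fun y =>
      congrArg₂ _ (congrArg₂ _ (hD4.periodic y) (hD1.periodic y)) (hD3.periodic y)⟩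
  · rw [← realThreeFoldDen_expand]
    exact hden y (hT0 y T)
  · obtain ⟨e1, e2⟩ := hPQ x t T hT
    have e2' : Q x t = T * b (x - c * t) + g (x - c * t) := by rw [e2]; ring
    have h0 : P x t ^ 2 + Q x t ^ 2 ≠ 0 := by
      rw [e1, e2']; exact hT0 _ T
    have hdx := hden (x - c * t) h0
    have hdx' : threeFoldDen l (conj l) l' ![p (x - c * t), q (x - c * t)]
        (starVec ![p (x - c * t), q (x - c * t)]) ![(P x t : ℂ), Q x t] ≠ 0 := by
      rw [← ofReal_realThreeFoldDen]; exact_mod_cast hdx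
    have hx := ofReal_realThreeFold (u := travelling U c) (F := fun x t => p (x - c * t))
      (G := fun x t => q (x - c * t)) him hll h0 (hne _)
    rw [threeFold_eq_neg_add hdx', travelling, ← ofReal_realThreeFoldDen,
      ← ofReal_realSumNum] at hx
    have hx' : realThreeFold l l' (travelling U c) P Q (fun x t => p (x - c * t))
        (fun x t => q (x - c * t)) x t = -U (x - c * t) +
        realSumNum l l' (U (x - c * t)) (p (x - c * t)) (q (x - c * t)) (P x t) (Q x t) /
        realThreeFoldDen l l' (p (x - c * t)) (q (x - c * t)) (P x t) (Q x t) := by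
      exact_mod_cast hx
    rw [hx', e1, e2']
    change _ + realSumNum _ _ _ _ _ (T * a (x - c * t) + f (x - c * t)) _ /
      realThreeFoldDen _ _ _ _ (T * a (x - c * t) + f (x - c * t)) _ = _
    rw [realThreeFoldDen_expand, realSumNum_expand, hS1, sub_zero, zero_mul, add_zero]
  -- At y = 0, U = λ₁ + λ₂ + λ₃ and the numerator depends only on the component sum of the third
  -- vector. The part T(a, b) contributes nothing, and f + g = -2a/D is not zero.
  · have hb0 : b 0 = -a 0 := by
      have := hE'.snd_eq_neg (y := 0) (by rw [hU0, he, hc]; ring)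
      exact_mod_cast this
    have hq0 : q 0 = -p 0 := hE.snd_eq_neg (y := 0) (by rw [hU0, he, hc]; ring)
    have hp0 : p 0 ≠ 0 := by
      rcases hne 0 with h1 | h1
      · exact h1
      · rw [hq0] at h1; exact neg_ne_zero.1 h1
    have ha0 : a 0 ≠ 0 := fun h1 => hab0 0 (by rw [hb0, h1]; ring)
    have key : ∀ A B : ℝ, (realSumNum l l' (U 0) (p 0) (q 0) A B : ℂ) =
        8 * p 0 ^ 2 * conj (p 0) ^ 2 * (l - conj l) ^ 2 * l' * (l + l') ^ 2 * (conj l + l') ^ 2 *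
          (A + B) ^ 2 := fun A B => by
      have e1 : starVec ![p 0, -p 0] = ![conj (p 0), -conj (p 0)] := by
        funext i
        fin_cases i <;> simp [starVec]
      rw [ofReal_realSumNum, hq0, hU0, e1, sumNum_of_neg]
    have hsum : realSumNum l l' (U 0) (p 0) (q 0) (a 0 + f 0) (b 0 + g 0) =
        realSumNum l l' (U 0) (p 0) (q 0) (f 0) (g 0) := by
      apply Complex.ofReal_injective
      rw [key, key, hb0]
      push_cast
      ring
    rw [hsum, sub_self, zero_mul, add_zero]
    intro h1
    have h2 := key (f 0) (g 0)
    rw [h1, Complex.ofReal_zero] at h2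
    have i1 : l - conj l ≠ 0 := fun h3 => him (by
      have := congrArg Complex.im h3
      simp at this
      linarith)
    have i2 : l + l' ≠ 0 := fun h3 => him (by simpa using congrArg Complex.im h3)
    have i3 : conj l + l' ≠ 0 := fun h3 => him (by simpa using congrArg Complex.im h3)
    have i4 : (f 0 : ℂ) + g 0 ≠ 0 := by
      have : f 0 + g 0 = -2 * a 0 / (2 * (4 * l' ^ 2 * U 0 + e)) := by
        simp only [hf, hg, hb0]; ring
      have h5 : f 0 + g 0 ≠ 0 := by
        rw [this]; exact div_ne_zero (mul_ne_zero (by norm_num) ha0) (hD2 0)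
      exact_mod_cast h5
    have i5 : conj (p 0) ≠ 0 := (map_ne_zero _).2 hp0
    revert h2
    simp [hp0, i1, i2, i3, i4, hl0]

/-- The soliton uses the same real second solution but periodic eigenfunctions for the complex pair.
The constant Wronskian and the growth at λ₁ give uniform convergence to it. -/
theorem exists_isSolitonAndRogueWaveOn_threeFold
    (hU : Profile U U₁ c e d L) (hl : BranchPoint U c e d l) (hl' : BranchPoint U c e d l')
    (him : l.im ≠ 0) (hll : l ^ 2 - (l' : ℂ) ^ 2 ≠ 0)
    (hc : (c : ℂ) = 2 * (l ^ 2 + conj l ^ 2 + l' ^ 2)) (he : (e : ℂ) = 4 * l * conj l * l')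
    (hd : (d : ℂ) = (l' ^ 2 - (l + conj l) ^ 2) * (l' ^ 2 - (l - conj l) ^ 2))
    (hU0 : (U 0 : ℂ) = l + conj l + l') (hτ : (phase U c e l L).im ≠ 0)
    (hτ' : phase U c e l' L = τ) (hτ0 : τ ≠ 0) {ψ ψ' : ℝ → ℝ → Fin 2 → ℂ}
    (hψ : IsSecondSolution U c L l ψ) (hψ' : IsSecondSolution U c L l' ψ')
    (hr : IsRealValued ψ') :
    ∃ v : ℝ → ℝ → ℝ,
      (∀ x t, threeFoldDen l (conj l) l' (ψ x t) (starVec (ψ x t)) (ψ' x t) ≠ 0 ∧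
        (v x t : ℂ) =
          threeFold l (conj l) l' (U (x - c * t)) (ψ x t) (starVec (ψ x t)) (ψ' x t)) ∧
      IsSolitonAndRogueWaveOn (fun y => -U y) c L (c - L / τ) v := by
  obtain ⟨m, M, hm, hlow⟩ := exists_second_lower hU hl hτ hψ
  obtain ⟨p, q, k, C, hE, hφ⟩ := exists_eigenPair_of_isSecondSolution hU hl hψ
  obtain ⟨a, b, k', h, P, Q, hE', hh, hPQ', hPQ, sP, sQ, hlax, h0⟩ :=
    exists_real_second hU hl' hτ' hτ0 hψ' hr
  obtain ⟨s0, s1⟩ := hE.contDiff_second (C := C) hU hl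
  have hlax1 := hE.laxOver_second (C := C) hU hl
  have e0 : secondFst U c e l C p q = fun x t => ψ x t 0 := funext₂ fun x t => (hφ x t).1.symm
  have e1 : secondSnd U c e l C p q = fun x t => ψ x t 1 := funext₂ fun x t => (hφ x t).2.symm
  rw [e0] at s0 hlax1
  rw [e1] at s1 hlax1
  have hne : ∀ x t, ψ x t 0 ≠ 0 ∨ ψ x t 1 ≠ 0 := fun x t => by
    rw [(hφ x t).1, (hφ x t).2]; exact hE.second_ne_zero hl x t
  have hne' : ∀ x t : ℝ, p (x - c * t) ≠ 0 ∨ q (x - c * t) ≠ 0 := fun x t =>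
    hE.vec_ne_zero hl (x - c * t)
  have hlax2 := hE.laxOver hU
  have hv := hU.smoothSol.threeFold him hll sP sQ h0 hlax s0 s1 hne hlax1
  have hs := hU.smoothSol.threeFold him hll sP sQ h0 hlax
    (contDiff_travelling (hE.contDiff hU).1 c) (contDiff_travelling (hE.contDiff hU).2 c) hne' hlax2
  obtain ⟨m', M', hm', hM', hb⟩ := hE.bounds hU hl
  obtain ⟨C₀, hC₀, hcmp⟩ := exists_realThreeFold_sub_le him hll
  have hvec : ∀ x t, ψ x t = ![ψ x t 0, ψ x t 1] := fun x t => by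
    funext i; fin_cases i <;> rfl
  have hvec' : ∀ x t, ψ' x t = ![(P x t : ℂ), Q x t] := fun x t => by
    funext i; fin_cases i
    · exact (hPQ' x t).1
    · exact (hPQ' x t).2
  have hdiff : ∀ x t, |realThreeFold l l' (travelling U c) P Q (fun x t => ψ x t 0)
      (fun x t => ψ x t 1) x t - realThreeFold l l' (travelling U c) P Q
        (fun x t => p (x - c * t)) (fun x t => q (x - c * t)) x t| * (m * |t| - M) ≤
      C₀ * ‖k‖ / m' := fun x t => by
    have h1 := hcmp (travelling U c) P Q (fun x t => ψ x t 0) (fun x t => ψ x t 1)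
      (fun x t => p (x - c * t)) (fun x t => q (x - c * t)) x t (h0 x t) (hne x t) (hne' x t)
    have h2 := hE.wronskian_second (C := C) hl x t
    rw [← (hφ x t).1, ← (hφ x t).2] at h2
    beta_reduce at h1
    rw [show ψ x t 0 * q (x - c * t) - ψ x t 1 * p (x - c * t) = k by linear_combination -h2] at h1
    rw [le_div_iff₀ hm']
    refine le_trans ?_ h1
    rw [mul_assoc]
    refine mul_le_mul_of_nonneg_left ?_ (abs_nonneg _)
    have h3 : m * |t| - M ≤ ‖ψ x t 0‖ + ‖ψ x t 1‖ := by
      nlinarith [hlow x t, abs_nonneg x]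
    exact (mul_le_mul_of_nonneg_right h3 hm'.le).trans
      (mul_le_mul_of_nonneg_left (hb _).1 (by positivity))
  refine ⟨realThreeFold l l' (travelling U c) P Q (fun x t => ψ x t 0) fun x t => ψ x t 1,
    fun x t => ⟨?_, ?_⟩, hv.isSolution, _, isAlgebraicSolitonOn_realThreeFold hU hl hl' him hll hc
      he hd hU0 hE hE' (div_ne_zero hτ0 hU.pos.ne') hh hPQ hs.isSolution, fun t => ?_,
    tendsto_iSup_ofReal hm hdiff tendsto_abs_atTop_atTop,
    tendsto_iSup_ofReal hm hdiff tendsto_abs_atBot_atTop⟩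
  · rw [hvec']
    exact threeFoldDen_ne_zero him (h0 x t) hll (hne x t)
  · rw [ofReal_realThreeFold him hll (h0 x t) (hne x t), ← hvec, ← hvec']
    rfl
  -- At fixed t both waves are two-fold transformations of the same one-fold potential. The Darboux
  -- matrix preserves sizes up to constants, so one vector still grows as x → ∞ and the other
  -- remains bounded above and below.
  · obtain ⟨-, htr⟩ := hU.smoothSol.oneFold sP sQ h0 hlax
    have hx1 := fun x => (htr hlax1 x t).px
    have hx2 := fun x => (htr hlax1 x t).qx
    have hx3 := fun x => (htr hlax2 x t).px
    have hx4 := fun x => (htr hlax2 x t).qx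
    have hK : 0 < ‖l‖ + 2 * |l'| := by
      have : 0 < ‖l‖ := norm_pos_iff.2 hl.ne_zero
      positivity
    have hn := norm_pos_iff.2 hll
    have hlo : ∀ (F G : ℝ → ℝ → ℂ) (x : ℝ), ‖l ^ 2 - (l' : ℂ) ^ 2‖ / (‖l‖ + 2 * |l'|) *
        (‖F x t‖ + ‖G x t‖) ≤
        ‖darbouxFst l' l (fun x t => P x t) (fun x t => Q x t) F G x t‖ +
        ‖darbouxSnd l' l (fun x t => P x t) (fun x t => Q x t) F G x t‖ := fun F G x => by
      rw [div_mul_eq_mul_div, div_le_iff₀ hK, mul_comm (_ + _) (‖l‖ + _)]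
      exact (darbouxVec_bounds (l := l) (l' := l') (h0 x t) ![F x t, G x t]).1
    have hhi : ∀ (F G : ℝ → ℝ → ℂ) (x : ℝ),
        ‖darbouxFst l' l (fun x t => P x t) (fun x t => Q x t) F G x t‖ +
        ‖darbouxSnd l' l (fun x t => P x t) (fun x t => Q x t) F G x t‖ ≤
        (‖l‖ + 2 * |l'|) * (‖F x t‖ + ‖G x t‖) := fun F G x =>
      (darbouxVec_bounds (l := l) (l' := l') (h0 x t) ![F x t, G x t]).2
    have hlim : Tendsto (fun x =>
        ‖darbouxFst l' l (fun x t => P x t) (fun x t => Q x t) (fun x t => ψ x t 0)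
          (fun x t => ψ x t 1) x t‖ +
        ‖darbouxSnd l' l (fun x t => P x t) (fun x t => Q x t) (fun x t => ψ x t 0)
          (fun x t => ψ x t 1) x t‖) atTop atTop := by
      refine tendsto_atTop_mono (fun x => (mul_le_mul_of_nonneg_left (hlow x t)
        (div_nonneg hn.le hK.le)).trans
        (hlo (fun x t => ψ x t 0) (fun x t => ψ x t 1) x)) ?_
      refine Tendsto.const_mul_atTop (by positivity) (tendsto_atTop_add_const_right _ _ ?_)
      exact (tendsto_atTop_add_const_right _ _ tendsto_abs_atTop_atTop).const_mul_atTop hm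
    obtain ⟨x, hx⟩ := exists_realTwoFold_ne (m := ‖l ^ 2 - (l' : ℂ) ^ 2‖ / (‖l‖ + 2 * |l'|) * m')
      (M := (‖l‖ + 2 * |l'|) * M') him (by positivity) hx1 hx2 hx3 hx4
      (fun x => darboux_ne_zero hll (h0 x t) (hne x t))
      (fun x => ⟨(mul_le_mul_of_nonneg_left (hb (x - c * t)).1 (by positivity)).trans
          (hlo (fun x t => p (x - c * t)) (fun x t => q (x - c * t)) x),
        (hhi (fun x t => p (x - c * t)) (fun x t => q (x - c * t)) x).trans
          (mul_le_mul_of_nonneg_left (hb (x - c * t)).2.1 hK.le)⟩) hlim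
    exact ⟨x, fun h1 => hx (add_left_cancel h1)⟩

end

/-! ### Darboux transformations of the cn-type wave -/

section

variable {a b β : ℝ}

theorem isPeriodicWave_cnWave_swap (hβ : β ≠ 0) (hab : a ≠ b) :
    IsPeriodicWave (cnWave b a β) (speed a b β) (period a b β) := by
  have h := (cnWave_profile (a := b) (b := a) hβ hab.symm).isPeriodicWave
  rwa [speed_swap, period_swap] at h

theorem isPeriodicWave_neg_cnWave_swap (hβ : β ≠ 0) (hab : a ≠ b) :
    IsPeriodicWave (fun y => -cnWave b a β y) (speed a b β) (period a b β) := by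
  have h := (cnWave_profile (a := b) (b := a) hβ hab.symm).neg.isPeriodicWave
  rwa [speed_swap, period_swap] at h

theorem lam3_ne_zero (hab' : a ≠ -b) : lam3 a b ≠ 0 := by
  rw [lam3_eq_ofReal, Ne, Complex.ofReal_eq_zero]
  exact fun h => hab' (by linarith)

theorem IsSecond.conj_lam2 {ψ : ℝ → ℝ → Fin 2 → ℂ} (h : IsSecond a b β (lam2 a b β) ψ) :
    IsSecond a b β (lam1 a b β) (conjSol ψ) := by
  have := IsSecondSolution.conj h
  rwa [MKdV.conj_lam2] at this

theorem GrowsLinearly.of_conjSol {φ : ℝ → ℝ → Fin 2 → ℂ} (h : GrowsLinearly (conjSol φ)) :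
    GrowsLinearly φ := by
  obtain ⟨m, M, hm, h⟩ := h
  refine ⟨m, M, hm, fun x t => ?_⟩
  have : ‖conjSol φ x t‖ = ‖φ x t‖ := by
    simp only [Pi.norm_def, conjSol]
    simp
  rw [← this]
  exact h x t

theorem exists_isAlgebraicSolitonOn_cnWave {τ : ℝ} (hβ : β ≠ 0) (hab : a ≠ b) (hab' : a ≠ -b)
    (hτ0 : τ ≠ 0)
    (hτ : phase (cnWave a b β) (speed a b β) (eConst a b β) (lam3 a b) (period a b β) = τ)
    {ψ : ℝ → ℝ → Fin 2 → ℂ} (hψ : IsSecond a b β (lam3 a b) ψ) (hr : IsRealValued ψ) :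
    ∃ v : ℝ → ℝ → ℝ,
      (∀ x t, oneFoldDen (ψ x t) ≠ 0 ∧
        (v x t : ℂ) = oneFold (lam3 a b) (cnWave a b β (x - speed a b β * t)) (ψ x t)) ∧
      IsAlgebraicSolitonOn (fun y => -cnWave b a β y) (speed a b β) (period a b β)
        (speed a b β - period a b β / τ) v := by
  have hU := cnWave_profile (a := a) (b := b) hβ hab
  have hl := branchPoint_lam3 hβ hab hab'
  have hc := (cnWave_profile (a := b) (b := a) hβ hab.symm).continuous
  rw [IsSecond] at hψ
  rw [lam3_eq_ofReal] at hl hτ hψ ⊢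
  refine exists_isAlgebraicSolitonOn_oneFold hU hl hτ hτ0 (isPeriodicWave_neg_cnWave_swap hβ hab)
    hc.neg (fun y => ?_) (y₀ := 0) ?_ hψ hr
  · have := cnWave_swap (a := a) (b := b) hβ hab y
    linear_combination -this
  · have := cnWaveDeriv_sq (a := a) (b := b) hβ 0
    rw [cnWave_zero hβ, sub_self, zero_mul, zero_mul] at this
    exact pow_eq_zero_iff two_ne_zero |>.1 this

/-- The swap relation, rewritten in the eigenvalues and divided by 4λ₃, is the Möbius relation
needed by `twoFold_eigen`. -/
theorem EigenPair.cnWave_swap_eq {k : ℂ} {p q : ℝ → ℂ} (hβ : β ≠ 0) (hab : a ≠ b)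
    (hab' : a ≠ -b)
    (h : EigenPair (cnWave a b β) (cnWaveDeriv a b β) (speed a b β) (eConst a b β) (lam1 a b β) k
      p q) (y : ℝ) :
    cnWave b a β y = cnWave a b β y + realTwoFold (lam1 a b β) (p y) (q y) := by
  have hs := h.sum y
  have hf := h.diff y
  have hp := h.prod y
  have hs' := congrArg conj hs
  have hf' := congrArg conj hf
  have hp' := congrArg conj hp
  simp only [eigenDen, map_add, map_sub, map_mul, map_pow, map_neg, Complex.conj_ofReal,
    map_ofNat, conj_lam1] at hs' hf' hp'
  have hen : (cnWaveDeriv a b β y : ℂ) ^ 2 = -(cnWave a b β y : ℂ) ^ 4 +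
      speed a b β * (cnWave a b β y : ℂ) ^ 2 + 2 * eConst a b β * cnWave a b β y -
      ((a * b * (alphaRoot a b ^ 2 + β ^ 2) : ℝ) : ℂ) := by
    exact_mod_cast (cnWave_profile (a := a) (b := b) hβ hab).energy y
  rw [energy_eq_lam] at hen
  have him : (lam1 a b β).im ≠ 0 := by rw [lam1_im]; exact div_ne_zero hβ two_ne_zero
  have hw : (cnWave b a β y : ℂ) * (lam1 a b β * lam2 a b β + lam3 a b * cnWave a b β y) =
      -(lam1 a b β * lam2 a b β * cnWave a b β y) +
        lam3 a b * (lam3 a b ^ 2 - lam1 a b β ^ 2 - lam2 a b β ^ 2) := by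
    have h1 : (cnWave b a β y : ℂ) * (eConst a b β + (a + b) ^ 2 * cnWave a b β y) =
        -(eConst a b β * cnWave a b β y) + (a + b) ^ 2 / 2 * ((a + b) ^ 2 - speed a b β) := by
      exact_mod_cast cnWave_swap (a := a) (b := b) hβ hab y
    have h2 : (a : ℂ) + b = 2 * lam3 a b := by rw [lam3]; ring
    rw [eConst_eq_lam, speed_eq_lam, h2] at h1
    have h3 : 4 * lam3 a b ≠ 0 := mul_ne_zero (by norm_num) (lam3_ne_zero hab')
    refine mul_left_cancel₀ h3 ?_
    linear_combination h1
  have hvec := h.vec_ne_zero (branchPoint_lam1 hβ hab hab') y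
  have hd := twoFoldDen_ne_zero (v := ![p y, q y]) him hvec
  have key := twoFold_eigen (v₁ := ![p y, q y]) (v₂ := starVec ![p y, q y]) speed_eq_lam
    eConst_eq_lam hen hs hf hp hs' hf' hp' hw (by rw [← conj_lam1]; exact hd)
  rw [← conj_lam1, twoFold_eq] at key
  exact_mod_cast key.symm

theorem EigenPair.snd_zero_eq_neg {k : ℂ} {p q : ℝ → ℂ} (hβ : β ≠ 0)
    (h : EigenPair (cnWave a b β) (cnWaveDeriv a b β) (speed a b β) (eConst a b β) (lam1 a b β) k
      p q) : q 0 = -p 0 := by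
  refine h.snd_eq_neg ?_
  rw [cnWave_zero hβ, speed_eq_lam, eConst_eq_lam]
  linear_combination (4 * lam1 a b β ^ 2 -
    2 * lam1 a b β * (a + (lam1 a b β + lam2 a b β + lam3 a b))) * fst_eq_lam (a := a) (b := b)
      (β := β)

theorem exists_isRogueWaveOn_cnWave (hβ : β ≠ 0) (hab : a ≠ b) (hab' : a ≠ -b)
    (hτ : (phase (cnWave a b β) (speed a b β) (eConst a b β) (lam1 a b β) (period a b β)).im ≠ 0)
    {ψ : ℝ → ℝ → Fin 2 → ℂ} (hψ : IsSecond a b β (lam1 a b β) ψ) :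
    ∃ v : ℝ → ℝ → ℝ,
      (∀ x t, twoFoldDen (lam1 a b β) (lam2 a b β) (ψ x t) (conjSol ψ x t) ≠ 0 ∧
        (v x t : ℂ) = twoFold (lam1 a b β) (lam2 a b β)
          (cnWave a b β (x - speed a b β * t)) (ψ x t) (conjSol ψ x t)) ∧
      IsRogueWaveOn (cnWave b a β) (speed a b β) (period a b β) v := by
  have him : (lam1 a b β).im ≠ 0 := by rw [lam1_im]; exact div_ne_zero hβ two_ne_zero
  have hre : (lam1 a b β).re ≠ 0 := by
    rw [lam1_re]; exact div_ne_zero (sub_ne_zero.2 hab) four_ne_zero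
  rw [← conj_lam1]
  exact exists_isRogueWaveOn_twoFold hre him (cnWave_profile hβ hab)
    (branchPoint_lam1 hβ hab hab') hτ (isPeriodicWave_cnWave_swap hβ hab)
    (fun h => h.cnWave_swap_eq hβ hab hab') (fun h => h.snd_zero_eq_neg hβ) hψ

theorem exists_isSolitonAndRogueWaveOn_cnWave {τ : ℝ} (hβ : β ≠ 0) (hab : a ≠ b) (hab' : a ≠ -b)
    (hτ : (phase (cnWave a b β) (speed a b β) (eConst a b β) (lam1 a b β) (period a b β)).im ≠ 0)
    (hτ0 : τ ≠ 0)
    (hτ' : phase (cnWave a b β) (speed a b β) (eConst a b β) (lam3 a b) (period a b β) = τ)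
    {ψ ψ' : ℝ → ℝ → Fin 2 → ℂ} (hψ : IsSecond a b β (lam1 a b β) ψ)
    (hψ' : IsSecond a b β (lam3 a b) ψ') (hr : IsRealValued ψ') :
    ∃ v : ℝ → ℝ → ℝ,
      (∀ x t, threeFoldDen (lam1 a b β) (lam2 a b β) (lam3 a b) (ψ x t) (conjSol ψ x t)
          (ψ' x t) ≠ 0 ∧
        (v x t : ℂ) = threeFold (lam1 a b β) (lam2 a b β) (lam3 a b)
          (cnWave a b β (x - speed a b β * t)) (ψ x t) (conjSol ψ x t) (ψ' x t)) ∧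
      IsSolitonAndRogueWaveOn (fun y => -cnWave a b β y) (speed a b β) (period a b β)
        (speed a b β - period a b β / τ) v := by
  have him : (lam1 a b β).im ≠ 0 := by rw [lam1_im]; exact div_ne_zero hβ two_ne_zero
  have hl3 := branchPoint_lam3 hβ hab hab'
  have h1 := speed_eq_lam (a := a) (b := b) (β := β)
  have h2 := eConst_eq_lam (a := a) (b := b) (β := β)
  have h3 := energy_eq_lam (a := a) (b := b) (β := β)
  have h4 : (cnWave a b β 0 : ℂ) = lam1 a b β + lam2 a b β + lam3 a b := by
    rw [cnWave_zero hβ, ← fst_eq_lam]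
  -- Since λ₃ is real, it is enough that Im λ₁² = (a - b)β/4 is nonzero.
  have hll : lam1 a b β ^ 2 - lam3 a b ^ 2 ≠ 0 := fun h => by
    have := congrArg Complex.im h
    rw [lam3_eq_ofReal, pow_two, pow_two, Complex.sub_im, Complex.mul_im, Complex.mul_im, lam1_re,
      lam1_im, Complex.ofReal_im, Complex.ofReal_re, Complex.zero_im] at this
    exact mul_ne_zero (sub_ne_zero.2 hab) hβ (by linarith)
  rw [IsSecond] at hψ'
  simp only [← conj_lam1] at h1 h2 h3 h4 ⊢
  simp only [lam3_eq_ofReal] at h1 h2 h3 h4 hl3 hτ' hψ' hll ⊢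
  exact exists_isSolitonAndRogueWaveOn_threeFold (cnWave_profile hβ hab)
    (branchPoint_lam1 hβ hab hab') hl3 him hll h1 h2 h3 h4 hτ hτ' hτ0 hψ hψ' hr

end

end MKdV

end

theorem theorem6 (a b β : ℝ) (hba : b ≤ a) (hne : a ≠ b) (hne' : a ≠ -b) (hβ : β ≠ 0)
    (hnd₁ : (MKdV.mean1 a b β).im ≠ 0) (hnd₃ : MKdV.mean3 a b β ≠ 0) :
    -- second solutions exist; those for `λ₂` include the conjugates of those for `λ₁`
    ((∃ ψ, MKdV.IsSecond a b β (MKdV.lam1 a b β) ψ) ∧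
      (∀ ψ, MKdV.IsSecond a b β (MKdV.lam1 a b β) ψ →
        MKdV.IsSecond a b β (MKdV.lam2 a b β) (MKdV.conjSol ψ)) ∧
      (∃ ψ, MKdV.IsSecond a b β (MKdV.lam3 a b) ψ ∧ MKdV.IsRealValued ψ)) ∧
    -- linear growth everywhere for `λ₁` and `λ₂`
    (∀ ψ, MKdV.IsSecond a b β (MKdV.lam1 a b β) ψ → MKdV.GrowsLinearly ψ) ∧
    (∀ ψ, MKdV.IsSecond a b β (MKdV.lam2 a b β) ψ → MKdV.GrowsLinearly ψ) ∧
    ∃ c₀ : ℝ, c₀ ≠ MKdV.speed a b β ∧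
      -- linear growth for `λ₃` except for a straight line with undetermined phase
      (∀ ψ, MKdV.IsSecond a b β (MKdV.lam3 a b) ψ →
        ∀ ξ₀ : ℝ, MKdV.GrowsLinearlyOffLine c₀ ξ₀ ψ) ∧
      -- one-fold transformation
      (∀ ψ₃, MKdV.IsSecond a b β (MKdV.lam3 a b) ψ₃ → MKdV.IsRealValued ψ₃ →
        ∃ v : ℝ → ℝ → ℝ,
          (∀ x t, MKdV.oneFoldDen (ψ₃ x t) ≠ 0 ∧
            (v x t : ℂ) = MKdV.oneFold (MKdV.lam3 a b)
              (MKdV.cnWave a b β (x - MKdV.speed a b β * t)) (ψ₃ x t)) ∧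
          MKdV.IsAlgebraicSolitonOn (fun y => -MKdV.cnWave b a β y)
            (MKdV.speed a b β) (MKdV.period a b β) c₀ v) ∧
      -- two-fold transformation
      (∀ ψ₁, MKdV.IsSecond a b β (MKdV.lam1 a b β) ψ₁ →
        ∃ v : ℝ → ℝ → ℝ,
          (∀ x t,
            MKdV.twoFoldDen (MKdV.lam1 a b β) (MKdV.lam2 a b β)
              (ψ₁ x t) (MKdV.conjSol ψ₁ x t) ≠ 0 ∧
            (v x t : ℂ) = MKdV.twoFold (MKdV.lam1 a b β) (MKdV.lam2 a b β)
              (MKdV.cnWave a b β (x - MKdV.speed a b β * t))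
              (ψ₁ x t) (MKdV.conjSol ψ₁ x t)) ∧
          MKdV.IsRogueWaveOn (MKdV.cnWave b a β)
            (MKdV.speed a b β) (MKdV.period a b β) v) ∧
      -- three-fold transformation
      (∀ ψ₁ ψ₃, MKdV.IsSecond a b β (MKdV.lam1 a b β) ψ₁ →
        MKdV.IsSecond a b β (MKdV.lam3 a b) ψ₃ → MKdV.IsRealValued ψ₃ →
        ∃ v : ℝ → ℝ → ℝ,
          (∀ x t,
            MKdV.threeFoldDen (MKdV.lam1 a b β) (MKdV.lam2 a b β) (MKdV.lam3 a b)
              (ψ₁ x t) (MKdV.conjSol ψ₁ x t) (ψ₃ x t) ≠ 0 ∧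
            (v x t : ℂ) = MKdV.threeFold (MKdV.lam1 a b β) (MKdV.lam2 a b β) (MKdV.lam3 a b)
              (MKdV.cnWave a b β (x - MKdV.speed a b β * t))
              (ψ₁ x t) (MKdV.conjSol ψ₁ x t) (ψ₃ x t)) ∧
          MKdV.IsSolitonAndRogueWaveOn (fun y => -MKdV.cnWave a b β y)
            (MKdV.speed a b β) (MKdV.period a b β) c₀ v) := by
  have hU := MKdV.cnWave_profile (a := a) (b := b) hβ hne
  have hl₁ := MKdV.branchPoint_lam1 hβ hne hne'
  have hl₃ := MKdV.branchPoint_lam3 hβ hne hne'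
  have hτ₁ := MKdV.phase_lam1_im_ne_zero hnd₁
  obtain ⟨τ, hτ0, hτ₃⟩ := MKdV.exists_phase_lam3 hnd₃
  have hgrow : ∀ ψ, MKdV.IsSecond a b β (MKdV.lam1 a b β) ψ → MKdV.GrowsLinearly ψ :=
    fun ψ hψ => MKdV.growsLinearly_of_isSecondSolution hU hl₁ hτ₁ hψ
  refine ⟨⟨MKdV.exists_isSecondSolution hU hl₁, fun ψ hψ => ?_, ?_⟩, hgrow,
    fun ψ hψ => (hgrow _ hψ.conj_lam2).of_conjSol,
    MKdV.speed a b β - MKdV.period a b β / τ, ?_,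
    fun ψ hψ ξ₀ => MKdV.growsLinearlyOffLine_of_isSecondSolution hU hl₃ hτ₃ hτ0 hψ ξ₀,
    fun ψ hψ hr => MKdV.exists_isAlgebraicSolitonOn_cnWave hβ hne hne' hτ0 hτ₃ hψ hr,
    fun ψ hψ => MKdV.exists_isRogueWaveOn_cnWave hβ hne hne' hτ₁ hψ,
    fun ψ ψ' hψ hψ' hr => MKdV.exists_isSolitonAndRogueWaveOn_cnWave hβ hne hne' hτ₁ hτ0 hτ₃
      hψ hψ' hr⟩
  · have h := MKdV.IsSecondSolution.conj hψ
    rwa [MKdV.conj_lam1] at h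
  · rw [MKdV.lam3_eq_ofReal] at hl₃ ⊢
    exact MKdV.exists_isSecondSolution_real hU hl₃
  · exact fun h => div_ne_zero (MKdV.period_pos hβ).ne' hτ0 (sub_eq_self.1 h)
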